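/- **Setting.** Fix a finite set of unitary gates that contains $\{H,T,\mathrm{CNOT}\}$ and is closed under inverses. A QPT algorithm is a logspace-uniform family of quantum circuits over these gates (with ancilla qubits, and with measurements and discarding of qubits at the end) whose size is polynomial in the number of input qubits and in the security parameter $\lambda$; a PPT algorithm is a logspace-uniform family of polynomial-size classical circuits with uniformly random auxiliary bits. A function $\eta:\mathbb N\to\mathbb R$ is negligible if $\lambda^k\eta(\lambda)\to 0$ for every $k$. Let $\mathcal G$ be a two-player XOR game: finite question sets $I_A,I_B$, a probability distribution $\pi$ on $I_A\times I_B$, answers $a,b\in\{0,1\}$, and predicate $V(x,y,a,b)=\frac12\bigl(1+(-1)^{g(x,y)}(-1)^{a+b}\bigr)$ for some $g:I_A\times I_B\to\{0,1\}$. Its quantum value $\omega_q^*(\mathcal G)$ is the supremum of $$\sum_{x,y}\pi(x,y)\sum_{a,b}V(x,y,a,b)\,\langle\psi|A_{xa}\otimes B_{yb}|\psi\rangle$$ over finite-dimensional Hilbert spaces $\mathcal H_A,\mathcal H_B$, unit vectors $|\psi\rangle\in\mathcal H_A\otimes\mathcal H_B$, and projective measurements $\{A_{xa}\}_a$ on $\mathcal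 H_A$ and $\{B_{yb}\}_b$ on $\mathcal H_B$. Let $\mathrm{QHE}=(\mathrm{Gen},\mathrm{Enc},\mathrm{Eval},\mathrm{Dec})$ be a quantum homomorphic encryption scheme for quantum circuits with classical output: $\mathrm{Gen}$ and $\mathrm{Enc}$ are PPT, $\mathrm{Eval}$ and $\mathrm{Dec}$ are QPT, $\mathrm{Dec}$ is deterministic on classical ciphertexts, and the scheme * is correct with auxiliary input: for polynomial-size circuits $C$, any joint state of registers $A,B$ and any message $x$, running $C$ on $(x,A)$, and encrypting $x$, running $\mathrm{Eval}$ for $C$ on the ciphertext and $A$, and decrypting the result, give output strings and states of $B$ at negligible trace distance; * is CPA secure: no QPT adversary with classical access to the oracle $\mathrm{Enc}(\mathrm{sk},\cdot)$ distinguishes encryptions of two fixed messages of equal length with non-negligible advantage. In the compiled game $\mathcal G_{\mathrm{comp}}$, the verifier samples $(x,y)\leftarrow\pi$, $\mathrm{sk}\leftarrow\mathrm{Gen}(1^\lambda)$ and $c\leftarrow\mathrm{Enc}(\mathrm{sk},x)$ and sends $c$ to a single prover; the prover replies with a classical string $\alpha$; the verifier sends $y$; the prover replies with $b$; the verifier accepts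 iff $a:=\mathrm{Dec}(\mathrm{sk},\alpha)\in\{0,1\}$, $b\in\{0,1\}$ and $V(x,y,a,b)=1$. A quantum strategy $S$ for $\mathcal G_{\mathrm{comp}}$ consists, for each $\lambda$, of a Hilbert space $\mathcal H$ of qubits, a state $|\psi\rangle\in\mathcal H$ preparable in QPT, operators $A_{c\alpha}=U_{c\alpha}P_{c\alpha}$ with QPT-implementable unitaries $U_{c\alpha}$ and QPT-measurable projective measurements $\{P_{c\alpha}\}_\alpha$ (the circuits have $c$, respectively $c$ and $\alpha$, as part of their input), and QPT-measurable projective measurements $\{B_{yb}\}_{b\in\{0,1\}}$ for $y\in I_B$. (A projective measurement is QPT-measurable if some QPT circuit has the same outcome probabilities on every state.) Its winning probability at security parameter $\lambda$ is $$\omega_q(S,\mathcal G_{\mathrm{comp}})=\sum_{x,y}\pi(x,y)\sum_{a,b}V(x,y,a,b)\;\mathop{\mathbb E}_{\substack{\mathrm{sk}\leftarrow\mathrm{Gen}(1^\lambda)\\ c\leftarrow\mathrm{Enc}(\mathrm{sk},x)}}\;\sum_{\alpha:\,\mathrm{Dec}(\mathrm{sk},\alpha)=a}\langle\psi|A_{c\alpha}^*B_{yb}A_{c\alpha}|\psi\rangle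 .$$ **Theorem.** For every XOR game $\mathcal G$, every compiled game $\mathcal G_{\mathrm{comp}}$ of $\mathcal G$, and every quantum strategy $S$ for $\mathcal G_{\mathrm{comp}}$, there is a negligible function $\eta$ such that for all $\lambda\in\mathbb N$ $$\omega_q(S,\mathcal G_{\mathrm{comp}})\le\omega_q^*(\mathcal G)+\eta(\lambda).$$ -/

import Mathlib

open scoped Kronecker

noncomputable section

/-! ## Bit strings and computational basis states -/

/-- Bit strings of length `n`; they also label the computational basis of `n` qubits. -/
abbrev Bits (n : ℕ) : Type := Fin n → Bool

/-- Restrict a bit string to its first `n` bits, or pad it with zeros on the right. -/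
def resize {m : ℕ} (n : ℕ) (s : Bits m) : Bits n :=
  fun i => if h : i.val < m then s ⟨i.val, h⟩ else false

/-- The vector `|c⟩ ⊗ φ`. -/
def ketTensor {m n : ℕ} (c : Bits m) (φ : Bits n → ℂ) : Bits (m + n) → ℂ :=
  fun u => if (fun i => u (Fin.castAdd n i)) = c then φ (fun i => u (Fin.natAdd m i)) else 0

/-- The basis vector `|c⟩`. -/
def ket {m : ℕ} (c : Bits m) : Bits m → ℂ := fun u => if u = c then 1 else 0

/-- The vector `φ ⊗ |0…0⟩` on `w` qubits (used with `m ≤ w`). -/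
def withAncillas {m : ℕ} (w : ℕ) (φ : Bits m → ℂ) : Bits w → ℂ :=
  fun s => if ∀ i : Fin w, m ≤ i.val → s i = false then φ (resize m s) else 0

/-- `⟨φ|M|φ⟩` (its real part; the operators used below are Hermitian). -/
def expval {ι : Type*} [Fintype ι] (φ : ι → ℂ) (M : Matrix ι ι ℂ) : ℝ :=
  (star φ ⬝ᵥ (M.mulVec φ)).re

/-- Projective measurements. -/
structure IsPVM {ι n : Type*} [Fintype ι] [Fintype n] [DecidableEq n]
    (E : ι → Matrix n n ℂ) : Prop where
  hermitian : ∀ i, (E i).IsHermitian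
  idem : ∀ i, E i * E i = E i
  orth : ∀ i j, i ≠ j → E i * E j = 0
  sum_eq_one : ∑ i, E i = 1

/-- The trace norm: the sum of the singular values. -/
def traceNorm {n : Type*} [Fintype n] [DecidableEq n] (M : Matrix n n ℂ) : ℝ :=
  ∑ i, Real.sqrt ((Matrix.isHermitian_conjTranspose_mul_self M).eigenvalues i)

/-- Negligible functions: `o(l ^ (-k))` for every `k`. -/
def Negligible (η : ℕ → ℝ) : Prop :=
  Asymptotics.SuperpolynomialDecay Filter.atTop (fun l : ℕ => (l : ℝ)) η

/-! ## Logarithmic space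

A machine has a finite program and registers holding natural numbers.  Its inputs are given in
unary, so that a run in which every register stays bounded by a polynomial in the inputs is
exactly a run that uses `O(log)` bits of work space. -/

/-- Programs of register machines (a program mentions only finitely many registers). -/
inductive Prog : Type
  | zero (r : ℕ) : Prog
  | copy (r q : ℕ) : Prog
  | inc (r : ℕ) : Prog
  | dec (r : ℕ) : Prog
  | seq (p p' : Prog) : Prog
  | whileNonzero (r : ℕ) (p : Prog) : Prog

/-- `Run B p s s'`: started with register contents `s`, the program `p` halts with contents `s'`,
and no register is ever raised above `B`. -/
inductive Run (B : ℕ) : Prog → (ℕ → ℕ) → (ℕ → ℕ) → Prop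
  | zero (r : ℕ) (s : ℕ → ℕ) : Run B (.zero r) s (Function.update s r 0)
  | copy (r q : ℕ) (s : ℕ → ℕ) : Run B (.copy r q) s (Function.update s r (s q))
  | inc (r : ℕ) (s : ℕ → ℕ) (h : s r + 1 ≤ B) : Run B (.inc r) s (Function.update s r (s r + 1))
  | dec (r : ℕ) (s : ℕ → ℕ) : Run B (.dec r) s (Function.update s r (s r - 1))
  | seq {p p' : Prog} {s s' s'' : ℕ → ℕ} :
      Run B p s s' → Run B p' s' s'' → Run B (.seq p p') s s''
  | while_stop (r : ℕ) (p : Prog) (s : ℕ → ℕ) (h : s r = 0) : Run B (.whileNonzero r p) s s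
  | while_step {r : ℕ} {p : Prog} {s s' s'' : ℕ → ℕ} (h : s r ≠ 0) :
      Run B p s s' → Run B (.whileNonzero r p) s' s'' → Run B (.whileNonzero r p) s s''

/-- The function `f` of `k` numbers, given in unary, is computed in logarithmic space.
Register `i` initially holds the `i`-th input; register `0` holds the result in the end. -/
def LogspaceComputable {k : ℕ} (f : (Fin k → ℕ) → ℕ) : Prop :=
  ∃ (p : Prog) (e : ℕ), ∀ v : Fin k → ℕ, ∃ s : ℕ → ℕ,
    Run (e * (∑ i, v i + 1) ^ e + ∑ i, v i) p
      (fun r => if h : r < k then v ⟨r, h⟩ else 0) s ∧ s 0 = f v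

/-- A family of finite tables of numbers can be written down in logarithmic space: the size of
the table and each of its entries are computable in logarithmic space from the parameters and the
position.  In particular the number of rows, their lengths and all entries are bounded by a
polynomial in the parameters. -/
structure LogspaceUniform {k : ℕ} (D : (Fin k → ℕ) → List (List ℕ)) : Prop where
  rows : LogspaceComputable fun v => (D v).length
  columns : LogspaceComputable fun v : Fin (k + 1) → ℕ =>
    ((D (Fin.tail v)).getD (v 0) []).length
  entries : LogspaceComputable fun v : Fin (k + 2) → ℕ =>
    ((D (Fin.tail (Fin.tail v))).getD (v 0) []).getD (v 1) 0

/-! ## Circuits -/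

/-- Operations that can be placed on `w` wires, with a description by a list of numbers. -/
class OpCode (Op : ℕ → Type) where
  code : ∀ {w : ℕ}, Op w → List ℕ

/-- A circuit: the input is on the first `ins` wires, the other wires start as `0`, the operations
are carried out in the order of the list, and the output is on the first `outs` wires. -/
structure Circuit (Op : ℕ → Type) where
  ins : ℕ
  outs : ℕ
  width : ℕ
  ins_le : ins ≤ width
  outs_le : outs ≤ width
  ops : List (Op width)

/-- The description of a circuit. -/
def Circuit.desc {Op : ℕ → Type} [OpCode Op] (C : Circuit Op) : List (List ℕ) :=
  [C.ins, C.outs, C.width] :: C.ops.map OpCode.code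

/-- Logspace-uniform families of circuits (of polynomial size, by `LogspaceUniform`). -/
def UniformFamily {k : ℕ} {Op : (Fin k → ℕ) → ℕ → Type} [∀ v, OpCode (Op v)]
    (C : ∀ v, Circuit (Op v)) : Prop :=
  LogspaceUniform fun v => (C v).desc

/-- A gate from a list of `N` gates with given arities, placed on distinct wires. -/
structure GateOp {N : ℕ} (arity : Fin N → ℕ) (w : ℕ) where
  gate : Fin N
  wires : Fin (arity gate) ↪ Fin w

instance {N : ℕ} (arity : Fin N → ℕ) : OpCode (GateOp arity) where
  code o := o.gate.val :: List.ofFn fun i => (o.wires i).val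

/-! ### Classical probabilistic circuits -/

/-- The gates NOT, CNOT and Toffoli, numbered by their number of control bits; the last wire is
the target. -/
abbrev ClassicalOp : ℕ → Type := GateOp (N := 3) fun g => g.val + 1

/-- The action of a classical gate. -/
def ClassicalOp.act {w : ℕ} (o : ClassicalOp w) (s : Bits w) : Bits w :=
  Function.update s (o.wires (Fin.last o.gate.val))
    (xor (s (o.wires (Fin.last o.gate.val)))
      (decide (∀ i : Fin o.gate.val, s (o.wires i.castSucc) = true)))

/-- The classical function computed by a classical circuit. -/
def Circuit.classicalRun (C : Circuit ClassicalOp) (u : Bits C.ins) : Bits C.outs :=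
  resize C.outs (C.ops.foldl (fun s o => o.act s) (resize C.width u))

/-- PPT algorithms with `k` numerical parameters: logspace-uniform families of classical circuits
which read the input and a number of uniformly random bits. -/
structure PPT (k : ℕ) (inLen : (Fin k → ℕ) → ℕ) where
  circ : (Fin k → ℕ) → Circuit ClassicalOp
  coins : (Fin k → ℕ) → ℕ
  ins_eq : ∀ v, (circ v).ins = inLen v + coins v
  coins_logspace : LogspaceComputable coins
  uniform : UniformFamily circ

namespace PPT

variable {k : ℕ} {inLen : (Fin k → ℕ) → ℕ}

/-- Length of the output. -/
def outLen (M : PPT k inLen) (v : Fin k → ℕ) : ℕ := (M.circ v).outs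

/-- Output on input `u` with random bits `r`. -/
def run (M : PPT k inLen) (v : Fin k → ℕ) (u : Bits (inLen v)) (r : Bits (M.coins v)) :
    Bits (M.outLen v) :=
  (M.circ v).classicalRun (resize _ (Fin.append u r))

/-- The expectation of `f (y)`, for `y` the random output on input `u`. -/
def expect (M : PPT k inLen) (v : Fin k → ℕ) (u : Bits (inLen v))
    (f : Bits (M.outLen v) → ℝ) : ℝ :=
  (∑ r : Bits (M.coins v), f (M.run v u r)) / 2 ^ M.coins v

/-- `y` is a possible output on input `u`. -/
def CanOutput (M : PPT k inLen) (v : Fin k → ℕ) (u : Bits (inLen v))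
    (y : Bits (M.outLen v)) : Prop :=
  ∃ r, M.run v u r = y

end PPT

/-! ### Quantum circuits -/

/-- The Hadamard gate. -/
def hadamardGate : Matrix (Bits 1) (Bits 1) ℂ :=
  Matrix.of fun s t => (if s 0 = true ∧ t 0 = true then -1 else 1) / (Real.sqrt 2 : ℂ)

/-- The `T` gate `diag (1, exp (i π / 4))`. -/
def tGate : Matrix (Bits 1) (Bits 1) ℂ :=
  Matrix.diagonal fun s => if s 0 = true then Complex.exp (Complex.I * Real.pi / 4) else 1

/-- The CNOT gate, with control `0` and target `1`. -/
def cnotGate : Matrix (Bits 2) (Bits 2) ℂ :=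
  Matrix.of fun s t => if s 0 = t 0 ∧ s 1 = xor (t 1) (t 0) then 1 else 0

/-- A finite set of unitary gates, closed under inverses, that contains the universal gate set
`{H, T, CNOT}`. -/
structure GateSet where
  num : ℕ
  gate : Fin num → (k : ℕ) × Matrix (Bits k) (Bits k) ℂ
  unitary : ∀ g, (gate g).2 ∈ Matrix.unitaryGroup (Bits (gate g).1) ℂ
  inverse : ∀ g, ∃ g', gate g' = ⟨(gate g).1, (gate g).2.conjTranspose⟩
  hadamard_mem : ∃ g, gate g = ⟨1, hadamardGate⟩
  t_mem : ∃ g, gate g = ⟨1, tGate⟩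
  cnot_mem : ∃ g, gate g = ⟨2, cnotGate⟩

/-- The operator on `w` qubits that acts as `M` on the given wires and trivially elsewhere. -/
def onWires {k w : ℕ} (f : Fin k ↪ Fin w) (M : Matrix (Bits k) (Bits k) ℂ) :
    Matrix (Bits w) (Bits w) ℂ :=
  Matrix.of fun s t =>
    if ∀ i, (∀ j, f j ≠ i) → s i = t i then M (fun j => s (f j)) (fun j => t (f j)) else 0

/-- Gates of the gate set `𝒢` placed on wires. -/
abbrev QOp (𝒢 : GateSet) : ℕ → Type := GateOp fun g => (𝒢.gate g).1

/-- The unitary of a placed gate. -/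
def QOp.mat {𝒢 : GateSet} {w : ℕ} (o : QOp 𝒢 w) : Matrix (Bits w) (Bits w) ℂ :=
  onWires o.wires (𝒢.gate o.gate).2

/-- Quantum circuits: unitary gates on the input qubits and on ancillas in state `0`.  (All
measurements and discarding of qubits take place at the end, which is no restriction.) -/
abbrev QCircuit (𝒢 : GateSet) : Type := Circuit (QOp 𝒢)

namespace QCircuit

variable {𝒢 : GateSet}

/-- The unitary of the circuit on all its wires. -/
def mat (C : QCircuit 𝒢) : Matrix (Bits C.width) (Bits C.width) ℂ :=
  C.ops.foldl (fun U o => QOp.mat o * U) 1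

/-- The final pure state of all wires, for input `φ` on the first `m = C.ins` wires. -/
def finalState (C : QCircuit 𝒢) {m : ℕ} (φ : Bits m → ℂ) : Bits C.width → ℂ :=
  C.mat.mulVec (withAncillas C.width φ)

/-- Probability that measuring the first `k = C.outs` wires in the end gives `y`. -/
def outcomeProb (C : QCircuit 𝒢) {m k : ℕ} (φ : Bits m → ℂ) (y : Bits k) : ℝ :=
  ∑ t : Bits C.width, if resize k t = y then ‖C.finalState φ t‖ ^ 2 else 0

/-- The output state: the reduced density matrix of the first `k = C.outs` wires. -/
def outDensity (C : QCircuit 𝒢) {m : ℕ} (k : ℕ) (φ : Bits m → ℂ) :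
    Matrix (Bits k) (Bits k) ℂ :=
  Matrix.of fun s s' => ∑ t : Bits C.width, ∑ t' : Bits C.width,
    if resize k t = s ∧ resize k t' = s' ∧ ∀ i : Fin C.width, k ≤ i.val → t i = t' i
    then C.finalState φ t * star (C.finalState φ t') else 0

/-- The circuit is applied to the `Bits m` part of a joint pure state `Ψ` with a register of `b`
further qubits, and the first `k = C.outs` wires are measured: the unnormalized state of the
further register, for outcome `y`. -/
def residual (C : QCircuit 𝒢) {m k b : ℕ} (Ψ : Bits b → Bits m → ℂ) (y : Bits k) :
    Matrix (Bits b) (Bits b) ℂ :=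
  Matrix.of fun β β' => ∑ t : Bits C.width,
    if resize k t = y then C.finalState (Ψ β) t * star (C.finalState (Ψ β') t) else 0

end QCircuit

/-- Families of quantum circuits of one parameter, the security parameter, with `m l` input and
`k l` output qubits. -/
structure IsQPT {𝒢 : GateSet} (C : ℕ → QCircuit 𝒢) (m k : ℕ → ℕ) : Prop where
  uniform : UniformFamily fun v : Fin 1 → ℕ => C (v 0)
  ins_eq : ∀ l, (C l).ins = m l
  outs_eq : ∀ l, (C l).outs = k l

/-! ### Quantum circuits with classical access to a probabilistic oracle -/

/-- Quantum gates, and oracle calls: a query of `m` bits and `len m` wires for the answer. -/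
inductive OracleOp (𝒢 : GateSet) (len : ℕ → ℕ) (w : ℕ) : Type
  | gate (o : QOp 𝒢 w) : OracleOp 𝒢 len w
  | query (m : ℕ) (wires : Fin m ⊕ Fin (len m) ↪ Fin w) : OracleOp 𝒢 len w

instance (𝒢 : GateSet) (len : ℕ → ℕ) : OpCode (OracleOp 𝒢 len) where
  code o := match o with
    | .gate o => OpCode.code o
    | .query m wires => 𝒢.num :: m :: (List.ofFn fun i => (wires (.inl i)).val) ++
        List.ofFn fun i => (wires (.inr i)).val

/-- Add the bit string `e` to the bits of `s` at the wires `f`. -/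
def xorAt {k w : ℕ} (f : Fin k → Fin w) (e : Bits k) (s : Bits w) : Bits w :=
  fun i => xor (s i) (decide (∃ j, f j = i ∧ e j = true))

/-- The action of an operation on density matrices.  `answer m q f` is the expectation of `f e`
over the oracle's answers `e` to the query `q` of length `m`.  An oracle call measures the query
wires and adds a fresh answer to the answer wires. -/
def OracleOp.act {𝒢 : GateSet} {len : ℕ → ℕ} {w : ℕ}
    (answer : ∀ m, Bits m → (Bits (len m) → ℂ) → ℂ) (ρ : Matrix (Bits w) (Bits w) ℂ) :
    OracleOp 𝒢 len w → Matrix (Bits w) (Bits w) ℂ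
  | .gate o => QOp.mat o * ρ * (QOp.mat o).conjTranspose
  | .query m wires => Matrix.of fun s s' =>
      if ∀ i, s (wires (.inl i)) = s' (wires (.inl i)) then
        answer m (fun i => s (wires (.inl i))) fun e =>
          ρ (xorAt (fun j => wires (.inr j)) e s) (xorAt (fun j => wires (.inr j)) e s')
      else 0

/-- Probability that an oracle circuit with one output bit outputs `1` on the classical input
`c`. -/
def Circuit.acceptProb {𝒢 : GateSet} {len : ℕ → ℕ} (A : Circuit (OracleOp 𝒢 len))
    (answer : ∀ m, Bits m → (Bits (len m) → ℂ) → ℂ) {n : ℕ} (c : Bits n) : ℝ :=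
  ∑ t : Bits A.width, if resize 1 t = (fun _ => true) then
    ((A.ops.foldl (OracleOp.act answer)
      (Matrix.vecMulVec (ket (resize A.width c)) (star (ket (resize A.width c))))) t t).re else 0

/-! ## Quantum homomorphic encryption -/

/-- A self-delimiting encoding of tables of numbers by bits, numbers in unary. -/
def natBits (n : ℕ) : List Bool := List.replicate n true ++ [false]

/-- See `natBits`. -/
def tableBits (D : List (List ℕ)) : List Bool :=
  natBits D.length ++ D.flatMap fun row => natBits row.length ++ row.flatMap natBits

/-- The algorithms of a quantum homomorphic encryption scheme, for the class of quantum circuits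
over `𝒢` with classical output.

* `Gen` has the security parameter `l` as parameter and outputs a secret key.
* `Enc` has parameters `l, n`; it encrypts a message of `n` bits.
* `Eval` has parameters `l, d, n, h, m`.  Its input is a circuit, described by `d` bits, a
  ciphertext of an `n`-bit message, and `h` further qubits; `m` is the number of output bits of the
  described circuit.  Its output is measured, which gives a classical ciphertext.
* `Dec` has parameters `l, m`; it decrypts a ciphertext of `m` bits, and is deterministic. -/
structure QHEScheme (𝒢 : GateSet) where
  Gen : PPT 1 fun _ => 0
  Enc : PPT 2 fun v => Gen.outLen ![v 0] + v 1
  Eval : (Fin 5 → ℕ) → QCircuit 𝒢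
  eval_uniform : UniformFamily Eval
  eval_ins : ∀ v, (Eval v).ins = v 1 + Enc.outLen ![v 0, v 2] + v 3
  Dec : (Fin 2 → ℕ) → QCircuit 𝒢
  dec_uniform : UniformFamily Dec
  dec_ins : ∀ v, (Dec v).ins = Gen.outLen ![v 0] + v 1
  dec : ∀ l m : ℕ, Bits (Gen.outLen ![l]) → Bits m → Bits (Dec ![l, m]).outs
  dec_eq : ∀ (l m : ℕ) (sk : Bits (Gen.outLen ![l])) (c : Bits m),
    Gen.CanOutput ![l] Fin.elim0 sk →
      (Dec ![l, m]).outcomeProb (ket (Fin.append sk c)) (dec l m sk c) = 1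

namespace QHEScheme

variable {𝒢 : GateSet} (Q : QHEScheme 𝒢)

/-- Length of secret keys. -/
abbrev skLen (l : ℕ) : ℕ := Q.Gen.outLen ![l]

/-- Length of ciphertexts of `n`-bit messages. -/
abbrev ctLen (l n : ℕ) : ℕ := Q.Enc.outLen ![l, n]

/-- Expectation over `sk ← Gen (1 ^ l)`. -/
def expectKey (l : ℕ) (f : Bits (Q.skLen l) → ℝ) : ℝ := Q.Gen.expect ![l] Fin.elim0 f

/-- Expectation over `c ← Enc (sk, x)`. -/
def expectEnc (l : ℕ) {n : ℕ} (sk : Bits (Q.skLen l)) (x : Bits n)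
    (f : Bits (Q.ctLen l n) → ℝ) : ℝ :=
  Q.Enc.expect ![l, n] (Fin.append sk x) f

/-- `c` is a possible ciphertext of `x`. -/
def IsCiphertext (l : ℕ) {n : ℕ} (x : Bits n) (c : Bits (Q.ctLen l n)) : Prop :=
  ∃ sk, Q.Gen.CanOutput ![l] Fin.elim0 sk ∧ Q.Enc.CanOutput ![l, n] (Fin.append sk x) c

/-- The bits that describe to `Eval` the circuit `C` with `n` classical input bits and `h` further
input qubits. -/
def circuitBits (n h : ℕ) (C : QCircuit 𝒢) : List Bool := tableBits ([n, h] :: C.desc)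

/-- Run `C` on the message `x` and the register `A` of the joint state `Ψ` of `A` and `B`, and
obtain an output string; the unnormalized state of `B` for output `y`. -/
def directGame {n h b : ℕ} (C : QCircuit 𝒢) (Ψ : Bits b → Bits h → ℂ) (x : Bits n)
    (y : List Bool) : Matrix (Bits b) (Bits b) ℂ :=
  ∑ z : Bits C.outs, if List.ofFn z = y then C.residual (fun β => ketTensor x (Ψ β)) z else 0

/-- Encrypt `x`, run `Eval` for the circuit `C` on the ciphertext and the register `A`, and decrypt
the result; the unnormalized state of `B` for output `y`. -/
def evalGame (l : ℕ) {n h b : ℕ} (C : QCircuit 𝒢) (Ψ : Bits b → Bits h → ℂ) (x : Bits n)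
    (y : List Bool) : Matrix (Bits b) (Bits b) ℂ :=
  let desc := circuitBits n h C
  let E := Q.Eval ![l, desc.length, n, h, C.outs]
  ((2 : ℂ) ^ Q.Gen.coins ![l])⁻¹ • ∑ r : Bits (Q.Gen.coins ![l]),
    ((2 : ℂ) ^ Q.Enc.coins ![l, n])⁻¹ • ∑ r' : Bits (Q.Enc.coins ![l, n]),
      let sk := Q.Gen.run ![l] Fin.elim0 r
      let c := Q.Enc.run ![l, n] (Fin.append sk x) r'
      ∑ z : Bits E.outs, if List.ofFn (Q.dec l E.outs sk z) = y then
        E.residual (fun β => ketTensor (Fin.append desc.get c) (Ψ β)) z else 0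

/-- Correctness with auxiliary input: for circuits of polynomial size and arbitrary joint states,
the output string and the state of `B` in the two games have negligible trace distance. -/
def IsCorrect : Prop :=
  ∀ e : ℕ, ∃ η : ℕ → ℝ, Negligible η ∧
    ∀ (l n h b : ℕ) (C : QCircuit 𝒢) (Ψ : Bits b → Bits h → ℂ) (x : Bits n),
      C.ins = n + h → (circuitBits n h C).length ≤ e * (l + 1) ^ e →
      ∑ β, ∑ a, ‖Ψ β a‖ ^ 2 = 1 →
      (∑ᶠ y : List Bool, traceNorm (directGame C Ψ x y - Q.evalGame l C Ψ x y)) / 2 ≤ η l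

/-- The encryption oracle `Enc (sk, ·)`. -/
def encOracle (l : ℕ) (sk : Bits (Q.skLen l)) (m : ℕ) (q : Bits m)
    (f : Bits (Q.ctLen l m) → ℂ) : ℂ :=
  (∑ r, f (Q.Enc.run ![l, m] (Fin.append sk q) r)) / 2 ^ Q.Enc.coins ![l, m]

/-- Probability that the adversary `A`, with access to the encryption oracle, outputs `1` when it
is given an encryption of `x`. -/
def adversaryProb (l : ℕ) (A : Circuit (OracleOp 𝒢 (Q.ctLen l))) {n : ℕ} (x : Bits n) : ℝ :=
  Q.expectKey l fun sk => Q.expectEnc l sk x fun c => A.acceptProb (Q.encOracle l sk) c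

/-- CPA security against (uniform) QPT adversaries. -/
def IsCPASecure : Prop :=
  ∀ (n : ℕ) (x₀ x₁ : Bits n) (A : ∀ l : ℕ, Circuit (OracleOp 𝒢 (Q.ctLen l))),
    UniformFamily (fun v : Fin 1 → ℕ => A (v 0)) →
    (∀ l, (A l).ins = Q.ctLen l n) → (∀ l, (A l).outs = 1) →
    Negligible fun l => |Q.adversaryProb l (A l) x₀ - Q.adversaryProb l (A l) x₁|

end QHEScheme

/-- Quantum homomorphic encryption schemes. -/
structure QHE (𝒢 : GateSet) extends QHEScheme 𝒢 where
  correct : toQHEScheme.IsCorrect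
  secure : toQHEScheme.IsCPASecure

/-! ## Nonlocal games -/

/-- Two-player nonlocal games. -/
structure NonlocalGame (IA IB OA OB : Type*) [Fintype IA] [Fintype IB] where
  prob : IA → IB → ℝ
  prob_nonneg : ∀ x y, 0 ≤ prob x y
  prob_sum : ∑ x, ∑ y, prob x y = 1
  wins : IA → IB → OA → OB → Bool

/-- Quantum (tensor) strategies on `ℂ ^ dA ⊗ ℂ ^ dB`. -/
structure QuantumStrategy (IA IB OA OB : Type*) [Fintype OA] [Fintype OB] where
  dA : ℕ
  dB : ℕ
  ψ : Fin dA × Fin dB → ℂ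
  ψ_norm : ∑ i, ‖ψ i‖ ^ 2 = 1
  A : IA → OA → Matrix (Fin dA) (Fin dA) ℂ
  B : IB → OB → Matrix (Fin dB) (Fin dB) ℂ
  A_pvm : ∀ x, IsPVM (A x)
  B_pvm : ∀ y, IsPVM (B y)

namespace NonlocalGame

variable {IA IB OA OB : Type*} [Fintype IA] [Fintype IB] [Fintype OA] [Fintype OB]

/-- The winning probability of a quantum strategy. -/
def winProb (G : NonlocalGame IA IB OA OB) (S : QuantumStrategy IA IB OA OB) : ℝ :=
  ∑ x, ∑ y, G.prob x y * ∑ a, ∑ b,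
    if G.wins x y a b then expval S.ψ (S.A x a ⊗ₖ S.B y b) else 0

/-- The quantum value. -/
def quantumValue (G : NonlocalGame IA IB OA OB) : ℝ :=
  sSup (Set.range fun S : QuantumStrategy IA IB OA OB => G.winProb S)

/-- XOR games: `V(x, y, a, b) = (1 + (-1) ^ g(x, y) (-1) ^ (a + b)) / 2`. -/
def IsXOR (G : NonlocalGame IA IB Bool Bool) : Prop :=
  ∃ g : IA → IB → Bool, ∀ x y a b, (if G.wins x y a b then (1 : ℝ) else 0) =
    1 / 2 * (1 + (-1) ^ (g x y).toNat * (-1) ^ (a.toNat + b.toNat))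

end NonlocalGame

/-! ## Compiled games -/

/-- Compiled games: a nonlocal game and a QHE scheme, with encodings of Alice's questions, Alice's
answers and Bob's answers as bit strings (for Alice, these are the plaintexts). -/
structure CompiledGame (𝒢 : GateSet) (IA IB OA OB : Type*) [Fintype IA] [Fintype IB] where
  game : NonlocalGame IA IB OA OB
  qhe : QHE 𝒢
  msgLen : ℕ
  question : IA ↪ Bits msgLen
  answerA : OA ↪ List Bool
  ansLenB : ℕ
  answerB : OB ↪ Bits ansLenB

namespace CompiledGame

variable {𝒢 : GateSet} {IA IB OA OB : Type*} [Fintype IA] [Fintype IB]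

/-- Length of the encrypted questions. -/
abbrev ctLen (G : CompiledGame 𝒢 IA IB OA OB) (l : ℕ) : ℕ := G.qhe.ctLen l G.msgLen

/-- `c` is a possible encrypted question. -/
def IsQuestion (G : CompiledGame 𝒢 IA IB OA OB) (l : ℕ) (c : Bits (G.ctLen l)) : Prop :=
  ∃ x, G.qhe.IsCiphertext l (G.question x) c

end CompiledGame

/-- Quantum strategies for a compiled game: for each security parameter `l`, a state `ψ` of
`qubits l` qubits, a PVM `P c` and unitaries `U c α` for each encrypted question `c`, and a PVM
`B y` for each question `y`, all of them implemented by QPT circuits.  The implementing circuits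
take `c` (and `α`) as an input. -/
structure CompiledStrategy {𝒢 : GateSet} {IA IB OA OB : Type*} [Fintype IA] [Fintype IB]
    [Fintype OB] (G : CompiledGame 𝒢 IA IB OA OB) where
  qubits : ℕ → ℕ
  ansLen : ℕ → ℕ
  ψ : ∀ l, Bits (qubits l) → ℂ
  P : ∀ l, Bits (G.ctLen l) → Bits (ansLen l) → Matrix (Bits (qubits l)) (Bits (qubits l)) ℂ
  U : ∀ l, Bits (G.ctLen l) → Bits (ansLen l) → Matrix (Bits (qubits l)) (Bits (qubits l)) ℂ
  B : ∀ l, IB → OB → Matrix (Bits (qubits l)) (Bits (qubits l)) ℂ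
  ψ_norm : ∀ l, ∑ s, ‖ψ l s‖ ^ 2 = 1
  P_pvm : ∀ l c, G.IsQuestion l c → IsPVM (P l c)
  U_unitary : ∀ l c α, G.IsQuestion l c → U l c α ∈ Matrix.unitaryGroup (Bits (qubits l)) ℂ
  B_pvm : ∀ l y, IsPVM (B l y)
  /-- The state is prepared by a QPT circuit. -/
  ψ_qpt : ∃ C : ℕ → QCircuit 𝒢, IsQPT C (fun _ => 0) qubits ∧
    ∀ l, (C l).outDensity (qubits l) (ket (Fin.elim0 : Bits 0)) =
      Matrix.vecMulVec (ψ l) (star (ψ l))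
  /-- The measurement of `α` has the same outcome probabilities as a QPT circuit. -/
  P_qpt : ∃ C : ℕ → QCircuit 𝒢, IsQPT C (fun l => G.ctLen l + qubits l) ansLen ∧
    ∀ l c, G.IsQuestion l c → ∀ (φ : Bits (qubits l) → ℂ) (α : Bits (ansLen l)),
      (C l).outcomeProb (ketTensor c φ) α = expval φ (P l c α)
  /-- The unitaries are implemented by a QPT circuit (outcomes that cannot occur are ignored). -/
  U_qpt : ∃ C : ℕ → QCircuit 𝒢,
    IsQPT C (fun l => G.ctLen l + ansLen l + qubits l) qubits ∧
    ∀ l c, G.IsQuestion l c → ∀ (α : Bits (ansLen l)), P l c α ≠ 0 →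
      ∀ φ : Bits (qubits l) → ℂ,
        (C l).outDensity (qubits l) (ketTensor (Fin.append c α) φ) =
          Matrix.vecMulVec ((U l c α).mulVec φ) (star ((U l c α).mulVec φ))
  /-- The measurement of `b` has the same outcome probabilities as a QPT circuit. -/
  B_qpt : ∀ y, ∃ C : ℕ → QCircuit 𝒢, IsQPT C qubits (fun _ => G.ansLenB) ∧
    ∀ l (φ : Bits (qubits l) → ℂ) (b : OB),
      (C l).outcomeProb φ (G.answerB b) = expval φ (B l y b)

namespace CompiledStrategy

variable {𝒢 : GateSet} {IA IB OA OB : Type*} [Fintype IA] [Fintype IB] [Fintype OA] [Fintype OB]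
  {G : CompiledGame 𝒢 IA IB OA OB}

/-- The unnormalized state `U P ψ` after the answer `α` to the encrypted question `c`. -/
def post (S : CompiledStrategy G) (l : ℕ) (c : Bits (G.ctLen l)) (α : Bits (S.ansLen l)) :
    Bits (S.qubits l) → ℂ :=
  (S.U l c α * S.P l c α).mulVec (S.ψ l)

/-- The probability of the (decrypted) answers `a, b` to the questions `x, y`. -/
def answerProb (S : CompiledStrategy G) (l : ℕ) (x : IA) (y : IB) (a : OA) (b : OB) : ℝ :=
  G.qhe.expectKey l fun sk => G.qhe.expectEnc l sk (G.question x) fun c =>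
    ∑ α, if List.ofFn (G.qhe.dec l (S.ansLen l) sk α) = G.answerA a then
      expval (S.post l c α) (S.B l y b) else 0

/-- The winning probability at security parameter `l`. -/
def winProb (S : CompiledStrategy G) (l : ℕ) : ℝ :=
  ∑ x, ∑ y, G.game.prob x y * ∑ a, ∑ b,
    if G.game.wins x y a b then S.answerProb l x y a b else 0

end CompiledStrategy

end

/-! Write `w x y = π(x,y) (-1)^{g(x,y)}` and `O y = B y false - B y true`. Playing the encrypted
question `x` leaves the prover in an ensemble of unnormalized states `φ`, indexed by the coins of
the encryption scheme and the answer `α`. With `ε` the sign of the decrypted answer, the winning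
probability is at most `1/2 + 1/2 ∑ₓ ∑_y w x y E[ε ⟨φ|O y|φ⟩]`. Cauchy–Schwarz removes `ε`
(`sum_correlation_le_sqrt`): for each `x` the correlation is at most `√(∑ w x y w x y' Kₓ(y,y'))`,
where `Kₓ(y,y') = E Re⟨O y φ, O y' φ⟩`. This Gram matrix no longer involves decryption.

An adversary can therefore estimate `Kₓ` from a ciphertext alone. It plays the prover's first move,
measures `B y` and then `B y'`, and outputs the parity of the two results. Since `∑_b B_b B'_{1-b}
B_b = 1/2 - (OO' + O'O)/4` (`IsPVM.parity_eq`), it accepts with probability `1/2 - Kₓ(y,y')/2`. By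
CPA security `Kₓ` differs only negligibly from `K_{x₀}` for a fixed question `x₀`
(`negligible_runGram`).

`K_{x₀}` is the Gram matrix of real unit vectors `v y`. The number `∑ₓ ‖∑_y w x y v y‖` is the
correlation obtained from the `v y` and suitable unit vectors `u x` (`sqrt_le_quantumValue`), and
Tsirelson's construction with anticommuting matrices on a maximally entangled state realizes such
vectors by a quantum strategy (`vector_le_quantumValue`). The total error is a finite sum of square
roots of negligible functions, hence negligible.

The longest part shows that the adversary is a uniform quantum circuit. The given circuits only
reproduce outcome probabilities, and may scramble the state. Computing, copying the result by CNOTs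
and uncomputing turns each into a genuine projective measurement (`conj_basisProj_mulVec_place`,
`measure_mulVec`). The pieces must also be wired together without collisions (`acceptProb_circuit`),
and the description of the whole circuit must be computable in logarithmic space
(`Attack.IsUniform.circuit`), for which logspace functions have to be closed under composition
(`LogspaceComputable.comp`). -/

noncomputable section

/-! ## Closure properties of logspace computability -/

/-- A monotone polynomial bound. -/
def polyBound (c S : ℕ) : ℕ := c * (S + 1) ^ c

lemma polyBound_mono {c c' S S' : ℕ} (hc : c ≤ c') (hS : S ≤ S') :
    polyBound c S ≤ polyBound c' S' := by
  unfold polyBound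
  calc c * (S + 1) ^ c ≤ c' * (S' + 1) ^ c := by gcongr
    _ ≤ c' * (S' + 1) ^ c' := by
      gcongr
      omega

lemma le_polyBound_succ (c S : ℕ) : polyBound c S + S ≤ polyBound (c + 1) S := by
  unfold polyBound
  have h1 : (S + 1) ^ c ≥ 1 := Nat.one_le_pow _ _ (by omega)
  have h2 : (S + 1) ^ (c + 1) = (S + 1) ^ c * (S + 1) := pow_succ _ _
  rw [h2]
  nlinarith [Nat.zero_le (c * (S + 1) ^ c * S), Nat.zero_le (((S + 1) ^ c - 1) * S),
    Nat.mul_le_mul_right S h1]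

/-- Used for composition: the outer function receives `m` arguments, each at most `polyBound c' S`,
so their sum is at most `m * polyBound c' S`. -/
lemma polyBound_comp (c c' m : ℕ) :
    ∃ c'', ∀ S, polyBound c (m * polyBound c' S) ≤ polyBound c'' S := by
  refine ⟨c * (m * c' + 1) ^ c + c' * c, fun S => ?_⟩
  unfold polyBound
  have h1 : (S + 1) ^ c' ≥ 1 := Nat.one_le_pow _ _ (by omega)
  have h2 : m * (c' * (S + 1) ^ c') + 1 ≤ (m * c' + 1) * (S + 1) ^ c' := by nlinarith
  calc c * (m * (c' * (S + 1) ^ c') + 1) ^ c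
      ≤ c * ((m * c' + 1) * (S + 1) ^ c') ^ c := by gcongr
    _ = c * (m * c' + 1) ^ c * (S + 1) ^ (c' * c) := by rw [mul_pow, ← pow_mul]; ring
    _ ≤ (c * (m * c' + 1) ^ c + c' * c) * (S + 1) ^ (c * (m * c' + 1) ^ c + c' * c) := by
        gcongr <;> omega

namespace Prog

/-- Move all registers by `d`. -/
def shift (d : ℕ) : Prog → Prog
  | zero r => zero (r + d)
  | copy r q => copy (r + d) (q + d)
  | inc r => inc (r + d)
  | dec r => dec (r + d)
  | seq p p' => seq (p.shift d) (p'.shift d)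
  | whileNonzero r p => whileNonzero (r + d) (p.shift d)

/-- A bound for the registers that occur in a program. -/
def regs : Prog → ℕ
  | zero r => r + 1
  | copy r q => max (r + 1) (q + 1)
  | inc r => r + 1
  | dec r => r + 1
  | seq p p' => max p.regs p'.regs
  | whileNonzero r p => max (r + 1) p.regs

end Prog

namespace Run

variable {B B' : ℕ} {p : Prog} {s s' : ℕ → ℕ}

lemma mono (h : Run B p s s') (hB : B ≤ B') : Run B' p s s' := by
  induction h with
  | zero r s => exact .zero r s
  | copy r q s => exact .copy r q s
  | inc r s h => exact .inc r s (h.trans hB)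
  | dec r s => exact .dec r s
  | seq _ _ h1 h2 => exact .seq h1 h2
  | while_stop r p s h => exact Run.while_stop r p s h
  | while_step h _ _ h1 h2 => exact .while_step h h1 h2

/-- Only `inc` can create a new maximum, and it is guarded by `B`. Hence logspace computable
functions are polynomially bounded. -/
lemma le_bound (h : Run B p s s') (hs : ∀ r, s r ≤ B) : ∀ r, s' r ≤ B := by
  induction h with
  | zero r s =>
    intro q
    by_cases hq : q = r <;> simp [hq, hs]
  | copy r q s =>
    intro t
    by_cases hq : t = r <;> simp [hq, hs]
  | inc r s h =>
    intro t
    by_cases hq : t = r <;> simp [hq, hs, h]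
  | dec r s =>
    intro t
    by_cases hq : t = r <;> simp [hq, hs]
    have := hs r
    omega
  | seq _ _ h1 h2 => exact h2 (h1 hs)
  | while_stop r p s h => exact hs
  | while_step h _ _ h1 h2 => exact h2 (h1 hs)

lemma eq_of_regs_le (h : Run B p s s') : ∀ r, p.regs ≤ r → s' r = s r := by
  induction h with
  | zero r s =>
    intro t ht
    rw [Function.update_of_ne]
    simp only [Prog.regs] at ht; omega
  | copy r q s =>
    intro t ht
    rw [Function.update_of_ne]
    simp only [Prog.regs] at ht; omega
  | inc r s h =>
    intro t ht
    rw [Function.update_of_ne]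
    simp only [Prog.regs] at ht; omega
  | dec r s =>
    intro t ht
    rw [Function.update_of_ne]
    simp only [Prog.regs] at ht; omega
  | seq _ _ h1 h2 =>
    intro t ht
    simp only [Prog.regs, max_le_iff] at ht
    rw [h2 t ht.2, h1 t ht.1]
  | while_stop r p s h => exact fun _ _ => rfl
  | while_step h _ _ h1 h2 =>
    intro t ht
    rw [h2 t ht]
    simp only [Prog.regs, max_le_iff] at ht
    rw [h1 t ht.2]

/-- Gives a subroutine private memory: the registers below `d` survive its run. -/
lemma shift (h : Run B p s s') (d : ℕ) : ∀ t : ℕ → ℕ, (∀ r, t (r + d) = s r) →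
    ∃ t', Run B (p.shift d) t t' ∧ (∀ r, t' (r + d) = s' r) ∧ ∀ r < d, t' r = t r := by
  induction h with
  | zero r s =>
    refine fun t ht => ⟨_, .zero _ _, fun q => ?_, fun q hq => ?_⟩
    · simp [Function.update_apply, ht]
    · rw [Function.update_of_ne]; omega
  | copy r q s =>
    refine fun t ht => ⟨_, .copy _ _ _, fun q => ?_, fun q hq => ?_⟩
    · simp [Function.update_apply, ht]
    · rw [Function.update_of_ne]; omega
  | inc r s h =>
    refine fun t ht => ⟨_, .inc _ _ (by rw [ht]; exact h), fun q => ?_, fun q hq => ?_⟩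
    · simp [Function.update_apply, ht]
    · rw [Function.update_of_ne]; omega
  | dec r s =>
    refine fun t ht => ⟨_, .dec _ _, fun q => ?_, fun q hq => ?_⟩
    · simp [Function.update_apply, ht]
    · rw [Function.update_of_ne]; omega
  | seq _ _ h1 h2 =>
    intro t ht
    obtain ⟨t1, r1, a1, b1⟩ := h1 t ht
    obtain ⟨t2, r2, a2, b2⟩ := h2 t1 a1
    exact ⟨t2, .seq r1 r2, a2, fun r hr => (b2 r hr).trans (b1 r hr)⟩
  | while_stop r p s h =>
    exact fun t ht => ⟨t, Run.while_stop _ _ _ (by rw [ht]; exact h), ht, fun _ _ => rfl⟩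
  | while_step h _ _ h1 h2 =>
    intro t ht
    obtain ⟨t1, r1, a1, b1⟩ := h1 t ht
    obtain ⟨t2, r2, a2, b2⟩ := h2 t1 a1
    exact ⟨t2, .while_step (by rw [ht]; exact h) r1 r2, a2,
      fun r hr => (b2 r hr).trans (b1 r hr)⟩

/-- Passes arguments to a subroutine: values scattered below `E` are gathered where a program
shifted by `E` expects its inputs. -/
lemma exists_copies {m : ℕ} (D : Fin m → ℕ) (E : ℕ) (hD : ∀ i, D i < E) :
    ∃ p, ∀ B s, ∃ s', Run B p s s' ∧ (∀ i : Fin m, s' (i + E) = s (D i)) ∧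
      ∀ r, (r < E ∨ E + m ≤ r) → s' r = s r := by
  induction m with
  | zero =>
    -- `copy 0 0` serves as the program that does nothing.
    refine ⟨.copy 0 0, fun B s => ⟨_, .copy _ _ _, fun i => i.elim0, fun r _ => ?_⟩⟩
    simp
  | succ m ih =>
    obtain ⟨p, hp⟩ := ih (fun i => D i.castSucc) (fun i => hD _)
    refine ⟨.seq p (.copy (m + E) (D (Fin.last m))), fun B s => ?_⟩
    obtain ⟨s', h1, h2, h3⟩ := hp B s
    refine ⟨_, .seq h1 (.copy _ _ _), fun i => ?_, fun r hr => ?_⟩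
    · refine Fin.lastCases ?_ (fun i => ?_) i
      · simp [h3 _ (Or.inl (hD _))]
      · rw [Function.update_of_ne]
        · exact h2 i
        · simp; omega
    · rw [Function.update_of_ne (by omega)]
      exact h3 r (by omega)

end Run

/-- Programs for `f` that use only registers from `d` on, which are supposed to be zero, and do
not change the inputs. -/
def Implementable {k : ℕ} (f : (Fin k → ℕ) → ℕ) : Prop :=
  ∃ c, (∀ v, f v ≤ polyBound c (∑ i, v i)) ∧ ∀ d, k ≤ d → ∃ p d', d < d' ∧
    ∀ (v : Fin k → ℕ) (s : ℕ → ℕ), (∀ i : Fin k, s i = v i) → (∀ r, d ≤ r → s r = 0) →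
      ∃ s', Run (polyBound c (∑ i, v i)) p s s' ∧ (∀ r < d, s' r = s r) ∧ s' d = f v ∧
        ∀ r, d' ≤ r → s' r = 0

/-- A program may destroy its inputs, so it is run on a copy of them placed from `d` on. It uses
only `p.regs` registers, so memory beyond its workspace remains zero for later subroutines. -/
lemma LogspaceComputable.implementable {k : ℕ} {f : (Fin k → ℕ) → ℕ}
    (hf : LogspaceComputable f) : Implementable f := by
  obtain ⟨p, e, hp⟩ := hf
  have hb : ∀ S, e * (S + 1) ^ e + S ≤ polyBound (e + 1) S := le_polyBound_succ e
  refine ⟨e + 1, fun v => ?_, fun d hd => ?_⟩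
  · obtain ⟨s, h1, h2⟩ := hp v
    rw [← h2]
    refine (h1.le_bound (fun r => ?_) 0).trans (hb _)
    split_ifs with h
    · exact (Finset.single_le_sum (f := v) (fun _ _ => Nat.zero_le _)
        (Finset.mem_univ _)).trans (Nat.le_add_left _ _)
    · exact Nat.zero_le _
  · obtain ⟨q, hq⟩ := Run.exists_copies (fun i : Fin k => (i : ℕ)) d (fun i => by omega)
    refine ⟨.seq q (p.shift d), d + k + p.regs + 1, by omega, fun v s hs h0 => ?_⟩
    obtain ⟨s1, h1, h2, h3⟩ := hq (polyBound (e + 1) (∑ i, v i)) s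
    obtain ⟨s2, h4, h5⟩ := hp v
    have h6 : ∀ r, s1 (r + d) = if h : r < k then v ⟨r, h⟩ else 0 := by
      intro r
      split_ifs with h
      · rw [h2 ⟨r, h⟩]; exact hs _
      · rw [h3 _ (by omega)]; exact h0 _ (by omega)
    obtain ⟨s3, h7, h8, h9⟩ := (h4.mono (hb _)).shift d s1 h6
    refine ⟨s3, .seq h1 h7, fun r hr => ?_, ?_, fun r hr => ?_⟩
    · rw [h9 r hr, h3 r (by omega)]
    · rw [← h5, ← h8]; simp
    · obtain ⟨t, rfl⟩ := Nat.exists_eq_add_of_le' (show d ≤ r by omega)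
      rw [h8, h4.eq_of_regs_le _ (by omega), dif_neg (by omega)]

/-- The functions are evaluated in turn, each with a workspace that begins where the previous one
ended. All results therefore survive together with the inputs. -/
lemma exists_implementations {k m : ℕ} {g : Fin m → (Fin k → ℕ) → ℕ}
    (hg : ∀ i, Implementable (g i)) :
    ∃ c, (∀ i v, g i v ≤ polyBound c (∑ i, v i)) ∧ ∃ p E, k ≤ E ∧ ∃ D : Fin m → ℕ,
      (∀ i, D i < E) ∧ ∀ (v : Fin k → ℕ) (s : ℕ → ℕ), (∀ i : Fin k, s i = v i) →
        (∀ r, k ≤ r → s r = 0) → ∃ s', Run (polyBound c (∑ i, v i)) p s s' ∧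
          (∀ r < k, s' r = s r) ∧ (∀ i, s' (D i) = g i v) ∧ ∀ r, E ≤ r → s' r = 0 := by
  induction m with
  | zero =>
    refine ⟨0, fun i => i.elim0, .copy 0 0, k, le_rfl, fun i => i.elim0, fun i => i.elim0,
      fun v s _ h0 => ⟨_, .copy _ _ _, fun r _ => ?_, fun i => i.elim0, fun r hr => ?_⟩⟩
    · simp
    · simpa using h0 r hr
  | succ m ih =>
    obtain ⟨c, hc, p, E, hE, D, hD, h⟩ := ih (fun i => hg i.castSucc)
    obtain ⟨c', hc', h'⟩ := hg (Fin.last m)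
    obtain ⟨p', E', hE', h'⟩ := h' E hE
    refine ⟨max c c', ?_, .seq p p', E', by omega, Fin.snoc D E, ?_, fun v s hs h0 => ?_⟩
    · intro i v
      refine Fin.lastCases ?_ (fun i => ?_) i
      · exact (hc' v).trans (polyBound_mono (le_max_right _ _) le_rfl)
      · exact (hc i v).trans (polyBound_mono (le_max_left _ _) le_rfl)
    · intro i
      refine Fin.lastCases ?_ (fun i => ?_) i
      · simpa using hE'
      · simpa using (hD i).trans hE'
    · obtain ⟨s1, a1, a2, a3, a4⟩ := h v s hs h0
      obtain ⟨s2, b1, b2, b3, b4⟩ := h' v s1 (fun i => (a2 i i.2).trans (hs i)) a4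
      refine ⟨s2, .seq (a1.mono (polyBound_mono (le_max_left _ _) le_rfl))
        (b1.mono (polyBound_mono (le_max_right _ _) le_rfl)), fun r hr => ?_, fun i => ?_, b4⟩
      · rw [b2 r (by omega), a2 r hr]
      · refine Fin.lastCases ?_ (fun i => ?_) i
        · simpa using b3
        · simpa using (b2 _ (hD i)).trans (a3 i)

namespace LogspaceComputable

theorem comp {k m : ℕ} {f : (Fin m → ℕ) → ℕ} {g : Fin m → (Fin k → ℕ) → ℕ}
    (hf : LogspaceComputable f) (hg : ∀ i, LogspaceComputable (g i)) :
    LogspaceComputable fun v => f fun i => g i v := by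
  obtain ⟨c, hc, p, E, hE, D, hD, h⟩ := exists_implementations fun i => (hg i).implementable
  obtain ⟨p', e, hp'⟩ := hf
  obtain ⟨q, hq⟩ := Run.exists_copies D E hD
  obtain ⟨c', hc'⟩ := polyBound_comp (e + 1) c m
  refine ⟨.seq p (.seq q (.seq (p'.shift E) (.copy 0 E))), max c c', fun v => ?_⟩
  set S := ∑ i, v i with hS
  have hb : polyBound (max c c') S ≤ max c c' * (S + 1) ^ (max c c') + S := Nat.le_add_right _ _
  have hB : polyBound c S ≤ max c c' * (S + 1) ^ (max c c') + S :=
    (polyBound_mono (le_max_left _ _) le_rfl).trans hb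
  have hB' : e * (∑ i, g i v + 1) ^ e + ∑ i, g i v ≤ max c c' * (S + 1) ^ (max c c') + S := by
    refine (le_polyBound_succ e _).trans (le_trans ?_
      ((polyBound_mono (le_max_right _ _) le_rfl).trans hb))
    refine (polyBound_mono le_rfl ?_).trans (hc' S)
    refine (Finset.sum_le_card_nsmul _ _ _ fun i _ => hc i v).trans ?_
    simp [hS]
  obtain ⟨s1, a1, a2, a3, a4⟩ := h v (fun r => if h : r < k then v ⟨r, h⟩ else 0)
    (fun i => by simp) (fun r hr => by rw [dif_neg (by omega)])
  obtain ⟨s2, b1, b2, b3⟩ := hq (max c c' * (S + 1) ^ (max c c') + S) s1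
  obtain ⟨s3, c1, c2⟩ := hp' fun i => g i v
  -- Beyond the `m` gathered arguments the registers are still zero, as the shifted program of `f`
  -- requires.
  obtain ⟨s4, d1, d2, d3⟩ := (c1.mono hB').shift E s2 (by
    intro r
    split_ifs with h
    · rw [b2 ⟨r, h⟩, a3]
    · rw [b3 _ (by omega), a4 _ (by omega)])
  refine ⟨_, .seq (a1.mono hB) (.seq b1 (.seq d1 (.copy _ _ _))), ?_⟩
  have := d2 0
  rw [Nat.zero_add] at this
  rw [Function.update_self, this, c2]

variable {k : ℕ} {f g h : (Fin k → ℕ) → ℕ}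

lemma proj (i : Fin k) : LogspaceComputable fun v : Fin k → ℕ => v i :=
  ⟨.copy 0 i, 0, fun v => ⟨_, .copy _ _ _, by simp⟩⟩

lemma const (c : ℕ) : LogspaceComputable fun _ : Fin k → ℕ => c := by
  have : ∀ c, ∃ p, ∀ B s, c ≤ B → ∃ s', Run B p s s' ∧ s' 0 = c := by
    intro c
    induction c with
    | zero => exact ⟨.zero 0, fun B s _ => ⟨_, .zero _ _, by simp⟩⟩
    | succ c ih =>
      obtain ⟨p, hp⟩ := ih
      refine ⟨.seq p (.inc 0), fun B s h => ?_⟩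
      obtain ⟨s', h1, h2⟩ := hp B s (by omega)
      exact ⟨_, .seq h1 (.inc _ _ (by omega)), by simp [h2]⟩
  obtain ⟨p, hp⟩ := this c
  refine ⟨p, c, fun v => hp _ _ ?_⟩
  have h1 : (∑ i, v i + 1) ^ c ≥ 1 := Nat.one_le_pow _ _ (by omega)
  exact (Nat.le_mul_of_pos_right _ h1).trans (Nat.le_add_right _ _)

lemma add_aux : LogspaceComputable fun v : Fin 2 → ℕ => v 0 + v 1 := by
  refine ⟨.whileNonzero 1 (.seq (.dec 1) (.inc 0)), 0, fun v => ?_⟩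
  -- With exponent `0` the space bound is exactly the sum of the two inputs, which is the largest
  -- value the loop produces.
  have : ∀ (n B : ℕ) (s : ℕ → ℕ), s 1 = n → s 0 + n ≤ B →
      ∃ s', Run B (.whileNonzero 1 (.seq (.dec 1) (.inc 0))) s s' ∧ s' 0 = s 0 + n := by
    intro n
    induction n with
    | zero => exact fun B s h _ => ⟨s, Run.while_stop _ _ _ h, rfl⟩
    | succ n ih =>
      intro B s h hB
      obtain ⟨s', h1, h2⟩ := ih B (Function.update (Function.update s 1 (s 1 - 1)) 0
        (Function.update s 1 (s 1 - 1) 0 + 1)) (by simp [h])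
        (by simp; omega)
      refine ⟨s', .while_step (by omega) (.seq (.dec _ _) (.inc _ _ ?_)) h1, ?_⟩
      · simp; omega
      · rw [h2]; simp; omega
  obtain ⟨s', h1, h2⟩ := this (v 1) (0 * (∑ i, v i + 1) ^ 0 + ∑ i, v i)
    (fun r => if h : r < 2 then v ⟨r, h⟩ else 0) (by simp) (by simp [Fin.sum_univ_two])
  exact ⟨s', h1, by rw [h2]; simp⟩

lemma sub_aux : LogspaceComputable fun v : Fin 2 → ℕ => v 0 - v 1 := by
  refine ⟨.whileNonzero 1 (.seq (.dec 1) (.dec 0)), 0, fun v => ?_⟩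
  have : ∀ (n B : ℕ) (s : ℕ → ℕ), s 1 = n →
      ∃ s', Run B (.whileNonzero 1 (.seq (.dec 1) (.dec 0))) s s' ∧ s' 0 = s 0 - n := by
    intro n
    induction n with
    | zero => exact fun B s h => ⟨s, Run.while_stop _ _ _ h, rfl⟩
    | succ n ih =>
      intro B s h
      obtain ⟨s', h1, h2⟩ := ih B (Function.update (Function.update s 1 (s 1 - 1)) 0
        (Function.update s 1 (s 1 - 1) 0 - 1)) (by simp [h])
      refine ⟨s', .while_step (by omega) (.seq (.dec _ _) (.dec _ _)) h1, ?_⟩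
      rw [h2]; simp; omega
  obtain ⟨s', h1, h2⟩ := this (v 1) (0 * (∑ i, v i + 1) ^ 0 + ∑ i, v i)
    (fun r => if h : r < 2 then v ⟨r, h⟩ else 0) (by simp)
  exact ⟨s', h1, by rw [h2]; simp⟩

lemma ite_aux : LogspaceComputable fun v : Fin 3 → ℕ => if v 0 = 0 then v 2 else v 1 := by
  refine ⟨.seq (.whileNonzero 0 (.seq (.copy 2 1) (.zero 0))) (.copy 0 2), 0, fun v => ?_⟩
  by_cases h : v 0 = 0
  · refine ⟨_, .seq (Run.while_stop _ _ _ (by simpa using h)) (.copy _ _ _), by simp [h]⟩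
  · refine ⟨_, .seq (.while_step (by simpa using h) (.seq (.copy _ _ _) (.zero _ _))
      (Run.while_stop _ _ _ (by simp))) (.copy _ _ _), by simp [h]⟩

lemma add (hf : LogspaceComputable f) (hg : LogspaceComputable g) :
    LogspaceComputable fun v => f v + g v :=
  add_aux.comp (g := ![f, g]) fun i => by fin_cases i <;> assumption

lemma sub (hf : LogspaceComputable f) (hg : LogspaceComputable g) :
    LogspaceComputable fun v => f v - g v :=
  sub_aux.comp (g := ![f, g]) fun i => by fin_cases i <;> assumption

lemma ite_zero (hf : LogspaceComputable f) (hg : LogspaceComputable g)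
    (hh : LogspaceComputable h) : LogspaceComputable fun v => if f v = 0 then g v else h v :=
  ite_aux.comp (g := ![f, h, g]) fun i => by fin_cases i <;> assumption

/-- Comparison is a zero test, since the truncated difference `b - a` vanishes iff `b ≤ a`. -/
lemma ite_lt {a b : (Fin k → ℕ) → ℕ} (ha : LogspaceComputable a) (hb : LogspaceComputable b)
    (hf : LogspaceComputable f) (hg : LogspaceComputable g) :
    LogspaceComputable fun v => if a v < b v then f v else g v := by
  convert (hb.sub ha).ite_zero hg hf using 2 with v
  by_cases h : a v < b v
  · rw [if_pos h, if_neg (by omega)]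
  · rw [if_neg h, if_pos (by omega)]

lemma ite_eq {a b : (Fin k → ℕ) → ℕ} (ha : LogspaceComputable a) (hb : LogspaceComputable b)
    (hf : LogspaceComputable f) (hg : LogspaceComputable g) :
    LogspaceComputable fun v => if a v = b v then f v else g v := by
  convert ((hb.sub ha).add (ha.sub hb)).ite_zero hf hg using 2 with v
  by_cases h : a v = b v
  · rw [if_pos h, if_pos (by omega)]
  · rw [if_neg h, if_neg (by omega)]

/-- A finite lookup table, with one comparison per entry. It is used to renumber the gates of the
finite gate set. -/
lemma comp_finite (γ : ℕ → ℕ) (N : ℕ) (hγ : ∀ n, N ≤ n → γ n = 0)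
    (hf : LogspaceComputable f) : LogspaceComputable fun v => γ (f v) := by
  induction N generalizing γ with
  | zero =>
    convert const (k := k) 0 using 2 with v
    exact hγ _ (Nat.zero_le _)
  | succ N ih =>
    have := ih (fun n => if n = N then 0 else γ n) (fun n hn => by
      split_ifs with h
      · rfl
      · exact hγ n (by omega))
    convert ite_eq hf (const N) (const (γ N)) this using 2 with v
    by_cases h : f v = N <;> simp [h]

end LogspaceComputable

/-! ## Uniform tables with one parameter -/

/-- Logspace computable functions of one number. -/
def LogspaceFun (f : ℕ → ℕ) : Prop := LogspaceComputable fun v : Fin 1 → ℕ => f (v 0)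

/-- Logspace computable functions of two numbers. -/
def LogspaceFun₂ (f : ℕ → ℕ → ℕ) : Prop := LogspaceComputable fun v : Fin 2 → ℕ => f (v 0) (v 1)

section

variable {k : ℕ} {a b : (Fin k → ℕ) → ℕ}

lemma LogspaceFun.comp {f : ℕ → ℕ} (hf : LogspaceFun f) (ha : LogspaceComputable a) :
    LogspaceComputable fun v => f (a v) :=
  LogspaceComputable.comp (m := 1) hf (g := fun _ => a) fun _ => ha

lemma LogspaceFun₂.comp {f : ℕ → ℕ → ℕ} (hf : LogspaceFun₂ f) (ha : LogspaceComputable a)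
    (hb : LogspaceComputable b) : LogspaceComputable fun v => f (a v) (b v) :=
  LogspaceComputable.comp (m := 2) hf (g := ![a, b]) fun i => by fin_cases i <;> assumption

end

namespace LogspaceFun

variable {f g : ℕ → ℕ}

lemma const (c : ℕ) : LogspaceFun fun _ => c := LogspaceComputable.const c

lemma id : LogspaceFun fun l => l := LogspaceComputable.proj 0

lemma add (hf : LogspaceFun f) (hg : LogspaceFun g) : LogspaceFun fun l => f l + g l :=
  LogspaceComputable.add hf hg

lemma sub (hf : LogspaceFun f) (hg : LogspaceFun g) : LogspaceFun fun l => f l - g l :=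
  LogspaceComputable.sub hf hg

lemma left (hf : LogspaceFun f) : LogspaceFun₂ fun l _ => f l := hf.comp (.proj 0)

end LogspaceFun

namespace LogspaceFun₂

variable {e e' e'' : ℕ → ℕ → ℕ}

lemma snd : LogspaceFun₂ fun _ i => i := LogspaceComputable.proj 1

lemma add (he : LogspaceFun₂ e) (he' : LogspaceFun₂ e') : LogspaceFun₂ fun l i => e l i + e' l i :=
  LogspaceComputable.add he he'

lemma sub (he : LogspaceFun₂ e) (he' : LogspaceFun₂ e') : LogspaceFun₂ fun l i => e l i - e' l i :=
  LogspaceComputable.sub he he'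

lemma ite_lt {f : ℕ → ℕ} (hf : LogspaceFun f) (he : LogspaceFun₂ e) (he' : LogspaceFun₂ e') :
    LogspaceFun₂ fun l i => if i < f l then e l i else e' l i :=
  LogspaceComputable.ite_lt snd hf.left he he'

lemma comp₂ (he : LogspaceFun₂ e) (he' : LogspaceFun₂ e') :
    LogspaceFun₂ fun l i => e l (e' l i) :=
  LogspaceFun₂.comp he (.proj 0) he'

end LogspaceFun₂

/-- Logspace-uniform families of tables with one parameter. -/
structure UniformTable (L : ℕ → List (List ℕ)) : Prop where
  rows : LogspaceFun fun l => (L l).length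
  cols : LogspaceFun₂ fun l i => ((L l).getD i []).length
  entries : LogspaceComputable fun v : Fin 3 → ℕ => ((L (v 0)).getD (v 1) []).getD (v 2) 0

/-- Reduces families with several parameters, such as `Enc`, to the security parameter alone. -/
lemma LogspaceUniform.uniformTable {k : ℕ} {D : (Fin k → ℕ) → List (List ℕ)}
    (hD : LogspaceUniform D) {g : Fin k → ℕ → ℕ} (hg : ∀ i, LogspaceFun (g i)) :
    UniformTable fun l => D fun i => g i l where
  rows := hD.rows.comp fun i => (hg i).comp (.proj 0)
  cols := by
    refine hD.columns.comp (g := Fin.cons (fun v => v 1) fun i v => g i (v 0))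
      (Fin.cases ?_ fun i => ?_)
    · exact .proj 1
    · exact (hg i).comp (.proj 0)
  entries := by
    refine hD.entries.comp
      (g := Fin.cons (fun v => v 1) (Fin.cons (fun v => v 2) fun i v => g i (v 0)))
      (Fin.cases ?_ (Fin.cases ?_ fun i => ?_))
    · exact .proj 1
    · exact .proj 2
    · exact (hg i).comp (.proj 0)

lemma getD_ite (p : Prop) [Decidable p] (r r' : List ℕ) (j : ℕ) :
    (if p then r else r').getD j 0 = if p then r.getD j 0 else r'.getD j 0 := by
  split_ifs <;> rfl

namespace UniformTable

variable {L L' : ℕ → List (List ℕ)}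

lemma logspaceUniform (hL : UniformTable L) : LogspaceUniform fun v : Fin 1 → ℕ => L (v 0) where
  rows := hL.rows
  columns := LogspaceFun₂.comp hL.cols (.proj 1) (.proj 0)
  entries := hL.entries.comp (g := ![fun v => v 2, fun v => v 0, fun v => v 1])
    fun i => by fin_cases i <;> exact .proj _

lemma entries_comp (hL : UniformTable L) {k : ℕ} {a i j : (Fin k → ℕ) → ℕ}
    (ha : LogspaceComputable a) (hi : LogspaceComputable i) (hj : LogspaceComputable j) :
    LogspaceComputable fun v => ((L (a v)).getD (i v) []).getD (j v) 0 :=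
  hL.entries.comp (g := ![a, i, j]) fun i => by fin_cases i <;> assumption

lemma append (hL : UniformTable L) (hL' : UniformTable L') :
    UniformTable fun l => L l ++ L' l := by
  have key : ∀ l i, (L l ++ L' l).getD i [] =
      if i < (L l).length then (L l).getD i [] else (L' l).getD (i - (L l).length) [] := by
    intro l i
    split_ifs with h
    · exact List.getD_append _ _ _ _ h
    · exact List.getD_append_right _ _ _ _ (by omega)
  constructor
  · simpa using hL.rows.add hL'.rows
  · simp only [key, apply_ite List.length]
    exact .ite_lt hL.rows hL.cols (hL'.cols.comp₂ (.sub .snd hL.rows.left))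
  · simp only [key, getD_ite]
    exact .ite_lt (.proj 1) (hL.rows.comp (.proj 0)) hL.entries
      (hL'.entries_comp (.proj 0) (.sub (.proj 1) (hL.rows.comp (.proj 0))) (.proj 2))

lemma tail (hL : UniformTable L) : UniformTable fun l => (L l).tail := by
  have key : ∀ l i, (L l).tail.getD i [] = (L l).getD (i + 1) [] := by
    intro l i
    simp [List.getD_eq_getElem?_getD]
  constructor
  · simpa using hL.rows.sub (.const 1)
  · simp only [key]
    exact hL.cols.comp₂ (.add .snd (LogspaceFun.const 1).left)
  · simp only [key]
    exact hL.entries_comp (.proj 0) (.add (.proj 1) (.const 1)) (.proj 2)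

lemma reverse (hL : UniformTable L) : UniformTable fun l => (L l).reverse := by
  have key : ∀ l i, (L l).reverse.getD i [] =
      if i < (L l).length then (L l).getD ((L l).length - 1 - i) [] else [] := by
    intro l i
    split_ifs with h
    · simp [List.getD_eq_getElem?_getD, List.getElem?_reverse h]
    · exact List.getD_eq_default _ _ (by simpa using h)
  constructor
  · simpa using hL.rows
  · simp only [key, apply_ite List.length]
    exact .ite_lt hL.rows
      (hL.cols.comp₂ (.sub (.sub hL.rows.left (LogspaceFun.const 1).left) .snd))
      (LogspaceFun.const 0).left
  · simp only [key, getD_ite]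
    exact .ite_lt (.proj 1) (hL.rows.comp (.proj 0))
      (hL.entries_comp (.proj 0) (.sub (.sub (hL.rows.comp (.proj 0)) (.const 1)) (.proj 1))
        (.proj 2)) (.const 0)

/-- Apply `γ` to the first entry and `e` to the other entries. -/
def mapRow (γ e : ℕ → ℕ) : List ℕ → List ℕ
  | [] => []
  | g :: ws => γ g :: ws.map e

lemma map_mapRow (hL : UniformTable L) {γ : ℕ → ℕ} {N : ℕ} (hγ : ∀ n, N ≤ n → γ n = 0)
    {e : ℕ → ℕ → ℕ} (he : LogspaceFun₂ e) :
    UniformTable fun l => (L l).map (mapRow γ (e l)) := by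
  have key : ∀ l i, ((L l).map (mapRow γ (e l))).getD i [] =
      mapRow γ (e l) ((L l).getD i []) := by
    intro l i
    exact List.getD_map (f := mapRow γ (e l)) (L l) []
  have hlen : ∀ (e : ℕ → ℕ) r, (mapRow γ e r).length = r.length := by
    rintro e (_ | ⟨g, ws⟩) <;> simp [mapRow]
  have hent : ∀ (e : ℕ → ℕ) r j, (mapRow γ e r).getD j 0 =
      if j < r.length then if j = 0 then γ (r.getD 0 0) else e (r.getD j 0) else 0 := by
    intro e r j
    split_ifs with h h0
    · subst h0
      rcases r with (_ | ⟨g, ws⟩)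
      · simp at h
      · simp [mapRow]
    · rcases r with (_ | ⟨g, ws⟩)
      · simp at h
      · obtain ⟨j, rfl⟩ := Nat.exists_eq_succ_of_ne_zero h0
        have : j < ws.length := by simpa using h
        simp [mapRow, List.getD_eq_getElem?_getD, this]
    · exact List.getD_eq_default _ _ (by rw [hlen]; omega)
  constructor
  · simpa using hL.rows
  · simpa only [key, hlen] using hL.cols
  · simp only [key, hent]
    refine .ite_lt (.proj 2) (LogspaceFun₂.comp hL.cols (.proj 0) (.proj 1))
      (.ite_zero (.proj 2) ?_ ?_) (.const 0)
    · exact .comp_finite γ N hγ (hL.entries_comp (.proj 0) (.proj 1) (.const 0))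
    · exact LogspaceFun₂.comp he (.proj 0) hL.entries

/-- Tables with rows of length three. -/
lemma triples {n : ℕ → ℕ} (hn : LogspaceFun n) {f g h : ℕ → ℕ → ℕ} (hf : LogspaceFun₂ f)
    (hg : LogspaceFun₂ g) (hh : LogspaceFun₂ h) :
    UniformTable fun l => (List.range (n l)).map fun i => [f l i, g l i, h l i] := by
  have key : ∀ l i, ((List.range (n l)).map fun i => [f l i, g l i, h l i]).getD i [] =
      if i < n l then [f l i, g l i, h l i] else [] := by
    intro l i
    split_ifs with hi
    · simp [List.getD_eq_getElem?_getD, hi]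
    · exact List.getD_eq_default _ _ (by simpa using hi)
  -- Entries are selected by zero tests: once `j = 0` is excluded, `j - 1 = 0` means `j = 1`, and so
  -- on.
  have hent : ∀ a b c j : ℕ, [a, b, c].getD j 0 =
      if j = 0 then a else if j - 1 = 0 then b else if j - 2 = 0 then c else 0 := by
    intro a b c j
    match j with
    | 0 => rfl
    | 1 => rfl
    | 2 => rfl
    | j + 3 => simp
  constructor
  · simpa using hn
  · simp only [key, apply_ite List.length]
    exact .ite_lt hn (LogspaceFun.const 3).left (LogspaceFun.const 0).left
  · simp only [key, getD_ite, hent]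
    refine .ite_lt (.proj 1) (hn.comp (.proj 0)) (.ite_zero (.proj 2) ?_
      (.ite_zero (.sub (.proj 2) (.const 1)) ?_ (.ite_zero (.sub (.proj 2) (.const 2)) ?_
        (.const 0)))) (.const 0)
    · exact LogspaceFun₂.comp hf (.proj 0) (.proj 1)
    · exact LogspaceFun₂.comp hg (.proj 0) (.proj 1)
    · exact LogspaceFun₂.comp hh (.proj 0) (.proj 1)

lemma triple {f g h : ℕ → ℕ} (hf : LogspaceFun f) (hg : LogspaceFun g) (hh : LogspaceFun h) :
    UniformTable fun l => [[f l, g l, h l]] :=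
  triples (.const 1) hf.left hg.left hh.left

end UniformTable

section

variable {Op : ℕ → Type} [OpCode Op] {C : ℕ → Circuit Op}

/-- The first row of a description is the header `[ins, outs, width]`, so these numbers are entries
of the table and the gates are its tail. -/
lemma UniformTable.outs_desc (h : UniformTable fun l => (C l).desc) :
    LogspaceFun fun l => (C l).outs :=
  h.entries_comp (.proj 0) (.const 0) (.const 1)

lemma UniformTable.width_desc (h : UniformTable fun l => (C l).desc) :
    LogspaceFun fun l => (C l).width :=
  h.entries_comp (.proj 0) (.const 0) (.const 2)

lemma UniformTable.ops_desc (h : UniformTable fun l => (C l).desc) :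
    UniformTable fun l => (C l).ops.map OpCode.code :=
  h.tail

end

/-! ## Operators on wires -/

section Wires

variable {m k w W : ℕ}

open scoped Classical in
/-- Split a bit string into the bits on the wires `e` and the other bits. -/
def splitWires (e : Fin w ↪ Fin W) : Bits W ≃ Bits w × ({i // i ∉ Set.range e} → Bool) where
  toFun s := (fun j => s (e j), fun i => s i.1)
  invFun x i := if h : i ∈ Set.range e then x.1 h.choose else x.2 ⟨i, h⟩
  left_inv s := by
    funext i
    dsimp only
    split_ifs with h
    · rw [h.choose_spec]
    · rfl
  right_inv x := by
    refine Prod.ext ?_ ?_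
    · funext j
      have h : e j ∈ Set.range e := ⟨j, rfl⟩
      have h' : h.choose = j := e.injective h.choose_spec
      simp only [dif_pos h, h']
    · funext i
      simp only [dif_neg i.2]

/-- Replace the bits on the wires `e`. -/
def override (e : Fin w ↪ Fin W) (a : Bits w) (s : Bits W) : Bits W :=
  (splitWires e).symm (a, (splitWires e s).2)

lemma splitWires_symm_apply_mem (e : Fin w ↪ Fin W) (x) (j : Fin w) :
    (splitWires e).symm x (e j) = x.1 j := by
  have := congrArg (fun y => y.1 j) ((splitWires e).apply_symm_apply x)
  exact this

lemma splitWires_symm_apply_notMem (e : Fin w ↪ Fin W) (x) {i : Fin W}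
    (hi : i ∉ Set.range e) : (splitWires e).symm x i = x.2 ⟨i, hi⟩ := by
  have := congrArg (fun y => y.2 ⟨i, hi⟩) ((splitWires e).apply_symm_apply x)
  exact this

@[simp] lemma override_apply (e : Fin w ↪ Fin W) (a : Bits w) (s : Bits W) (j : Fin w) :
    override e a s (e j) = a j :=
  splitWires_symm_apply_mem _ _ _

lemma override_of_notMem (e : Fin w ↪ Fin W) (a : Bits w) (s : Bits W) {i : Fin W}
    (hi : i ∉ Set.range e) : override e a s i = s i :=
  splitWires_symm_apply_notMem _ _ hi

lemma bits_ext_wires (e : Fin w ↪ Fin W) {s t : Bits W} (h : ∀ j, s (e j) = t (e j))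
    (h' : ∀ i ∉ Set.range e, s i = t i) : s = t := by
  funext i
  by_cases hi : i ∈ Set.range e
  · obtain ⟨j, rfl⟩ := hi
    exact h j
  · exact h' i hi

lemma onWires_apply (e : Fin w ↪ Fin W) (M : Matrix (Bits w) (Bits w) ℂ) (s t : Bits W) :
    onWires e M s t =
      M (splitWires e s).1 (splitWires e t).1 *
        if (splitWires e s).2 = (splitWires e t).2 then 1 else 0 := by
  have : (∀ i, (∀ j, e j ≠ i) → s i = t i) ↔ (splitWires e s).2 = (splitWires e t).2 := by
    rw [funext_iff]
    constructor
    · exact fun h i => h i.1 fun j hj => i.2 ⟨j, hj⟩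
    · exact fun h i hi => h ⟨i, fun ⟨j, hj⟩ => hi j hj⟩
  rw [mul_ite, mul_one, mul_zero]
  exact if_congr this rfl rfl

/-- After reordering the qubits, `onWires e M` is `M ⊗ 1`. Its algebra is thereby inherited from the
Kronecker product. -/
lemma onWires_eq (e : Fin w ↪ Fin W) (M : Matrix (Bits w) (Bits w) ℂ) :
    onWires e M = (M ⊗ₖ (1 : Matrix ({i // i ∉ Set.range e} → Bool) _ ℂ)).submatrix
      (splitWires e) (splitWires e) := by
  ext s t
  rw [onWires_apply, Matrix.submatrix_apply, Matrix.kroneckerMap_apply, Matrix.one_apply]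

lemma onWires_mul (e : Fin w ↪ Fin W) (M N : Matrix (Bits w) (Bits w) ℂ) :
    onWires e (M * N) = onWires e M * onWires e N := by
  rw [onWires_eq, onWires_eq, onWires_eq, Matrix.submatrix_mul_equiv, ← Matrix.mul_kronecker_mul,
    one_mul]

@[simp] lemma onWires_one (e : Fin w ↪ Fin W) :
    onWires e (1 : Matrix (Bits w) (Bits w) ℂ) = 1 := by
  rw [onWires_eq, Matrix.one_kronecker_one, Matrix.submatrix_one_equiv]

lemma onWires_conjTranspose (e : Fin w ↪ Fin W) (M : Matrix (Bits w) (Bits w) ℂ) :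
    onWires e M.conjTranspose = (onWires e M).conjTranspose := by
  rw [onWires_eq, onWires_eq, Matrix.conjTranspose_submatrix, Matrix.conjTranspose_kronecker,
    Matrix.conjTranspose_one]

lemma onWires_sum {ι : Type*} (S : Finset ι) (e : Fin w ↪ Fin W)
    (M : ι → Matrix (Bits w) (Bits w) ℂ) :
    onWires e (∑ i ∈ S, M i) = ∑ i ∈ S, onWires e (M i) := by
  ext s t
  simp only [onWires_apply, Matrix.sum_apply, Finset.sum_mul]

lemma onWires_trans (f : Fin k ↪ Fin w) (e : Fin w ↪ Fin W) (M : Matrix (Bits k) (Bits k) ℂ) :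
    onWires (f.trans e) M = onWires e (onWires f M) := by
  ext s t
  simp only [onWires, Matrix.of_apply, Function.Embedding.trans_apply]
  rw [← ite_and]
  refine if_congr ⟨fun h => ⟨fun i hi => h i fun j => hi _, fun i hi => h _ fun j hj =>
    hi j (e.injective hj)⟩, fun ⟨h, h'⟩ i hi => ?_⟩ rfl rfl
  by_cases hie : ∃ j, e j = i
  · obtain ⟨j, rfl⟩ := hie
    exact h' j fun j' hj' => hi j' (by rw [hj'])
  · exact h i fun j hj => hie ⟨j, hj⟩

lemma onWires_unitary (e : Fin w ↪ Fin W) {M : Matrix (Bits w) (Bits w) ℂ}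
    (hM : M ∈ Matrix.unitaryGroup (Bits w) ℂ) :
    onWires e M ∈ Matrix.unitaryGroup (Bits W) ℂ := by
  rw [Matrix.mem_unitaryGroup_iff, Matrix.star_eq_conjTranspose] at hM ⊢
  rw [← onWires_conjTranspose, ← onWires_mul, hM, onWires_one]

lemma onWires_mulVec (e : Fin w ↪ Fin W) (M : Matrix (Bits w) (Bits w) ℂ) (Φ : Bits W → ℂ)
    (s : Bits W) :
    (onWires e M).mulVec Φ s = ∑ a, M (fun j => s (e j)) a * Φ (override e a s) := by
  simp only [Matrix.mulVec, dotProduct]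
  rw [← (splitWires e).symm.sum_comp, Fintype.sum_prod_type]
  refine Finset.sum_congr rfl fun a _ => ?_
  rw [Finset.sum_eq_single (splitWires e s).2]
  · rw [onWires_apply, Equiv.apply_symm_apply, if_pos rfl, mul_one]
    rfl
  · intro r _ hr
    rw [onWires_apply]
    simp [hr.symm]
  · simp

/-- The part of a vector with fixed bits outside the wires `e`. -/
def slice (e : Fin w ↪ Fin W) (Φ : Bits W → ℂ) (r : {i // i ∉ Set.range e} → Bool) :
    Bits w → ℂ :=
  fun a => Φ ((splitWires e).symm (a, r))

lemma slice_ext (e : Fin w ↪ Fin W) {Φ Ψ : Bits W → ℂ} (h : ∀ r, slice e Φ r = slice e Ψ r) :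
    Φ = Ψ := by
  funext s
  have := congrFun (h (splitWires e s).2) (splitWires e s).1
  simpa [slice] using this

/-- A vector on all wires is a family of vectors on the wires `e`, indexed by the other bits, and
`M` acts on each member separately. Local identities can thus be checked slice by slice. -/
lemma slice_onWires (e : Fin w ↪ Fin W) (M : Matrix (Bits w) (Bits w) ℂ) (Φ : Bits W → ℂ) (r) :
    slice e ((onWires e M).mulVec Φ) r = M.mulVec (slice e Φ r) := by
  funext a
  rw [slice, onWires_mulVec]
  simp only [splitWires_symm_apply_mem, override, Equiv.apply_symm_apply]
  rfl

/-- The quadratic form of a matrix. -/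
def quadForm {ι : Type*} [Fintype ι] (M : Matrix ι ι ℂ) (φ : ι → ℂ) : ℂ :=
  star φ ⬝ᵥ M.mulVec φ

lemma expval_eq_re_quadForm {ι : Type*} [Fintype ι] (φ : ι → ℂ) (M : Matrix ι ι ℂ) :
    expval φ M = (quadForm M φ).re := rfl

lemma quadForm_conj {ι κ : Type*} [Fintype ι] [Fintype κ] (M : Matrix κ κ ℂ) (A : Matrix κ ι ℂ)
    (φ : ι → ℂ) : quadForm (A.conjTranspose * M * A) φ = quadForm M (A.mulVec φ) := by
  simp only [quadForm, Matrix.star_mulVec, ← Matrix.mulVec_mulVec, Matrix.dotProduct_mulVec,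
    Matrix.vecMul_vecMul]

lemma quadForm_sum {ι κ : Type*} [Fintype ι] (S : Finset κ) (M : κ → Matrix ι ι ℂ) (φ : ι → ℂ) :
    quadForm (∑ i ∈ S, M i) φ = ∑ i ∈ S, quadForm (M i) φ := by
  simp only [quadForm, Matrix.sum_mulVec, dotProduct_sum]

lemma quadForm_one {ι : Type*} [Fintype ι] [DecidableEq ι] (φ : ι → ℂ) :
    quadForm 1 φ = ((∑ i, ‖φ i‖ ^ 2 : ℝ) : ℂ) := by
  simp only [quadForm, Matrix.one_mulVec, dotProduct, Pi.star_apply, RCLike.star_def,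
    Complex.conj_mul']
  push_cast
  rfl

lemma quadForm_onWires (e : Fin w ↪ Fin W) (M : Matrix (Bits w) (Bits w) ℂ) (Φ : Bits W → ℂ) :
    quadForm (onWires e M) Φ = ∑ r, quadForm M (slice e Φ r) := by
  simp only [quadForm, dotProduct]
  rw [← (splitWires e).symm.sum_comp, Fintype.sum_prod_type_right]
  refine Finset.sum_congr rfl fun r _ => Finset.sum_congr rfl fun a _ => ?_
  have := congrFun (slice_onWires e M Φ r) a
  rw [← this]
  rfl

open scoped Classical in
/-- The vector that is `φ` on the wires `p` and `b` on the other wires. -/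
def place (p : Fin m ↪ Fin w) (b : Bits w) (φ : Bits m → ℂ) : Bits w → ℂ :=
  fun t => if ∀ i ∉ Set.range p, t i = b i then φ fun j => t (p j) else 0

lemma slice_place (p : Fin m ↪ Fin w) (b : Bits w) (φ : Bits m → ℂ) (r) :
    slice p (place p b φ) r = if r = (splitWires p b).2 then φ else 0 := by
  funext a
  have : (∀ i ∉ Set.range p, (splitWires p).symm (a, r) i = b i) ↔ r = (splitWires p b).2 := by
    rw [funext_iff]
    constructor
    · intro h i
      rw [← show b i.1 = (splitWires p b).2 i from rfl, ← h i.1 i.2,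
        splitWires_symm_apply_notMem _ _ i.2]
    · intro h i hi
      rw [splitWires_symm_apply_notMem _ _ hi]
      exact h ⟨i, hi⟩
  simp only [slice, place, this, splitWires_symm_apply_mem]
  split_ifs <;> rfl

lemma onWires_mulVec_place (p : Fin m ↪ Fin w) (b : Bits w) (φ : Bits m → ℂ)
    (M : Matrix (Bits m) (Bits m) ℂ) :
    (onWires p M).mulVec (place p b φ) = place p b (M.mulVec φ) := by
  refine slice_ext p fun r => ?_
  rw [slice_onWires, slice_place, slice_place]
  split_ifs
  · rfl
  · exact Matrix.mulVec_zero _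

lemma quadForm_onWires_place (p : Fin m ↪ Fin w) (b : Bits w) (φ : Bits m → ℂ)
    (M : Matrix (Bits m) (Bits m) ℂ) :
    quadForm (onWires p M) (place p b φ) = quadForm M φ := by
  rw [quadForm_onWires, Finset.sum_eq_single (splitWires p b).2]
  · rw [slice_place, if_pos rfl]
  · intro r _ hr
    rw [slice_place, if_neg hr]
    simp [quadForm]
  · simp

lemma place_add (p : Fin m ↪ Fin w) (b : Bits w) (φ ψ : Bits m → ℂ) :
    place p b (φ + ψ) = place p b φ + place p b ψ := by
  funext t
  simp only [place, Pi.add_apply]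
  split_ifs <;> simp

lemma sum_norm_sq_place (p : Fin m ↪ Fin w) (b : Bits w) (φ : Bits m → ℂ) :
    ∑ t, ‖place p b φ t‖ ^ 2 = ∑ t, ‖φ t‖ ^ 2 := by
  have := quadForm_onWires_place p b φ 1
  rw [onWires_one, quadForm_one, quadForm_one] at this
  exact_mod_cast this

/-- The vector is supported on bit strings whose bit `i` is `β`. -/
def FixedAt (Φ : Bits W → ℂ) (i : Fin W) (β : Bool) : Prop := ∀ s, s i ≠ β → Φ s = 0

lemma FixedAt.onWires {Φ : Bits W → ℂ} {i : Fin W} {β : Bool} (h : FixedAt Φ i β)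
    (e : Fin w ↪ Fin W) (hi : i ∉ Set.range e) (M : Matrix (Bits w) (Bits w) ℂ) :
    FixedAt ((onWires e M).mulVec Φ) i β := by
  intro s hs
  rw [onWires_mulVec]
  refine Finset.sum_eq_zero fun a _ => ?_
  rw [h _ (by rwa [override_of_notMem _ _ _ hi]), mul_zero]

lemma slice_eq_place {Φ : Bits W → ℂ} (e : Fin w ↪ Fin W) (p : Fin m ↪ Fin w) (b : Bits w)
    (h : ∀ i ∉ Set.range p, FixedAt Φ (e i) (b i)) (r) :
    slice e Φ r = place p b fun a => slice e Φ r (override p a b) := by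
  funext a
  simp only [place]
  split_ifs with ha
  · congr 1
    refine bits_ext_wires p (fun j => ?_) fun i hi => ?_
    · rw [override_apply]
    · rw [override_of_notMem _ _ _ hi, ha i hi]
  · push Not at ha
    obtain ⟨i, hi, hne⟩ := ha
    refine h i hi _ ?_
    rwa [splitWires_symm_apply_mem]

/-- A local identity on vectors `place p b φ` holds for all vectors of this form on the wires
`e`. -/
lemma onWires_mulVec_eq_of_place (e : Fin w ↪ Fin W) (p : Fin m ↪ Fin w) (b : Bits w)
    {A : Matrix (Bits w) (Bits w) ℂ} {R : Matrix (Bits m) (Bits m) ℂ}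
    (hA : ∀ φ, A.mulVec (place p b φ) = place p b (R.mulVec φ)) {Φ : Bits W → ℂ}
    (h : ∀ i ∉ Set.range p, FixedAt Φ (e i) (b i)) :
    (onWires e A).mulVec Φ = (onWires (p.trans e) R).mulVec Φ := by
  rw [onWires_trans]
  refine slice_ext e fun r => ?_
  rw [slice_onWires, slice_onWires, slice_eq_place e p b h, hA, onWires_mulVec_place]

lemma quadForm_onWires_eq_of_place (e : Fin w ↪ Fin W) (p : Fin m ↪ Fin w) (b : Bits w)
    {A : Matrix (Bits w) (Bits w) ℂ} {R : Matrix (Bits m) (Bits m) ℂ}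
    (hA : ∀ φ, quadForm A (place p b φ) = quadForm R φ) {Φ : Bits W → ℂ}
    (h : ∀ i ∉ Set.range p, FixedAt Φ (e i) (b i)) :
    quadForm (onWires e A) Φ = quadForm (onWires (p.trans e) R) Φ := by
  rw [onWires_trans, quadForm_onWires, quadForm_onWires]
  refine Finset.sum_congr rfl fun r _ => ?_
  rw [slice_eq_place e p b h, hA, quadForm_onWires_place]

end Wires

/-! ## Measuring without disturbing -/

section Measure

variable {m k w W : ℕ}

lemma sum_norm_sq_mulVec {ι : Type*} [Fintype ι] [DecidableEq ι] {V : Matrix ι ι ℂ}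
    (hV : V ∈ Matrix.unitaryGroup ι ℂ) (φ : ι → ℂ) :
    ∑ i, ‖V.mulVec φ i‖ ^ 2 = ∑ i, ‖φ i‖ ^ 2 := by
  have h := quadForm_conj 1 V φ
  rw [Matrix.mem_unitaryGroup_iff', Matrix.star_eq_conjTranspose] at hV
  rw [mul_one, hV, quadForm_one, quadForm_one] at h
  exact_mod_cast h.symm

/-- The projection onto the basis vectors in `D`. -/
def basisProj {ι : Type*} [DecidableEq ι] (D : ι → Prop) [DecidablePred D] : Matrix ι ι ℂ :=
  Matrix.diagonal fun t => if D t then 1 else 0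

lemma basisProj_mulVec {ι : Type*} [Fintype ι] [DecidableEq ι] (D : ι → Prop) [DecidablePred D]
    (φ : ι → ℂ) (t : ι) : (basisProj D).mulVec φ t = if D t then φ t else 0 := by
  simp [basisProj, Matrix.mulVec_diagonal]

lemma quadForm_basisProj {ι : Type*} [Fintype ι] [DecidableEq ι] (D : ι → Prop) [DecidablePred D]
    (φ : ι → ℂ) :
    quadForm (basisProj D) φ = ((∑ t, if D t then ‖φ t‖ ^ 2 else 0 : ℝ) : ℂ) := by
  simp only [quadForm, dotProduct, basisProj_mulVec, Pi.star_apply, RCLike.star_def]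
  push_cast
  refine Finset.sum_congr rfl fun t _ => ?_
  split_ifs
  · rw [Complex.conj_mul']
    push_cast
    rfl
  · simp

/-- Outcome probabilities on all states determine the measurement once it is uncomputed. On a vector
in the range of `R` the event `D` has full probability, so `V` maps it into the span of `D`; on a
vector killed by `R` it has probability zero, so the projection onto `D` annihilates its image.
Splitting `φ = Rφ + (φ - Rφ)` and applying `Vᴴ` leaves `Rφ`, with the ancillas restored. -/
lemma conj_basisProj_mulVec_place {p : Fin m ↪ Fin w} {b : Bits w} {D : Bits w → Prop}
    [DecidablePred D] {V : Matrix (Bits w) (Bits w) ℂ} {R : Matrix (Bits m) (Bits m) ℂ}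
    (hV : V ∈ Matrix.unitaryGroup (Bits w) ℂ) (hR : R * R = R)
    (h : ∀ φ, (∑ t, if D t then ‖V.mulVec (place p b φ) t‖ ^ 2 else 0) = expval φ R)
    (φ : Bits m → ℂ) :
    (V.conjTranspose * basisProj D * V).mulVec (place p b φ) = place p b (R.mulVec φ) := by
  have hRφ : R.mulVec (R.mulVec φ) = R.mulVec φ := by rw [Matrix.mulVec_mulVec, hR]
  have h1 : (basisProj D).mulVec (V.mulVec (place p b (R.mulVec φ))) =
      V.mulVec (place p b (R.mulVec φ)) := by
    set χ := V.mulVec (place p b (R.mulVec φ)) with hχ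
    have e1 := h (R.mulVec φ)
    have e2 : expval (R.mulVec φ) R = ∑ t, ‖χ t‖ ^ 2 := by
      rw [hχ, sum_norm_sq_mulVec hV, sum_norm_sq_place]
      have : quadForm R (R.mulVec φ) = quadForm 1 (R.mulVec φ) := by
        simp only [quadForm, hRφ, Matrix.one_mulVec]
      rw [expval_eq_re_quadForm, this, quadForm_one, Complex.ofReal_re]
    rw [e2] at e1
    have e3 := (Finset.sum_eq_sum_iff_of_le (s := Finset.univ) (fun t _ => by
      split_ifs
      · exact le_rfl
      · positivity)).1 e1
    funext t
    rw [basisProj_mulVec]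
    have e4 := e3 t (Finset.mem_univ _)
    split_ifs with hD
    · rfl
    · rw [if_neg hD] at e4
      exact (norm_eq_zero.1 (pow_eq_zero_iff two_ne_zero |>.1 e4.symm)).symm
  have h2 : (basisProj D).mulVec (V.mulVec (place p b (φ - R.mulVec φ))) = 0 := by
    have e1 := h (φ - R.mulVec φ)
    have e2 : expval (φ - R.mulVec φ) R = 0 := by
      simp only [expval, Matrix.mulVec_sub, hRφ, sub_self, dotProduct_zero, Complex.zero_re]
    rw [e2, Finset.sum_eq_zero_iff_of_nonneg (fun t _ => by split_ifs <;> positivity)] at e1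
    funext t
    rw [basisProj_mulVec]
    have e4 := e1 t (Finset.mem_univ _)
    split_ifs with hD
    · rw [if_pos hD] at e4
      exact norm_eq_zero.1 (pow_eq_zero_iff two_ne_zero |>.1 e4)
    · rfl
  have h3 : place p b φ = place p b (R.mulVec φ) + place p b (φ - R.mulVec φ) := by
    rw [← place_add, add_sub_cancel]
  rw [Matrix.mem_unitaryGroup_iff', Matrix.star_eq_conjTranspose] at hV
  conv_lhs => rw [h3]
  rw [Matrix.mulVec_add, ← Matrix.mulVec_mulVec, ← Matrix.mulVec_mulVec, h1, Matrix.mulVec_mulVec,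
    hV, Matrix.one_mulVec, ← Matrix.mulVec_mulVec, ← Matrix.mulVec_mulVec, h2, Matrix.mulVec_zero,
    add_zero]

end Measure

/-! ## Lists of gates -/

section Gates

variable {𝒢 : GateSet} {m k n w W : ℕ}

/-- The unitary of a list of gates. -/
def opsMat (ops : List (QOp 𝒢 w)) : Matrix (Bits w) (Bits w) ℂ :=
  ops.foldl (fun U o => QOp.mat o * U) 1

lemma foldl_mat_mul (ops : List (QOp 𝒢 w)) (A : Matrix (Bits w) (Bits w) ℂ) :
    ops.foldl (fun U o => QOp.mat o * U) A = opsMat ops * A := by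
  induction ops using List.reverseRecOn with
  | nil => simp [opsMat]
  | append_singleton ops o ih => simp [opsMat] at ih ⊢; rw [ih, mul_assoc]

@[simp] lemma opsMat_nil : opsMat ([] : List (QOp 𝒢 w)) = 1 := rfl

lemma opsMat_append (ops ops' : List (QOp 𝒢 w)) :
    opsMat (ops ++ ops') = opsMat ops' * opsMat ops := by
  rw [opsMat, List.foldl_append, foldl_mat_mul]
  rfl

lemma opsMat_singleton (o : QOp 𝒢 w) : opsMat [o] = o.mat := by
  simp [opsMat]

lemma opsMat_cons (o : QOp 𝒢 w) (ops : List (QOp 𝒢 w)) :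
    opsMat (o :: ops) = opsMat ops * o.mat := by
  rw [← List.singleton_append, opsMat_append, opsMat_singleton]

lemma QOp.mat_unitary (o : QOp 𝒢 w) : o.mat ∈ Matrix.unitaryGroup (Bits w) ℂ :=
  onWires_unitary _ (𝒢.unitary _)

lemma opsMat_unitary (ops : List (QOp 𝒢 w)) : opsMat ops ∈ Matrix.unitaryGroup (Bits w) ℂ := by
  induction ops with
  | nil => exact one_mem _
  | cons o ops ih => rw [opsMat_cons]; exact mul_mem ih o.mat_unitary

/-- Move a gate along an embedding of the wires. -/
def QOp.map (e : Fin w ↪ Fin W) (o : QOp 𝒢 w) : QOp 𝒢 W := ⟨o.gate, o.wires.trans e⟩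

lemma opsMat_map (e : Fin w ↪ Fin W) (ops : List (QOp 𝒢 w)) :
    opsMat (ops.map (QOp.map e)) = onWires e (opsMat ops) := by
  induction ops with
  | nil => simp
  | cons o ops ih =>
    rw [List.map_cons, opsMat_cons, opsMat_cons, ih, onWires_mul]
    congr 1
    exact onWires_trans _ _ _

/-- A gate with a given matrix. -/
lemma exists_place_gate {M : Matrix (Bits k) (Bits k) ℂ} {g : Fin 𝒢.num}
    (h : 𝒢.gate g = ⟨k, M⟩) (f : Fin k ↪ Fin w) :
    ∃ o : QOp 𝒢 w, o.mat = onWires f M ∧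
      OpCode.code o = g.val :: List.ofFn fun i => (f i).val := by
  -- The arity of `g` equals `k` only propositionally. Abstracting the dependent pair allows the
  -- equation to be substituted.
  have key : ∀ x : (k : ℕ) × Matrix (Bits k) (Bits k) ℂ, x = ⟨k, M⟩ →
      ∃ f' : Fin x.1 ↪ Fin w, onWires f' x.2 = onWires f M ∧
        (List.ofFn fun i => (f' i).val) = List.ofFn fun i => (f i).val := by
    rintro _ rfl
    exact ⟨f, rfl, rfl⟩
  obtain ⟨f', h1, h2⟩ := key _ h
  exact ⟨⟨g, f'⟩, h1, congrArg (g.val :: ·) h2⟩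

/-- The number of an inverse gate. -/
def GateSet.inv (𝒢 : GateSet) (g : Fin 𝒢.num) : Fin 𝒢.num := (𝒢.inverse g).choose

/-- The inverse of a placed gate. -/
def QOp.inv (o : QOp 𝒢 w) : QOp 𝒢 w :=
  (exists_place_gate (𝒢.inverse o.gate).choose_spec o.wires).choose

lemma QOp.mat_inv (o : QOp 𝒢 w) : o.inv.mat = o.mat.conjTranspose :=
  ((exists_place_gate (𝒢.inverse o.gate).choose_spec o.wires).choose_spec.1).trans
    (onWires_conjTranspose _ _)

lemma QOp.code_inv (o : QOp 𝒢 w) :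
    OpCode.code o.inv = (𝒢.inv o.gate).val :: List.ofFn fun i => (o.wires i).val :=
  (exists_place_gate (𝒢.inverse o.gate).choose_spec o.wires).choose_spec.2

lemma opsMat_inverse (ops : List (QOp 𝒢 w)) :
    opsMat (ops.reverse.map QOp.inv) = (opsMat ops).conjTranspose := by
  induction ops with
  | nil => simp
  | cons o ops ih =>
    rw [List.reverse_cons, List.map_append, List.map_cons, List.map_nil, opsMat_append, ih,
      opsMat_singleton, opsMat_cons, QOp.mat_inv, Matrix.conjTranspose_mul]

/-- Two wires. -/
def pairWires (i j : Fin w) (h : i ≠ j) : Fin 2 ↪ Fin w :=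
  ⟨![i, j], fun a b hab => by fin_cases a <;> fin_cases b <;> simp_all⟩

/-- A CNOT gate. -/
def cnotOp (𝒢 : GateSet) (i j : Fin w) (h : i ≠ j) : QOp 𝒢 w :=
  (exists_place_gate 𝒢.cnot_mem.choose_spec (pairWires i j h)).choose

lemma code_cnotOp (i j : Fin w) (h : i ≠ j) :
    OpCode.code (cnotOp 𝒢 i j h) = [𝒢.cnot_mem.choose.val, i.val, j.val] :=
  (exists_place_gate 𝒢.cnot_mem.choose_spec (pairWires i j h)).choose_spec.2.trans (by
    simp [List.ofFn_succ]
    exact ⟨rfl, rfl⟩)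

lemma cnotOp_mulVec (i j : Fin w) (h : i ≠ j) (Φ : Bits w → ℂ) (s : Bits w) :
    (cnotOp 𝒢 i j h).mat.mulVec Φ s = Φ (Function.update s j (xor (s j) (s i))) := by
  have : (cnotOp 𝒢 i j h).mat = onWires (pairWires i j h) cnotGate :=
    (exists_place_gate 𝒢.cnot_mem.choose_spec (pairWires i j h)).choose_spec.1
  have h0 : pairWires i j h 0 = i := rfl
  have h1 : pairWires i j h 1 = j := rfl
  rw [this, onWires_mulVec, Finset.sum_eq_single ![s i, xor (s j) (s i)]]
  · rw [cnotGate, Matrix.of_apply, if_pos, one_mul]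
    · congr 1
      refine bits_ext_wires (pairWires i j h) (fun a => ?_) fun t ht => ?_
      · rw [override_apply]
        fin_cases a
        · simp [h0, h]
        · simp [h1]
      · rw [override_of_notMem _ _ _ ht, Function.update_of_ne]
        rintro rfl
        exact ht ⟨1, rfl⟩
    · simp [h0, h1]
  · intro a _ ha
    rw [cnotGate, Matrix.of_apply, if_neg, zero_mul]
    rintro ⟨h2, h3⟩
    simp only [h0, h1] at h2 h3
    refine ha (funext fun b => ?_)
    fin_cases b
    · simp [h2]
    · simp [h2, h3]
  · simp

/-- Copy the wires `S` to the wires `T`. -/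
def copyOps (𝒢 : GateSet) (S : Fin k → Fin w) (T : Fin k → Fin w) (h : ∀ i j, S i ≠ T j) :
    List (QOp 𝒢 w) :=
  List.ofFn fun i => cnotOp 𝒢 (S i) (T i) (h i i)

/-- No source is a target, so the source bits stay constant and the CNOTs combine into one addition.
This permutation is its own inverse, whence the formula as a pullback. -/
lemma opsMat_copyOps_mulVec (S : Fin k → Fin w) (T : Fin k ↪ Fin w) (h : ∀ i j, S i ≠ T j)
    (Φ : Bits w → ℂ) (s : Bits w) :
    (opsMat (copyOps 𝒢 S T h)).mulVec Φ s = Φ (xorAt T (fun i => s (S i)) s) := by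
  induction k generalizing Φ with
  | zero =>
    have : xorAt T (fun i => s (S i)) s = s := by
      funext i
      simp [xorAt]
    rw [this]
    simp [copyOps]
  | succ k ih =>
    have := ih (fun i => S i.succ) ((Fin.succEmb k).trans T) (fun i j => h _ _)
      ((cnotOp 𝒢 (S 0) (T 0) (h 0 0)).mat.mulVec Φ)
    rw [copyOps, List.ofFn_succ, opsMat_cons, ← Matrix.mulVec_mulVec]
    refine this.trans ?_
    rw [cnotOp_mulVec]
    congr 1
    funext i
    have h0 : ∀ j : Fin k, T j.succ ≠ S 0 := fun j => (h _ _).symm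
    have h1 : ∀ j : Fin k, T j.succ ≠ T 0 := fun j hj => Fin.succ_ne_zero j (T.injective hj)
    by_cases hi : i = T 0
    · subst hi
      simp [xorAt, h0, h1]
    · simp [xorAt, hi, Fin.exists_fin_succ, Ne.symm hi]

end Gates

/-! ## Adding bits -/

section XorAt

variable {k w W : ℕ}

lemma xorAt_apply (T : Fin k ↪ Fin W) (y : Bits k) (s : Bits W) (j : Fin k) :
    xorAt T y s (T j) = xor (s (T j)) (y j) := by
  simp [xorAt]

lemma xorAt_of_notMem (T : Fin k ↪ Fin W) (y : Bits k) (s : Bits W) {i : Fin W}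
    (hi : ∀ j, T j ≠ i) : xorAt T y s i = s i := by
  simp [xorAt, hi]

lemma xorAt_involutive (T : Fin k ↪ Fin W) (y : Bits k) :
    Function.Involutive (xorAt T y : Bits W → Bits W) := by
  intro s
  funext i
  simp only [xorAt]
  rw [Bool.xor_assoc, Bool.xor_self, Bool.xor_false]

lemma xorAt_override (e : Fin w ↪ Fin W) (T : Fin k ↪ Fin W) (h : ∀ i j, T j ≠ e i) (y : Bits k)
    (a : Bits w) (s : Bits W) :
    xorAt T y (override e a s) = override e a (xorAt T y s) := by
  refine bits_ext_wires e (fun j => ?_) fun i hi => ?_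
  · rw [xorAt_of_notMem _ _ _ (h j), override_apply, override_apply]
  · rw [override_of_notMem _ _ _ hi, xorAt, xorAt, override_of_notMem _ _ _ hi]

lemma onWires_mulVec_xorAt (e : Fin w ↪ Fin W) (T : Fin k ↪ Fin W) (h : ∀ i j, T j ≠ e i)
    (M : Matrix (Bits w) (Bits w) ℂ) (y : Bits k) (Φ : Bits W → ℂ) (s : Bits W) :
    (onWires e M).mulVec (fun t => Φ (xorAt T y t)) s =
      (onWires e M).mulVec Φ (xorAt T y s) := by
  simp only [onWires_mulVec, xorAt_override e T h]
  simp only [xorAt_of_notMem T y s (h _)]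

lemma quadForm_onWires_xorAt (e : Fin w ↪ Fin W) (T : Fin k ↪ Fin W) (h : ∀ i j, T j ≠ e i)
    (M : Matrix (Bits w) (Bits w) ℂ) (y : Bits k) (Φ : Bits W → ℂ) :
    quadForm (onWires e M) (fun t => Φ (xorAt T y t)) = quadForm (onWires e M) Φ := by
  simp only [quadForm, dotProduct, onWires_mulVec_xorAt e T h, Pi.star_apply]
  exact Equiv.sum_comp (xorAt_involutive T y).toPerm
    fun s => star (Φ s) * (onWires e M).mulVec Φ s

/-- The part of a vector with bits `y` on the wires `T`. -/
def restrictWires (T : Fin k ↪ Fin W) (y : Bits k) (Φ : Bits W → ℂ) : Bits W → ℂ :=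
  fun s => if (fun j => s (T j)) = y then Φ s else 0

lemma onWires_mulVec_restrictWires (e : Fin w ↪ Fin W) (T : Fin k ↪ Fin W)
    (h : ∀ i j, T j ≠ e i) (M : Matrix (Bits w) (Bits w) ℂ) (y : Bits k) (Φ : Bits W → ℂ) :
    (onWires e M).mulVec (restrictWires T y Φ) =
      restrictWires T y ((onWires e M).mulVec Φ) := by
  funext s
  have : ∀ a j, override e a s (T j) = s (T j) := fun a j =>
    override_of_notMem _ _ _ fun ⟨i, hi⟩ => h i j hi.symm
  simp only [restrictWires, onWires_mulVec, this]
  split_ifs <;> simp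

/-- Deferred measurement: an operator that avoids `T` preserves the bits there, so there are no
cross terms between different values of `y`. -/
lemma quadForm_onWires_restrictWires (e : Fin w ↪ Fin W) (T : Fin k ↪ Fin W)
    (h : ∀ i j, T j ≠ e i) (M : Matrix (Bits w) (Bits w) ℂ) (Φ : Bits W → ℂ) :
    quadForm (onWires e M) Φ = ∑ y, quadForm (onWires e M) (restrictWires T y Φ) := by
  simp only [quadForm, onWires_mulVec_restrictWires e T h, dotProduct]
  rw [Finset.sum_comm]
  refine Finset.sum_congr rfl fun s _ => ?_
  simp [restrictWires, apply_ite (star : ℂ → ℂ)]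

lemma FixedAt.xorAt {Φ : Bits W → ℂ} (T : Fin k ↪ Fin W) (y : Bits k) {i : Fin W} {β : Bool}
    (h : FixedAt Φ i β) (hi : ∀ j, T j ≠ i) : FixedAt (fun t => Φ (xorAt T y t)) i β := by
  intro s hs
  exact h _ (by rwa [xorAt_of_notMem _ _ _ hi])

lemma FixedAt.xorAt_self {Φ : Bits W → ℂ} (T : Fin k ↪ Fin W) (y : Bits k) {j : Fin k}
    (h : FixedAt Φ (T j) false) : FixedAt (fun t => Φ (_root_.xorAt T y t)) (T j) (y j) := by
  intro s hs
  refine h _ ?_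
  rw [xorAt_apply]
  cases hs' : s (T j) <;> cases hy : y j <;> simp_all

/-- Adding `y` to wires that hold zero leaves exactly `y` on them. -/
lemma eq_zero_of_ne {Φ : Bits W → ℂ} (T : Fin k ↪ Fin W) (hΦ : ∀ j, FixedAt Φ (T j) false)
    {y : Bits k} {s : Bits W} (h : (fun j => s (T j)) ≠ y) : Φ (xorAt T y s) = 0 := by
  obtain ⟨j, hj⟩ := Function.ne_iff.1 h
  exact (hΦ j).xorAt_self T y s hj

end XorAt

/-! ## Measuring a circuit without disturbing the state -/

section Gadget

variable {m k w W : ℕ}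

lemma onWires_basisProj_mulVec (e : Fin w ↪ Fin W) (D : Bits w → Prop) [DecidablePred D]
    (Φ : Bits W → ℂ) (s : Bits W) :
    (onWires e (basisProj D)).mulVec Φ s = if D fun j => s (e j) then Φ s else 0 := by
  rw [onWires_mulVec, Finset.sum_eq_single fun j => s (e j)]
  · have : override e (fun j => s (e j)) s = s :=
      bits_ext_wires e (by simp) fun i hi => override_of_notMem _ _ _ hi
    simp [basisProj, this]
  · intro a _ ha
    simp [basisProj, Matrix.diagonal_apply_ne _ ha.symm]
  · simp

/-- Computing, copying and uncomputing produces `∑_y R_y Φ ⊗ |y⟩` with `y` on `T`. Because `T`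
starts at zero, at a bit string with `y` on `T` the copy keeps only the outcome `y` of the circuit,
and `conj_basisProj_mulVec_place` identifies the resulting `Vᴴ Π_y V` with `R y`. -/
lemma measure_mulVec {V : Matrix (Bits w) (Bits w) ℂ} (hV : V ∈ Matrix.unitaryGroup (Bits w) ℂ)
    {N : Matrix (Bits W) (Bits W) ℂ} (e : Fin w ↪ Fin W) (o : Fin k ↪ Fin w) (T : Fin k ↪ Fin W)
    (hT : ∀ i j, T j ≠ e i)
    (hN : ∀ Φ s, N.mulVec Φ s = Φ (xorAt T (fun i => s (e (o i))) s))
    {p : Fin m ↪ Fin w} {b : Bits w} {R : Bits k → Matrix (Bits m) (Bits m) ℂ}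
    (hR : ∀ y, R y * R y = R y)
    (h : ∀ φ y, (∑ t, if (fun j => t (o j)) = y then ‖V.mulVec (place p b φ) t‖ ^ 2 else 0) =
      expval φ (R y))
    {Φ : Bits W → ℂ} (hΦ : ∀ i ∉ Set.range p, FixedAt Φ (e i) (b i))
    (hΦT : ∀ j, FixedAt Φ (T j) false) (s : Bits W) :
    (onWires e V).conjTranspose.mulVec (N.mulVec ((onWires e V).mulVec Φ)) s =
      (onWires (p.trans e) (R fun j => s (T j))).mulVec Φ (xorAt T (fun j => s (T j)) s) := by
  set y := fun j => s (T j) with hy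
  rw [← onWires_mulVec_eq_of_place e p b (conj_basisProj_mulVec_place hV (hR y) fun φ => h φ y) hΦ,
    onWires_mul, onWires_mul, ← Matrix.mulVec_mulVec, ← Matrix.mulVec_mulVec,
    ← onWires_conjTranspose, onWires_mulVec, onWires_mulVec]
  simp only [xorAt_of_notMem T y s (hT _)]
  refine Finset.sum_congr rfl fun a _ => ?_
  congr 1
  rw [hN, onWires_basisProj_mulVec]
  simp only [override_apply]
  have h1 : (fun j => override e a s (T j)) = y := funext fun j =>
    override_of_notMem _ _ _ fun ⟨i, hi⟩ => hT i j hi.symm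
  split_ifs with ha
  · rw [ha, xorAt_override e T hT]
  · refine eq_zero_of_ne T (fun j => (hΦT j).onWires e (fun ⟨i, hi⟩ => hT i j hi.symm) V) ?_
    rw [h1]
    exact Ne.symm ha

end Gadget

/-! ## Circuits -/

section Circuits

variable {𝒢 : GateSet} {m k n w : ℕ}

lemma QCircuit.mat_eq_opsMat (C : QCircuit 𝒢) : C.mat = opsMat C.ops := rfl

lemma resize_of_le (h : k ≤ w) (t : Bits w) : resize k t = fun i => t (Fin.castLEEmb h i) := by
  funext i
  have : i.val < w := by omega
  simp [resize, this]
  rfl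

/-- The wires `n, …, n + m - 1`. -/
def wiresFrom (n m w : ℕ) (h : n + m ≤ w) : Fin m ↪ Fin w :=
  ⟨fun i => ⟨n + i, by omega⟩, fun i j hij => Fin.ext (by simpa using hij)⟩

@[simp] lemma wiresFrom_val (n m w : ℕ) (h : n + m ≤ w) (i : Fin m) :
    (wiresFrom n m w h i).val = n + i := rfl

lemma withAncillas_eq_place (h : m ≤ w) (φ : Bits m → ℂ) :
    withAncillas w φ = place (Fin.castLEEmb h) (fun _ => false) φ := by
  funext t
  have : (∀ i : Fin w, m ≤ i.val → t i = false) ↔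
      ∀ i ∉ Set.range (Fin.castLEEmb h), t i = false := by
    refine forall_congr' fun i => ?_
    have : m ≤ i.val ↔ i ∉ Set.range (Fin.castLEEmb h) := by
      simp only [Set.mem_range, not_exists]
      refine ⟨fun h j hj => ?_, fun h' => ?_⟩
      · have := congrArg Fin.val hj
        simp at this
        omega
      · by_contra hlt
        exact h' ⟨i, by omega⟩ (Fin.ext rfl)
    rw [this]
  rw [withAncillas, place, resize_of_le h]
  exact if_congr this rfl rfl

/-- A classical input is treated like the ancillas: both are definite bits around the `m` free
wires. -/
lemma withAncillas_ketTensor (h : n + m ≤ w) (c : Bits n) (φ : Bits m → ℂ) :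
    withAncillas w (ketTensor c φ) = place (wiresFrom n m w h) (resize w c) φ := by
  have hmem : ∀ i : Fin w, i ∉ Set.range (wiresFrom n m w h) ↔ i.val < n ∨ n + m ≤ i.val := by
    intro i
    simp only [Set.mem_range, not_exists]
    refine ⟨fun h' => ?_, fun h' j hj => ?_⟩
    · by_contra hlt
      exact h' ⟨i.val - n, by omega⟩ (Fin.ext (by simp; omega))
    · have := congrArg Fin.val hj
      simp at this
      omega
  funext t
  rw [withAncillas_eq_place h, place, place]
  simp only [ketTensor]
  rw [← ite_and]
  refine if_congr ⟨fun ⟨h1, h2⟩ i hi => ?_, fun h1 => ⟨fun i hi => ?_, funext fun i => ?_⟩⟩ rfl rfl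
  · rcases (hmem i).1 hi with hi | hi
    · have := congrFun h2 ⟨i, hi⟩
      simp only [resize, dif_pos hi, ← this]
      rfl
    · rw [h1 i, resize, dif_neg (by omega)]
      rintro ⟨j, hj⟩
      have := congrArg Fin.val hj
      simp at this
      omega
  · have hi' : n + m ≤ i.val := by
      by_contra hlt
      exact hi ⟨⟨i, by omega⟩, rfl⟩
    rw [h1 i ((hmem i).2 (Or.inr hi')), resize, dif_neg (by omega)]
  · have := h1 (Fin.castLEEmb h (Fin.castAdd m i)) ((hmem _).2 (Or.inl (by simp)))
    rw [this]
    simp [resize]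

lemma QCircuit.outcomeProb_eq (C : QCircuit 𝒢) (h : k ≤ C.width) (φ : Bits m → ℂ) (y : Bits k) :
    C.outcomeProb φ y = ∑ t, if (fun j => t (Fin.castLEEmb h j)) = y then
      ‖C.mat.mulVec (withAncillas C.width φ) t‖ ^ 2 else 0 := by
  simp only [QCircuit.outcomeProb, resize_of_le h, QCircuit.finalState]

lemma sum_comm_four {α β : Type*} [Fintype α] [Fintype β] (F : α → α → β → β → ℂ) :
    ∑ t, ∑ t', ∑ s, ∑ s', F t t' s s' = ∑ s, ∑ s', ∑ t', ∑ t, F t t' s s' := by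
  rw [Finset.sum_comm]
  have : ∑ x : α × α, ∑ y : β × β, F x.2 x.1 y.1 y.2 =
    ∑ y : β × β, ∑ x : α × α, F x.2 x.1 y.1 y.2 := Finset.sum_comm
  simpa only [Fintype.sum_prod_type] using this

/-- The expectation of an observable on the output wires is its trace against the reduced density
matrix. What remains on the other wires is irrelevant, so no uncomputation is needed for
preparations and unitaries. -/
lemma QCircuit.quadForm_eq_of_outDensity (C : QCircuit 𝒢) (h : k ≤ C.width) {φ : Bits m → ℂ}
    {u : Bits k → ℂ} (hu : C.outDensity k φ = Matrix.vecMulVec u (star u))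
    (Y : Matrix (Bits k) (Bits k) ℂ) :
    quadForm (onWires (Fin.castLEEmb h) Y) (C.mat.mulVec (withAncillas C.width φ)) =
      quadForm Y u := by
  change quadForm _ (C.finalState φ) = _
  set χ := C.finalState φ with hχ
  have h1 : quadForm Y u = ∑ s, ∑ s', Y s s' * C.outDensity k φ s' s := by
    simp only [hu, quadForm, dotProduct, Matrix.mulVec, Matrix.vecMulVec_apply, Pi.star_apply,
      Finset.mul_sum]
    exact Finset.sum_congr rfl fun _ _ => Finset.sum_congr rfl fun _ _ => by ring
  have h2 : ∀ t t' : Bits C.width, (∀ i : Fin C.width, k ≤ i.val → t i = t' i) ↔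
      ∀ i, (∀ j, Fin.castLEEmb h j ≠ i) → t i = t' i := by
    refine fun t t' => forall_congr' fun i => ?_
    have : k ≤ i.val ↔ ∀ j, Fin.castLEEmb h j ≠ i := by
      refine ⟨fun h j hj => ?_, fun h' => ?_⟩
      · have := congrArg Fin.val hj
        simp at this
        omega
      · by_contra hlt
        exact h' ⟨i, by omega⟩ (Fin.ext rfl)
    rw [this]
  have h3 : ∀ s s', C.outDensity k φ s' s = ∑ t', ∑ t, if resize k t' = s' then
      if resize k t = s then if ∀ i : Fin C.width, k ≤ i.val → t i = t' i then
        χ t' * star (χ t) else 0 else 0 else 0 := by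
    intro s s'
    rw [QCircuit.outDensity, Matrix.of_apply]
    refine Finset.sum_congr rfl fun t' _ => Finset.sum_congr rfl fun t _ => ?_
    rw [← ite_and, ← ite_and]
    exact if_congr (by rw [and_assoc]; simp only [eq_comm]) rfl rfl
  rw [h1]
  simp only [h3, Finset.mul_sum, quadForm, dotProduct, Matrix.mulVec]
  calc _ = ∑ t : Bits C.width, ∑ t', ∑ s, ∑ s', Y s s' * if resize k t' = s' then
      if resize k t = s then if ∀ i : Fin C.width, k ≤ i.val → t i = t' i then
        χ t' * star (χ t) else 0 else 0 else 0 := ?_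
    _ = _ := ?_
  · refine Finset.sum_congr rfl fun t _ => Finset.sum_congr rfl fun t' _ => ?_
    rw [Finset.sum_eq_single (resize k t), Finset.sum_eq_single (resize k t')]
    · rw [if_pos rfl, if_pos rfl]
      simp only [onWires, Matrix.of_apply, h2, resize_of_le h, Pi.star_apply]
      split_ifs <;> ring
    · intro s' _ hs'
      rw [if_neg (Ne.symm hs'), mul_zero]
    · simp
    · intro s _ hs
      simp [if_neg (Ne.symm hs)]
    · simp
  · exact sum_comm_four _

end Circuits

/-! ## Sequences of measurements on wires -/

section Stages

variable {k m w w' W : ℕ}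

lemma restrictWires_measure {V : Matrix (Bits w) (Bits w) ℂ}
    (hV : V ∈ Matrix.unitaryGroup (Bits w) ℂ)
    {N : Matrix (Bits W) (Bits W) ℂ} (e : Fin w ↪ Fin W) (o : Fin k ↪ Fin w) (T : Fin k ↪ Fin W)
    (hT : ∀ i j, T j ≠ e i)
    (hN : ∀ Φ s, N.mulVec Φ s = Φ (xorAt T (fun i => s (e (o i))) s))
    {p : Fin m ↪ Fin w} {b : Bits w} {R : Bits k → Matrix (Bits m) (Bits m) ℂ}
    (hR : ∀ y, R y * R y = R y)
    (h : ∀ φ y, (∑ t, if (fun j => t (o j)) = y then ‖V.mulVec (place p b φ) t‖ ^ 2 else 0) =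
      expval φ (R y))
    {Φ : Bits W → ℂ} (hΦ : ∀ i ∉ Set.range p, FixedAt Φ (e i) (b i))
    (hΦT : ∀ j, FixedAt Φ (T j) false) (y : Bits k) :
    restrictWires T y
        ((onWires e V).conjTranspose.mulVec (N.mulVec ((onWires e V).mulVec Φ))) =
      fun s => (onWires (p.trans e) (R y)).mulVec Φ (xorAt T y s) := by
  funext s
  rw [restrictWires]
  split_ifs with hs
  · rw [measure_mulVec hV e o T hT hN hR h hΦ hΦT, hs]
  · refine (eq_zero_of_ne T (fun j => (hΦT j).onWires _ ?_ _) hs).symm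
    rintro ⟨i, hi⟩
    exact hT _ _ hi.symm

/-- Two measurements in sequence. -/
lemma sum_norm_sq_two_measurements
    {V : Matrix (Bits w) (Bits w) ℂ} (hV : V ∈ Matrix.unitaryGroup (Bits w) ℂ)
    {V' : Matrix (Bits w') (Bits w') ℂ} (hV' : V' ∈ Matrix.unitaryGroup (Bits w') ℂ)
    {N : Matrix (Bits W) (Bits W) ℂ} (e : Fin w ↪ Fin W) (e' : Fin w' ↪ Fin W)
    (o : Fin k ↪ Fin w) (o' : Fin k ↪ Fin w') (T : Fin k ↪ Fin W)
    (hT : ∀ i j, T j ≠ e i) (hT' : ∀ i j, T j ≠ e' i)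
    (hN : ∀ Φ s, N.mulVec Φ s = Φ (xorAt T (fun i => s (e (o i))) s))
    {p : Fin m ↪ Fin w} {p' : Fin m ↪ Fin w'} (hp : p.trans e = p'.trans e')
    {b : Bits w} {b' : Bits w'} {R R' : Bits k → Matrix (Bits m) (Bits m) ℂ}
    (hR : ∀ y, R y * R y = R y) (hR' : ∀ y, R' y * R' y = R' y)
    (h : ∀ φ y, (∑ t, if (fun j => t (o j)) = y then ‖V.mulVec (place p b φ) t‖ ^ 2 else 0) =
      expval φ (R y))
    (h' : ∀ φ y, (∑ t, if (fun j => t (o' j)) = y then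
      ‖V'.mulVec (place p' b' φ) t‖ ^ 2 else 0) = expval φ (R' y))
    {Φ : Bits W → ℂ} (hΦ : ∀ i ∉ Set.range p, FixedAt Φ (e i) (b i))
    (hΦ' : ∀ i ∉ Set.range p', FixedAt Φ (e' i) (b' i))
    (hΦT : ∀ j, FixedAt Φ (T j) false) (D : Bits k → Bits k → Prop) [∀ y y', Decidable (D y y')] :
    (∑ s, if D (fun j => s (T j)) (fun j => s (e' (o' j))) then
      ‖(onWires e' V').mulVec ((onWires e V).conjTranspose.mulVec
        (N.mulVec ((onWires e V).mulVec Φ))) s‖ ^ 2 else 0) =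
      expval Φ (onWires (p.trans e)
        (∑ y, ∑ y', if D y y' then (R y).conjTranspose * R' y' * R y else 0)) := by
  set Φ' := (onWires e V).conjTranspose.mulVec (N.mulVec ((onWires e V).mulVec Φ)) with hΦ'_def
  set Ψ := (onWires e' V').mulVec Φ' with hΨ
  -- In the branch where `T` reads `y` the state is `R y Φ`. The second circuit need not be
  -- uncomputed, as only its outcome probabilities matter.
  have key : ∀ y y', (∑ s, if (fun j => s (e' (o' j))) = y' then
      ‖restrictWires T y Ψ s‖ ^ 2 else 0) =
      expval Φ (onWires (p.trans e) ((R y).conjTranspose * R' y' * R y)) := by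
    intro y y'
    have h1 : ((∑ s, if (fun j => s (e' (o' j))) = y' then
        ‖restrictWires T y Ψ s‖ ^ 2 else 0 : ℝ) : ℂ) =
        quadForm (onWires e' (basisProj fun t => (fun j => t (o' j)) = y'))
          (restrictWires T y Ψ) := by
      rw [← quadForm_basisProj, quadForm, quadForm]
      congr 1
      funext s
      rw [basisProj_mulVec, onWires_basisProj_mulVec]
    replace h1 := congrArg Complex.re h1
    rw [Complex.ofReal_re] at h1
    rw [h1, expval_eq_re_quadForm]
    congr 1
    rw [hΨ, ← onWires_mulVec_restrictWires e' T hT', ← quadForm_conj, ← onWires_conjTranspose,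
      ← onWires_mul, ← onWires_mul,
      restrictWires_measure hV e o T hT hN hR h hΦ hΦT]
    -- On this branch the first measurement has acted only on the common state wires (`hp`) and on
    -- `T`, so the ancillas of the second circuit are still fixed.
    have hfix : ∀ i ∉ Set.range p', FixedAt (fun s =>
        (onWires (p.trans e) (R y)).mulVec Φ (xorAt T y s)) (e' i) (b' i) := by
      intro i hi
      refine ((hΦ' i hi).onWires _ ?_ _).xorAt T y (hT' i)
      rw [hp]
      rintro ⟨j, hj⟩
      exact hi ⟨j, e'.injective hj⟩
    have h2 : ∀ (A B : Matrix (Bits W) (Bits W) ℂ) Θ, A.mulVec Θ = B.mulVec Θ →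
        quadForm A Θ = quadForm B Θ := fun A B Θ hAB => by rw [quadForm, quadForm, hAB]
    rw [h2 _ _ _ (onWires_mulVec_eq_of_place e' p' b'
      (conj_basisProj_mulVec_place hV' (hR' y') fun φ => h' φ y') hfix),
      quadForm_onWires_xorAt (p'.trans e') T (fun i j => hT' _ _), hp, ← quadForm_conj,
      ← onWires_conjTranspose, ← onWires_mul, ← onWires_mul]
  have hsplit : ∀ s, (if D (fun j => s (T j)) (fun j => s (e' (o' j))) then ‖Ψ s‖ ^ 2 else 0) =
      ∑ y, ∑ y', if D y y' then (if (fun j => s (e' (o' j))) = y' then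
        ‖restrictWires T y Ψ s‖ ^ 2 else 0) else 0 := by
    intro s
    rw [Finset.sum_eq_single fun j => s (T j), Finset.sum_eq_single fun j => s (e' (o' j))]
    · simp [restrictWires]
    · intro y' _ hy'
      simp [hy'.symm]
    · simp
    · intro y _ hy
      simp [restrictWires, hy.symm]
    · simp
  simp only [hsplit]
  rw [Finset.sum_comm, expval_eq_re_quadForm, onWires_sum, quadForm_sum, Complex.re_sum]
  refine Finset.sum_congr rfl fun y _ => ?_
  rw [Finset.sum_comm, onWires_sum, quadForm_sum, Complex.re_sum]
  refine Finset.sum_congr rfl fun y' _ => ?_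
  split_ifs
  · exact key y y'
  · have : onWires (p.trans e) (0 : Matrix (Bits m) (Bits m) ℂ) = 0 := by
      ext s t
      simp [onWires_apply]
    simp [this, quadForm]

/-- A measurement, whose result is copied once more, followed by an operation that depends on the
result. -/
lemma quadForm_measure_then {V : Matrix (Bits w) (Bits w) ℂ}
    (hV : V ∈ Matrix.unitaryGroup (Bits w) ℂ) {q : ℕ}
    {N N' : Matrix (Bits W) (Bits W) ℂ} (e : Fin w ↪ Fin W) (e' : Fin w' ↪ Fin W)
    (o : Fin k ↪ Fin w) (o' : Fin q ↪ Fin w') (T T' : Fin k ↪ Fin W)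
    (hT : ∀ i j, T j ≠ e i) (hT' : ∀ i j, T' j ≠ e i) (hTT' : ∀ i j, T' j ≠ T i)
    (hTe' : ∀ i j, T' j ≠ e' i)
    (hN : ∀ Φ s, N.mulVec Φ s = Φ (xorAt T (fun i => s (e (o i))) s))
    (hN' : ∀ Φ s, N'.mulVec Φ s = Φ (xorAt T' (fun i => s (T i)) s))
    {p : Fin m ↪ Fin w} {p' : Fin m ↪ Fin w'} (hp : p.trans e = p'.trans e')
    {b : Bits w} {b' : Bits k → Bits w'} {R : Bits k → Matrix (Bits m) (Bits m) ℂ}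
    (hR : ∀ y, R y * R y = R y)
    (h : ∀ φ y, (∑ t, if (fun j => t (o j)) = y then ‖V.mulVec (place p b φ) t‖ ^ 2 else 0) =
      expval φ (R y))
    {V' : Matrix (Bits w') (Bits w') ℂ} {Y : Matrix (Bits q) (Bits q) ℂ}
    {Y' : Bits k → Matrix (Bits m) (Bits m) ℂ}
    (h' : ∀ y, R y ≠ 0 → ∀ φ, quadForm (onWires o' Y) (V'.mulVec (place p' (b' y) φ)) =
      quadForm (Y' y) φ)
    {Φ : Bits W → ℂ} (hΦ : ∀ i ∉ Set.range p, FixedAt Φ (e i) (b i))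
    (hΦ' : ∀ i ∉ Set.range p', (∃ j, e' i = T j ∧ ∀ y, b' y i = y j) ∨
      (∀ j, T j ≠ e' i) ∧ ∀ y, FixedAt Φ (e' i) (b' y i))
    (hΦT : ∀ j, FixedAt Φ (T j) false) (hΦT' : ∀ j, FixedAt Φ (T' j) false) :
    quadForm (onWires (o'.trans e') Y) ((onWires e' V').mulVec (N'.mulVec
      ((onWires e V).conjTranspose.mulVec (N.mulVec ((onWires e V).mulVec Φ))))) =
    quadForm (onWires (p.trans e) (∑ y, (R y).conjTranspose * Y' y * R y)) Φ := by
  set Φ₂ := (onWires e V).conjTranspose.mulVec (N.mulVec ((onWires e V).mulVec Φ)) with hΦ₂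
  set Ξ : Bits k → Bits W → ℂ := fun y => (onWires (p.trans e) (R y)).mulVec Φ with hΞ
  have hpT : ∀ i j, T j ≠ (p.trans e) i := fun i j => hT _ _
  have hpT' : ∀ i j, T' j ≠ (p.trans e) i := fun i j => hT' _ _
  have hΞT : ∀ y j, FixedAt (Ξ y) (T j) false := fun y j =>
    (hΦT j).onWires _ (fun ⟨i, hi⟩ => hpT i j hi.symm) _
  have hΞT' : ∀ y j, FixedAt (Ξ y) (T' j) false := fun y j =>
    (hΦT' j).onWires _ (fun ⟨i, hi⟩ => hpT' i j hi.symm) _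
  have hTT : ∀ (s : Bits W) y j, xorAt T' y s (T j) = s (T j) := fun s y j =>
    xorAt_of_notMem _ _ _ (hTT' j)
  -- The second copy records the outcome: the next operation takes `T` as input and may alter it,
  -- but avoids `T'`. Where `T'` reads `y`, so does `T`, and the state is `Ξ y`.
  have key : ∀ y, restrictWires T' y (N'.mulVec Φ₂) =
      fun s => Ξ y (xorAt T y (xorAt T' y s)) := by
    intro y
    have h1 : ∀ j, FixedAt (fun s => Ξ y (xorAt T y s)) (T' j) false := fun j =>
      (hΞT' y j).xorAt T y fun i => (hTT' i j).symm
    funext s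
    rw [restrictWires]
    split_ifs with hs
    · rw [hN', hΦ₂, measure_mulVec hV e o T hT hN hR h hΦ hΦT]
      simp only [hTT]
      by_cases hy : (fun j => s (T j)) = y
      · rw [hy]
      -- If the two copies disagree, both sides vanish: on the right `T` would not return to zero,
      -- on the left `T'` would not.
      · rw [eq_zero_of_ne T (hΞT y) (by simpa only [hTT] using hy)]
        obtain ⟨j, hj⟩ := Function.ne_iff.1 hy
        refine (hΞT' _ j).xorAt T _ (fun i => (hTT' i j).symm) _ ?_
        rw [xorAt_apply, congrFun hs j]
        intro h0
        apply hj
        revert h0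
        cases y j <;> cases s (T j) <;> simp
    · exact (eq_zero_of_ne T' h1 hs).symm
  rw [onWires_trans, ← quadForm_conj, ← onWires_conjTranspose, ← onWires_mul, ← onWires_mul,
    quadForm_onWires_restrictWires e' T' hTe', onWires_sum, quadForm_sum]
  refine Finset.sum_congr rfl fun y _ => ?_
  rw [key y]
  -- `h'` says nothing about outcomes with `R y = 0`, but their branches are zero.
  by_cases hRy : R y = 0
  · have h0 : Ξ y = 0 := by
      funext s
      simp [hΞ, hRy, onWires_mulVec]
    simp only [h0, hRy, Matrix.mul_zero, Pi.zero_apply]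
    have : onWires (p.trans e) (0 : Matrix (Bits m) (Bits m) ℂ) = 0 := by
      ext s t
      simp [onWires_apply]
    rw [this]
    simp only [quadForm, Matrix.zero_mulVec, dotProduct_zero]
    exact (congrArg (· ⬝ᵥ _) (star_zero _)).trans (zero_dotProduct _)
  · rw [quadForm_onWires_eq_of_place e' p' (b' y) (R := Y' y) (fun φ => by
      rw [quadForm_conj, h' y hRy]), ← hp]
    · rw [quadForm_onWires_xorAt (p.trans e) T' hpT' _ y fun s => Ξ y (xorAt T y s),
        quadForm_onWires_xorAt (p.trans e) T hpT, ← quadForm_conj, ← onWires_conjTranspose,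
        ← onWires_mul, ← onWires_mul]
    · intro i hi
      refine FixedAt.xorAt (Φ := fun s => Ξ y (xorAt T y s)) T' y ?_ (hTe' i)
      -- The wires of the second circuit besides the state either hold the outcome, which is `y` in
      -- this branch, or have been fixed from the beginning.
      rcases hΦ' i hi with ⟨j, hj, hb⟩ | ⟨hne, hf⟩
      · rw [hj, hb]
        exact (hΞT y j).xorAt_self T y
      · refine ((hf y).onWires _ ?_ _).xorAt T y hne
        rw [hp]
        rintro ⟨j, hj⟩
        exact hi ⟨j, e'.injective hj⟩

lemma ket_eq_place (e : Fin w ↪ Fin W) (s : Bits W) :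
    ket s = place e s (ket fun i => s (e i)) := by
  funext t
  have : t = s ↔ (∀ i ∉ Set.range e, t i = s i) ∧ (fun j => t (e j)) = fun i => s (e i) :=
    ⟨fun h => by simp [h], fun ⟨h, h'⟩ => bits_ext_wires e (congrFun h') h⟩
  rw [ket, place, if_congr this rfl rfl, ite_and]
  rfl

end Stages

/-! ## The adversary -/

/-- Circuits that prepare a state of `q` qubits, measure it depending on `n` bits, act on it
depending on these bits and the result of `a` bits, and measure it twice. -/
structure Attack (𝒢 : GateSet) where
  n : ℕ
  q : ℕ
  a : ℕ
  prep : QCircuit 𝒢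
  meas : QCircuit 𝒢
  post : QCircuit 𝒢
  fst : QCircuit 𝒢
  snd : QCircuit 𝒢
  bit : ℕ
  prep_outs : prep.outs = q
  meas_ins : meas.ins = n + q
  meas_outs : meas.outs = a
  post_ins : post.ins = n + a + q
  post_outs : post.outs = q
  fst_ins : fst.ins = q
  snd_ins : snd.ins = q
  bit_lt_fst : bit < fst.outs
  bit_lt_snd : bit < snd.outs

/-- An embedding of wires given by a function on numbers. -/
def wiresOf {w W : ℕ} (f : ℕ → ℕ) (h : ∀ i < w, f i < W)
    (h' : ∀ i < w, ∀ j < w, f i = f j → i = j) : Fin w ↪ Fin W :=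
  ⟨fun i => ⟨f i, h i i.2⟩, fun i j hij => Fin.ext (h' i i.2 j j.2 (congrArg Fin.val hij))⟩

@[simp] lemma wiresOf_val {w W : ℕ} (f : ℕ → ℕ) (h : ∀ i < w, f i < W)
    (h' : ∀ i < w, ∀ j < w, f i = f j → i = j) (i : Fin w) : (wiresOf f h h' i).val = f i := rfl

namespace Attack

variable {𝒢 : GateSet} (X : Attack 𝒢)

lemma q_le_prep : X.q ≤ X.prep.width := X.prep_outs ▸ X.prep.outs_le
lemma le_meas : X.n + X.q ≤ X.meas.width := X.meas_ins ▸ X.meas.ins_le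
lemma a_le_meas : X.a ≤ X.meas.width := X.meas_outs ▸ X.meas.outs_le
lemma le_post : X.n + X.a + X.q ≤ X.post.width := X.post_ins ▸ X.post.ins_le
lemma q_le_post : X.q ≤ X.post.width := X.post_outs ▸ X.post.outs_le
lemma q_le_fst : X.q ≤ X.fst.width := X.fst_ins ▸ X.fst.ins_le
lemma q_le_snd : X.q ≤ X.snd.width := X.snd_ins ▸ X.snd.ins_le
lemma bit_lt_fst_width : X.bit < X.fst.width := X.bit_lt_fst.trans_le X.fst.outs_le
lemma bit_lt_snd_width : X.bit < X.snd.width := X.bit_lt_snd.trans_le X.snd.outs_le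

/-- The first wire that is not used by the input and the preparation. -/
def off₁ : ℕ := X.n + X.prep.width
/-- The first copy of the result. -/
def off₂ : ℕ := X.off₁ + X.meas.width
/-- The second copy of the result. -/
def off₃ : ℕ := X.off₂ + X.a
/-- The ancillas of `post`. -/
def off₄ : ℕ := X.off₃ + X.a
/-- The ancillas of `fst`. -/
def off₅ : ℕ := X.off₄ + X.post.width
/-- The ancillas of `snd`. -/
def off₆ : ℕ := X.off₅ + X.fst.width
/-- The wire before the wire for the final result. -/
def off₇ : ℕ := X.off₆ + X.snd.width
/-- The number of wires. -/
def width : ℕ := X.off₇ + 2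

/-- Numbers of the wires of `meas`. -/
def measWire (i : ℕ) : ℕ := if i < X.n + X.q then i else X.off₁ + i
/-- Numbers of the wires of `post`. -/
def postWire (i : ℕ) : ℕ :=
  if i < X.n then i else if i < X.n + X.a then i - X.n + X.off₂
    else if i < X.n + X.a + X.q then i - X.a else X.off₄ + i
/-- Numbers of the wires of `fst`. -/
def fstWire (i : ℕ) : ℕ := if i < X.q then X.postWire i else X.off₅ + i
/-- Numbers of the wires of `snd`. -/
def sndWire (i : ℕ) : ℕ := if i < X.q then X.postWire i else X.off₆ + i

/-- With the layout in this form every question of disjointness is linear arithmetic. The ancilla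
`i` of `meas`, `post`, `fst` or `snd` sits at its offset plus `i`, without subtracting the number of
inputs; the unused wires do no harm. -/
lemma off_eqs : X.off₁ = X.n + X.prep.width ∧ X.off₂ = X.off₁ + X.meas.width ∧
    X.off₃ = X.off₂ + X.a ∧ X.off₄ = X.off₃ + X.a ∧ X.off₅ = X.off₄ + X.post.width ∧
    X.off₆ = X.off₅ + X.fst.width ∧ X.off₇ = X.off₆ + X.snd.width ∧ X.width = X.off₇ + 2 :=
  ⟨rfl, rfl, rfl, rfl, rfl, rfl, rfl, rfl⟩

lemma measWire_cases (i : ℕ) : (i < X.n + X.q ∧ X.measWire i = i) ∨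
    (X.n + X.q ≤ i ∧ X.measWire i = X.off₁ + i) := by
  unfold measWire; split_ifs <;> omega

lemma postWire_cases (i : ℕ) : (i < X.n ∧ X.postWire i = i) ∨
    (X.n ≤ i ∧ i < X.n + X.a ∧ X.postWire i + X.n = X.off₂ + i) ∨
    (X.n + X.a ≤ i ∧ i < X.n + X.a + X.q ∧ X.postWire i + X.a = i) ∨
    (X.n + X.a + X.q ≤ i ∧ X.postWire i = X.off₄ + i) := by
  unfold postWire; split_ifs <;> omega

/-- The state to be measured is the output of `post`, on the first `q` wires of that circuit. These
may include wires of the ciphertext and of the first copy of the answer. -/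
lemma fstWire_cases (i : ℕ) : (i < X.q ∧ X.fstWire i = X.postWire i) ∨
    (X.q ≤ i ∧ X.fstWire i = X.off₅ + i) := by
  unfold fstWire; split_ifs <;> omega

lemma sndWire_cases (i : ℕ) : (i < X.q ∧ X.sndWire i = X.postWire i) ∨
    (X.q ≤ i ∧ X.sndWire i = X.off₆ + i) := by
  unfold sndWire; split_ifs <;> omega

/-- The wires of `prep`. -/
def e₀ : Fin X.prep.width ↪ Fin X.width :=
  wiresOf (fun i => X.n + i) (fun i hi => by have := X.off_eqs; omega) fun i _ j _ h => by omega

/-- The wires of `meas`. -/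
def e₁ : Fin X.meas.width ↪ Fin X.width :=
  wiresOf X.measWire
    (fun i hi => by
      have := X.off_eqs; have := X.measWire_cases i; have := X.q_le_prep; omega)
    fun i hi j hj h => by
      have := X.off_eqs; have := X.measWire_cases i; have := X.measWire_cases j
      have := X.q_le_prep; omega

/-- The first copy of the result. -/
def t₁ : Fin X.a ↪ Fin X.width :=
  wiresOf (fun i => X.off₂ + i) (fun i hi => by have := X.off_eqs; omega) fun i _ j _ h => by omega

/-- The second copy of the result. -/
def t₂ : Fin X.a ↪ Fin X.width :=
  wiresOf (fun i => X.off₃ + i) (fun i hi => by have := X.off_eqs; omega) fun i _ j _ h => by omega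

/-- The wires of `post`. -/
def e₂ : Fin X.post.width ↪ Fin X.width :=
  wiresOf X.postWire
    (fun i hi => by
      have := X.off_eqs; have := X.postWire_cases i; have := X.q_le_prep; omega)
    fun i hi j hj h => by
      have := X.off_eqs; have := X.postWire_cases i; have := X.postWire_cases j
      have := X.q_le_prep; omega

/-- The wires of `fst`. -/
def e₃ : Fin X.fst.width ↪ Fin X.width :=
  wiresOf X.fstWire
    (fun i hi => by
      have := X.off_eqs; have := X.fstWire_cases i; have := X.postWire_cases i
      have := X.q_le_prep; have := X.q_le_post; omega)
    fun i hi j hj h => by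
      have := X.off_eqs; have := X.fstWire_cases i; have := X.fstWire_cases j
      have := X.postWire_cases i; have := X.postWire_cases j
      have := X.q_le_prep; have := X.q_le_post; omega

/-- The wires of `snd`. -/
def e₄ : Fin X.snd.width ↪ Fin X.width :=
  wiresOf X.sndWire
    (fun i hi => by
      have := X.off_eqs; have := X.sndWire_cases i; have := X.postWire_cases i
      have := X.q_le_prep; have := X.q_le_post; omega)
    fun i hi j hj h => by
      have := X.off_eqs; have := X.sndWire_cases i; have := X.sndWire_cases j
      have := X.postWire_cases i; have := X.postWire_cases j
      have := X.q_le_prep; have := X.q_le_post; omega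

/-- The wire for the final result. -/
def t : Fin 1 ↪ Fin X.width :=
  wiresOf (fun i => X.off₇ + 1 + i) (fun i hi => by have := X.off_eqs; omega)
    fun i _ j _ h => by omega

/-- The first wire. -/
def zeroWire : Fin X.width := ⟨0, by have := X.off_eqs; omega⟩

/-- The output wires of `meas`. -/
def o₁ : Fin X.a ↪ Fin X.meas.width := Fin.castLEEmb X.a_le_meas
/-- The output wire of `fst`. -/
def o₃ : Fin 1 ↪ Fin X.fst.width :=
  wiresOf (fun i => X.bit + i) (fun i hi => by have := X.bit_lt_fst_width; omega)
    fun i _ j _ h => by omega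
/-- The output wire of `snd`. -/
def o₄ : Fin 1 ↪ Fin X.snd.width :=
  wiresOf (fun i => X.bit + i) (fun i hi => by have := X.bit_lt_snd_width; omega)
    fun i _ j _ h => by omega

lemma t₁_ne_e₁ (i j) : X.t₁ j ≠ X.e₁ i := fun h => by
  have h := congrArg Fin.val h
  simp only [t₁, e₁, wiresOf_val] at h
  have := X.off_eqs; have := X.measWire_cases i; have := X.q_le_prep; omega

lemma t₂_ne_e₁ (i j) : X.t₂ j ≠ X.e₁ i := fun h => by
  have h := congrArg Fin.val h
  simp only [t₂, e₁, wiresOf_val] at h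
  have := X.off_eqs; have := X.measWire_cases i; have := X.q_le_prep; omega

lemma t₂_ne_t₁ (i j) : X.t₂ j ≠ X.t₁ i := fun h => by
  have h := congrArg Fin.val h
  simp only [t₂, t₁, wiresOf_val] at h
  have := X.off_eqs; omega

lemma t₂_ne_e₂ (i j) : X.t₂ j ≠ X.e₂ i := fun h => by
  have h := congrArg Fin.val h
  simp only [t₂, e₂, wiresOf_val] at h
  have := X.off_eqs; have := X.postWire_cases i; have := X.q_le_prep; omega

lemma t_ne_e₃ (i j) : X.t j ≠ X.e₃ i := fun h => by
  have h := congrArg Fin.val h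
  simp only [t, e₃, wiresOf_val] at h
  have := X.off_eqs; have := X.fstWire_cases i; have := X.postWire_cases i
  have := X.q_le_prep; have := X.q_le_post; omega

lemma t_ne_e₄ (i j) : X.t j ≠ X.e₄ i := fun h => by
  have h := congrArg Fin.val h
  simp only [t, e₄, wiresOf_val] at h
  have := X.off_eqs; have := X.sndWire_cases i; have := X.postWire_cases i
  have := X.q_le_prep; have := X.q_le_post; omega

lemma t_ne_zeroWire (j) : X.t j ≠ X.zeroWire := fun h => by
  have h := congrArg Fin.val h
  simp only [t, zeroWire, wiresOf_val] at h
  omega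

/-- A measurement of a subcircuit, the result of which is copied. -/
def measOps {w k : ℕ} (ops : List (QOp 𝒢 w)) (e : Fin w ↪ Fin X.width) (o : Fin k ↪ Fin w)
    (T : Fin k ↪ Fin X.width) (hT : ∀ i j, T j ≠ e i) : List (QOp 𝒢 X.width) :=
  ops.map (QOp.map e) ++ (copyOps 𝒢 (fun i => e (o i)) T (fun _ _ => (hT _ _).symm) ++
    (ops.map (QOp.map e)).reverse.map QOp.inv)

/-- The gates of the attack up to the second measurement. -/
def mainOps : List (QOp 𝒢 X.width) :=
  X.prep.ops.map (QOp.map X.e₀) ++ (X.measOps X.meas.ops X.e₁ X.o₁ X.t₁ X.t₁_ne_e₁ ++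
    (copyOps 𝒢 X.t₁ X.t₂ (fun i j => (X.t₂_ne_t₁ i j).symm) ++
      (X.post.ops.map (QOp.map X.e₂) ++ (X.measOps X.fst.ops X.e₃ X.o₃ X.t X.t_ne_e₃ ++
        X.snd.ops.map (QOp.map X.e₄)))))

/-- The gates that compute the parity of the two results on the first wire. -/
def finalOps : List (QOp 𝒢 X.width) :=
  [cnotOp 𝒢 (X.e₄ (X.o₄ 0)) (X.t 0) (X.t_ne_e₄ _ _).symm,
    -- The old content of the first wire is added to `t` so that it cancels when `t` is added to
    -- that wire.
    cnotOp 𝒢 X.zeroWire (X.t 0) (X.t_ne_zeroWire 0).symm,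
    cnotOp 𝒢 (X.t 0) X.zeroWire (X.t_ne_zeroWire 0)]

/-- The adversary. -/
def circuit (len : ℕ → ℕ) : Circuit (OracleOp 𝒢 len) where
  ins := X.n
  outs := 1
  width := X.width
  ins_le := by have := X.off_eqs; omega
  outs_le := by have := X.off_eqs; omega
  ops := (X.mainOps ++ X.finalOps).map OracleOp.gate

end Attack

/-! ### Acceptance probability of the adversary -/

section Accept

variable {𝒢 : GateSet} {n w W : ℕ}

lemma sum_cnotOp (i j : Fin W) (h : i ≠ j) (Φ : Bits W → ℂ) (D : Bits W → Prop)
    [DecidablePred D] :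
    (∑ s, if D s then ‖(cnotOp 𝒢 i j h).mat.mulVec Φ s‖ ^ 2 else 0) =
      ∑ s, if D (Function.update s j (xor (s j) (s i))) then ‖Φ s‖ ^ 2 else 0 := by
  have hinv : Function.Involutive fun s : Bits W => Function.update s j (xor (s j) (s i)) := by
    intro s
    funext r
    by_cases hr : r = j
    · subst hr
      simp [h]
    · simp [hr]
  rw [← Equiv.sum_comp hinv.toPerm]
  refine Finset.sum_congr rfl fun s _ => ?_
  rw [cnotOp_mulVec]
  exact congrArg (fun u => if D _ then ‖Φ u‖ ^ 2 else 0) (hinv s)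

/-- Without oracle calls the density matrix remains that of a pure state. -/
lemma acceptProb_map_gate {len : ℕ → ℕ} (A : Circuit (OracleOp 𝒢 len))
    (ops : List (QOp 𝒢 A.width)) (h : A.ops = ops.map OracleOp.gate)
    (answer : ∀ m, Bits m → (Bits (len m) → ℂ) → ℂ) (c : Bits n) :
    A.acceptProb answer c = ∑ t : Bits A.width, if resize 1 t = (fun _ => true) then
      ‖(opsMat ops).mulVec (ket (resize A.width c)) t‖ ^ 2 else 0 := by
  have key : ∀ (ops : List (QOp 𝒢 A.width)) (v : Bits A.width → ℂ),
      (ops.map OracleOp.gate).foldl (OracleOp.act answer) (Matrix.vecMulVec v (star v)) =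
        Matrix.vecMulVec ((opsMat ops).mulVec v) (star ((opsMat ops).mulVec v)) := by
    intro ops
    induction ops with
    | nil => intro v; simp
    | cons o ops ih =>
      intro v
      have h1 : OracleOp.act answer (Matrix.vecMulVec v (star v)) (.gate o) =
          Matrix.vecMulVec (o.mat.mulVec v) (star (o.mat.mulVec v)) := by
        rw [OracleOp.act, Matrix.mul_vecMulVec, Matrix.vecMulVec_mul, Matrix.star_mulVec]
      rw [List.map_cons, List.foldl_cons, h1, ih, opsMat_cons, Matrix.mulVec_mulVec]
  rw [Circuit.acceptProb, h, key]
  refine Finset.sum_congr rfl fun t _ => ?_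
  split_ifs
  · rw [Matrix.vecMulVec_apply, Pi.star_apply, RCLike.star_def, Complex.mul_conj']
    norm_cast
  · rfl

end Accept

namespace Attack

variable {𝒢 : GateSet} (X : Attack 𝒢)

lemma opsMat_measOps_mulVec {w k : ℕ} (ops : List (QOp 𝒢 w)) (e : Fin w ↪ Fin X.width)
    (o : Fin k ↪ Fin w) (T : Fin k ↪ Fin X.width) (hT : ∀ i j, T j ≠ e i)
    (Φ : Bits X.width → ℂ) :
    (opsMat (X.measOps ops e o T hT)).mulVec Φ = (onWires e (opsMat ops)).conjTranspose.mulVec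
      ((opsMat (copyOps 𝒢 (fun i => e (o i)) T (fun _ _ => (hT _ _).symm))).mulVec
        ((onWires e (opsMat ops)).mulVec Φ)) := by
  rw [measOps, opsMat_append, opsMat_append, opsMat_inverse, opsMat_map, ← Matrix.mulVec_mulVec,
    ← Matrix.mulVec_mulVec]

lemma sum_finalOps (Φ : Bits X.width → ℂ) :
    (∑ s, if resize 1 s = (fun _ => true) then ‖(opsMat X.finalOps).mulVec Φ s‖ ^ 2 else 0) =
      ∑ s, if xor (s (X.t 0)) (s (X.e₄ (X.o₄ 0))) = true then ‖Φ s‖ ^ 2 else 0 := by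
  have h0 : ∀ s : Bits X.width, resize 1 s = (fun _ => true) ↔ s X.zeroWire = true := by
    intro s
    have hw : 0 < X.width := by have := X.off_eqs; omega
    constructor
    · intro h
      have := congrFun h 0
      simpa [resize, hw, zeroWire] using this
    · intro h
      funext i
      obtain rfl : i = 0 := Subsingleton.elim _ _
      simpa [resize, hw, zeroWire] using h
  have ht := X.t_ne_zeroWire 0
  have ht' := X.t_ne_e₄ (X.o₄ 0) 0
  simp only [h0, finalOps, opsMat_cons, opsMat_nil, one_mul, ← Matrix.mulVec_mulVec]
  rw [sum_cnotOp, sum_cnotOp, sum_cnotOp]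
  refine Finset.sum_congr rfl fun s _ => if_congr ?_ rfl rfl
  simp [ht.symm]
  cases s X.zeroWire <;> cases s (X.t 0) <;> cases s (X.e₄ (X.o₄ 0)) <;> simp

/-- The computation runs backwards through the circuit: `sum_norm_sq_two_measurements` turns the
last two measurements into the observable `Y`, `quadForm_measure_then` pulls `Y` back through `post`
and `meas`, and `quadForm_eq_of_outDensity` evaluates the result on the prepared state. -/
lemma acceptProb_circuit {len : ℕ → ℕ} (answer : ∀ m, Bits m → (Bits (len m) → ℂ) → ℂ)
    (c : Bits X.n) {ψ : Bits X.q → ℂ} {P U : Bits X.a → Matrix (Bits X.q) (Bits X.q) ℂ}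
    {R R' : Bits 1 → Matrix (Bits X.q) (Bits X.q) ℂ}
    (hprep : X.prep.outDensity X.q (ket (Fin.elim0 : Bits 0)) = Matrix.vecMulVec ψ (star ψ))
    (hP : ∀ α, P α * P α = P α)
    (hmeas : ∀ φ α, X.meas.outcomeProb (ketTensor c φ) α = expval φ (P α))
    (hpost : ∀ α, P α ≠ 0 → ∀ φ : Bits X.q → ℂ,
      X.post.outDensity X.q (ketTensor (Fin.append c α) φ) =
        Matrix.vecMulVec ((U α).mulVec φ) (star ((U α).mulVec φ)))
    (hR : ∀ y, R y * R y = R y) (hR' : ∀ y, R' y * R' y = R' y)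
    (hfst : ∀ (φ : Bits X.q → ℂ) y, (∑ s, if (fun j => s (X.o₃ j)) = y then
      ‖X.fst.mat.mulVec (withAncillas X.fst.width φ) s‖ ^ 2 else 0) = expval φ (R y))
    (hsnd : ∀ (φ : Bits X.q → ℂ) y, (∑ s, if (fun j => s (X.o₄ j)) = y then
      ‖X.snd.mat.mulVec (withAncillas X.snd.width φ) s‖ ^ 2 else 0) = expval φ (R' y)) :
    (X.circuit len).acceptProb answer c = ∑ α, expval ((U α * P α).mulVec ψ)
      (∑ y, ∑ y', if xor (y 0) (y' 0) = true then (R y).conjTranspose * R' y' * R y else 0) := by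
  set Y := ∑ y, ∑ y', if xor (y 0) (y' 0) = true then
    (R y).conjTranspose * R' y' * R y else 0 with hY
  have hoff := X.off_eqs
  have hq0 := X.q_le_prep
  have hq2 := X.q_le_post
  rw [acceptProb_map_gate (X.circuit len) _ rfl]
  change (∑ t : Bits X.width, if resize 1 t = (fun _ => true) then
    ‖(opsMat (X.mainOps ++ X.finalOps)).mulVec (ket (resize X.width c)) t‖ ^ 2 else 0) = _
  rw [opsMat_append, ← Matrix.mulVec_mulVec, sum_finalOps, mainOps]
  set s₀ : Bits X.width := resize X.width c with hs₀
  have hs₀_lt : ∀ (i : Fin X.width) (h : i.val < X.n), s₀ i = c ⟨i, h⟩ := fun i h => by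
    simp [hs₀, resize, h]
  have hs₀_ge : ∀ i : Fin X.width, X.n ≤ i.val → s₀ i = false := fun i h => by
    simp [hs₀, resize, Nat.not_lt.2 h]
  simp only [opsMat_append, ← Matrix.mulVec_mulVec, opsMat_map, opsMat_measOps_mulVec]
  set Φ₁ := (onWires X.e₀ (opsMat X.prep.ops)).mulVec (ket s₀) with hΦ₁
  set Φ₂ := (onWires X.e₁ (opsMat X.meas.ops)).conjTranspose.mulVec
    ((opsMat (copyOps 𝒢 (fun i => X.e₁ (X.o₁ i)) X.t₁ (fun _ _ => (X.t₁_ne_e₁ _ _).symm))).mulVec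
      ((onWires X.e₁ (opsMat X.meas.ops)).mulVec Φ₁)) with hΦ₂
  set Φ₃ := (opsMat (copyOps 𝒢 X.t₁ X.t₂ (fun i j => (X.t₂_ne_t₁ i j).symm))).mulVec Φ₂ with hΦ₃
  set Φ₄ := (onWires X.e₂ (opsMat X.post.ops)).mulVec Φ₃ with hΦ₄
  -- The preparation touches neither the ciphertext nor the wires from `off₁` on.
  have hfix₁ : ∀ i : Fin X.width, (i.val < X.n ∨ X.off₁ ≤ i.val) → FixedAt Φ₁ i (s₀ i) := by
    intro i hi
    refine FixedAt.onWires (fun s hs => ?_) _ ?_ _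
    · rw [ket, if_neg]
      rintro rfl
      exact hs rfl
    · rintro ⟨j, hj⟩
      have := congrArg Fin.val hj
      simp only [e₀, wiresOf_val] at this
      omega
  have hfix₁' : ∀ i : Fin X.width, X.off₁ ≤ i.val → FixedAt Φ₁ i false := by
    intro i hi
    rw [← hs₀_ge i (by omega)]
    exact hfix₁ i (Or.inr hi)
  -- The ancillas of `fst` and `snd` and the wire `t` are untouched until the last two measurements.
  have hfix₄ : ∀ i : Fin X.width, X.off₅ ≤ i.val → FixedAt Φ₄ i false := by
    intro i hi
    have h1 : i ∉ Set.range X.e₁ := by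
      rintro ⟨j, hj⟩
      have := congrArg Fin.val hj
      simp only [e₁, wiresOf_val] at this
      have := X.measWire_cases j
      omega
    have h2 : i ∉ Set.range X.e₂ := by
      rintro ⟨j, hj⟩
      have := congrArg Fin.val hj
      simp only [e₂, wiresOf_val] at this
      have := X.postWire_cases j
      omega
    have h3 : ∀ j, X.t₁ j ≠ i := by
      intro j hj
      have := congrArg Fin.val hj
      simp only [t₁, wiresOf_val] at this
      omega
    have h4 : ∀ j, X.t₂ j ≠ i := by
      intro j hj
      have := congrArg Fin.val hj
      simp only [t₂, wiresOf_val] at this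
      omega
    refine FixedAt.onWires (fun s hs => ?_) _ h2 _
    rw [hΦ₃, opsMat_copyOps_mulVec]
    refine FixedAt.xorAt (Φ := Φ₂) X.t₂ _ ?_ h4 s hs
    rw [hΦ₂, ← onWires_conjTranspose]
    refine FixedAt.onWires (fun s hs => ?_) _ h1 _
    rw [opsMat_copyOps_mulVec]
    refine FixedAt.xorAt X.t₁ _ ?_ h3 s hs
    exact (hfix₁' i (by omega)).onWires _ h1 _
  have hp : ∀ i ∉ Set.range (Fin.castLEEmb X.q_le_fst), X.q ≤ i.val := by
    intro i hi
    by_contra hlt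
    exact hi ⟨⟨i, by omega⟩, Fin.ext rfl⟩
  have hp' : ∀ i ∉ Set.range (Fin.castLEEmb X.q_le_snd), X.q ≤ i.val := by
    intro i hi
    by_contra hlt
    exact hi ⟨⟨i, by omega⟩, Fin.ext rfl⟩
  refine (sum_norm_sq_two_measurements (opsMat_unitary X.fst.ops) (opsMat_unitary X.snd.ops)
    X.e₃ X.e₄ X.o₃ X.o₄ X.t X.t_ne_e₃ X.t_ne_e₄
    (fun Φ s => opsMat_copyOps_mulVec _ _ _ _ _)
    (p := Fin.castLEEmb X.q_le_fst) (p' := Fin.castLEEmb X.q_le_snd) ?_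
    (b := fun _ => false) (b' := fun _ => false) hR hR' ?_ ?_ ?_ ?_ ?_
    (fun y y' => xor (y 0) (y' 0) = true)).trans ?_
  · ext i
    simp [e₃, e₄, fstWire, sndWire]
  · intro φ y
    rw [← withAncillas_eq_place X.q_le_fst]
    exact hfst φ y
  · intro φ y
    rw [← withAncillas_eq_place X.q_le_snd]
    exact hsnd φ y
  · intro i hi
    refine hfix₄ _ ?_
    have := hp i hi
    have := X.fstWire_cases i
    simp only [e₃, wiresOf_val]
    omega
  · intro i hi
    refine hfix₄ _ ?_
    have := hp' i hi
    have := X.sndWire_cases i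
    simp only [e₄, wiresOf_val]
    omega
  · intro j
    refine hfix₄ _ ?_
    simp only [t, wiresOf_val]
    omega
  have hwire : (Fin.castLEEmb X.q_le_fst).trans X.e₃ = (Fin.castLEEmb X.q_le_post).trans X.e₂ := by
    ext i
    simp [e₃, e₂, fstWire]
  rw [hwire, ← hY, expval_eq_re_quadForm, hΦ₄, hΦ₃, hΦ₂]
  have hwire' : (wiresFrom X.n X.q X.meas.width X.le_meas).trans X.e₁ =
      (Fin.castLEEmb X.q_le_prep).trans X.e₀ := by
    ext i
    simp [e₀, e₁, measWire]
  rw [quadForm_measure_then (opsMat_unitary X.meas.ops) X.e₁ X.e₂ X.o₁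
    (Fin.castLEEmb X.q_le_post) X.t₁ X.t₂ X.t₁_ne_e₁ X.t₂_ne_e₁ X.t₂_ne_t₁ X.t₂_ne_e₂
    (fun Φ s => opsMat_copyOps_mulVec _ _ _ _ _) (fun Φ s => opsMat_copyOps_mulVec _ _ _ _ _)
    (p := wiresFrom X.n X.q X.meas.width X.le_meas)
    (p' := wiresFrom (X.n + X.a) X.q X.post.width X.le_post) ?_
    (b := resize X.meas.width c) (b' := fun α => resize X.post.width (Fin.append c α))
    (R := P) hP ?_ (Y' := fun α => (U α).conjTranspose * Y * U α) ?_ ?_ ?_ ?_ ?_]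
  -- The preparation starts from no input qubits: on its wires the initial basis vector consists of
  -- ancillas only.
  · have hprep' := fun Z => X.prep.quadForm_eq_of_outDensity X.q_le_prep hprep Z
    have hket : ket s₀ = place X.e₀ s₀ (withAncillas X.prep.width (ket (Fin.elim0 : Bits 0))) := by
      rw [ket_eq_place X.e₀ s₀]
      congr 1
      funext u
      have h1 : ∀ i, s₀ (X.e₀ i) = false := fun i => hs₀_ge _ (by simp [e₀])
      have h2 : resize 0 u = (Fin.elim0 : Bits 0) := funext fun i => i.elim0
      simp [ket, withAncillas, h1, h2, funext_iff]
    rw [hwire', hΦ₁, hket, onWires_mulVec_place, onWires_trans, quadForm_onWires_place]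
    rw [← QCircuit.mat_eq_opsMat, hprep', quadForm_sum, Complex.re_sum]
    refine Finset.sum_congr rfl fun α _ => ?_
    rw [expval_eq_re_quadForm, quadForm_conj, quadForm_conj, Matrix.mulVec_mulVec]
  · ext i
    have h1 := X.measWire_cases (X.n + i)
    have h2 := X.postWire_cases (X.n + X.a + i)
    simp only [Function.Embedding.trans_apply, e₁, e₂, wiresOf_val, wiresFrom_val]
    omega
  · intro φ α
    rw [← withAncillas_ketTensor X.le_meas, ← hmeas, X.meas.outcomeProb_eq X.a_le_meas]
    rfl
  · intro α hα φ
    rw [quadForm_conj, ← withAncillas_ketTensor X.le_post]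
    exact X.post.quadForm_eq_of_outDensity X.q_le_post (hpost α hα φ) Y
  · intro i hi
    have hi' : i.val < X.n ∨ X.n + X.q ≤ i.val := by
      by_contra hlt
      exact hi ⟨⟨i.val - X.n, by omega⟩, Fin.ext (by simp; omega)⟩
    have h1 := X.measWire_cases i
    have h2 : resize X.meas.width c i = s₀ (X.e₁ i) := by
      by_cases hlt : i.val < X.n
      · rw [hs₀_lt _ (by simp only [e₁, wiresOf_val]; omega), resize, dif_pos hlt]
        congr 1
        ext
        simp only [e₁, wiresOf_val]
        omega
      · rw [hs₀_ge _ (by simp only [e₁, wiresOf_val]; omega), resize, dif_neg hlt]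
    rw [h2]
    refine hfix₁ _ ?_
    simp only [e₁, wiresOf_val]
    omega
  · intro i hi
    have hi' : i.val < X.n + X.a ∨ X.n + X.a + X.q ≤ i.val := by
      by_contra hlt
      exact hi ⟨⟨i.val - (X.n + X.a), by omega⟩, Fin.ext (by simp; omega)⟩
    have h1 := X.postWire_cases i
    by_cases hT : X.n ≤ i.val ∧ i.val < X.n + X.a
    · refine Or.inl ⟨⟨i.val - X.n, by omega⟩, ?_, fun α => ?_⟩
      · ext
        simp only [e₂, t₁, wiresOf_val]
        omega
      · rw [resize, dif_pos hT.2]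
        have : (⟨i.val, hT.2⟩ : Fin (X.n + X.a)) = Fin.natAdd X.n ⟨i.val - X.n, by omega⟩ := by
          ext
          simp
          omega
        rw [this, Fin.append_right]
    · refine Or.inr ⟨fun j hj => ?_, fun α => ?_⟩
      · have := congrArg Fin.val hj
        simp only [e₂, t₁, wiresOf_val] at this
        omega
      · have h2 : resize X.post.width (Fin.append c α) i = s₀ (X.e₂ i) := by
          by_cases hlt : i.val < X.n
          · rw [hs₀_lt _ (by simp only [e₂, wiresOf_val]; omega), resize, dif_pos (by omega)]
            have : (⟨i.val, by omega⟩ : Fin (X.n + X.a)) = Fin.castAdd X.a ⟨i.val, hlt⟩ := rfl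
            rw [this, Fin.append_left]
            congr 1
            ext
            simp only [e₂, wiresOf_val]
            omega
          · rw [hs₀_ge _ (by simp only [e₂, wiresOf_val]; omega), resize, dif_neg (by omega)]
        rw [h2]
        refine hfix₁ _ ?_
        simp only [e₂, wiresOf_val]
        omega
  · intro j
    refine hfix₁' _ ?_
    simp only [t₁, wiresOf_val]
    omega
  · intro j
    refine hfix₁' _ ?_
    simp only [t₂, wiresOf_val]
    omega

end Attack

/-! ## Uniformity of the adversary -/

section Tables

variable {𝒢 : GateSet} {w W k : ℕ}

/-- The numbers of gates. -/
def gateNum (𝒢 : GateSet) (g : ℕ) : ℕ := if g < 𝒢.num then g else 0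

/-- The numbers of inverse gates. -/
def gateInvNum (𝒢 : GateSet) (g : ℕ) : ℕ := if h : g < 𝒢.num then (𝒢.inv ⟨g, h⟩).val else 0

/-- Relocating a circuit changes its description row by row. On actual gate numbers `gateNum` is the
identity; its cutoff makes it a finite lookup table. -/
lemma map_code_map (e : Fin w ↪ Fin W) (f : ℕ → ℕ) (hf : ∀ i, (e i).val = f i)
    (ops : List (QOp 𝒢 w)) : (ops.map (QOp.map e)).map OpCode.code =
      (ops.map OpCode.code).map (UniformTable.mapRow (gateNum 𝒢) f) := by
  rw [List.map_map, List.map_map]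
  refine List.map_congr_left fun o _ => ?_
  change o.gate.val :: List.ofFn (fun i => (e (o.wires i)).val) =
    gateNum 𝒢 o.gate.val :: (List.ofFn fun i => (o.wires i).val).map f
  rw [gateNum, if_pos o.gate.2, List.map_ofFn]
  simp only [hf]
  rfl

lemma map_code_inv (e : Fin w ↪ Fin W) (f : ℕ → ℕ) (hf : ∀ i, (e i).val = f i)
    (ops : List (QOp 𝒢 w)) : ((ops.map (QOp.map e)).reverse.map QOp.inv).map OpCode.code =
      ((ops.map OpCode.code).map (UniformTable.mapRow (gateInvNum 𝒢) f)).reverse := by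
  rw [← List.map_reverse, List.map_map, List.map_map, List.map_map, ← List.map_reverse]
  refine List.map_congr_left fun o _ => ?_
  change OpCode.code (QOp.map e o).inv =
    gateInvNum 𝒢 o.gate.val :: (List.ofFn fun i => (o.wires i).val).map f
  rw [QOp.code_inv, gateInvNum, dif_pos o.gate.2, List.map_ofFn]
  change _ :: List.ofFn (fun i => (e (o.wires i)).val) = _
  simp only [hf]
  rfl

lemma map_code_copyOps (S T : Fin k → Fin w) (h : ∀ i j, S i ≠ T j) (f g : ℕ → ℕ)
    (hf : ∀ i, (S i).val = f i) (hg : ∀ i, (T i).val = g i) :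
    (copyOps 𝒢 S T h).map OpCode.code =
      (List.range k).map fun i => [𝒢.cnot_mem.choose.val, f i, g i] := by
  refine List.ext_getElem (by simp [copyOps]) fun i h1 h2 => ?_
  simp [copyOps, code_cnotOp, hf, hg]

end Tables

namespace Attack

variable {𝒢 : GateSet} {X : ℕ → Attack 𝒢}

/-- Logspace-uniform families of attacks. -/
structure IsUniform (X : ℕ → Attack 𝒢) : Prop where
  n : LogspaceFun fun l => (X l).n
  q : LogspaceFun fun l => (X l).q
  a : LogspaceFun fun l => (X l).a
  bit : LogspaceFun fun l => (X l).bit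
  prep : UniformTable fun l => (X l).prep.desc
  meas : UniformTable fun l => (X l).meas.desc
  post : UniformTable fun l => (X l).post.desc
  fst : UniformTable fun l => (X l).fst.desc
  snd : UniformTable fun l => (X l).snd.desc

namespace IsUniform

lemma off₁ (h : IsUniform X) : LogspaceFun fun l => (X l).off₁ := h.n.add h.prep.width_desc
lemma off₂ (h : IsUniform X) : LogspaceFun fun l => (X l).off₂ := h.off₁.add h.meas.width_desc
lemma off₃ (h : IsUniform X) : LogspaceFun fun l => (X l).off₃ := h.off₂.add h.a
lemma off₄ (h : IsUniform X) : LogspaceFun fun l => (X l).off₄ := h.off₃.add h.a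
lemma off₅ (h : IsUniform X) : LogspaceFun fun l => (X l).off₅ := h.off₄.add h.post.width_desc
lemma off₆ (h : IsUniform X) : LogspaceFun fun l => (X l).off₆ := h.off₅.add h.fst.width_desc
lemma off₇ (h : IsUniform X) : LogspaceFun fun l => (X l).off₇ := h.off₆.add h.snd.width_desc
lemma width (h : IsUniform X) : LogspaceFun fun l => (X l).width := h.off₇.add (.const 2)

lemma measWire (h : IsUniform X) : LogspaceFun₂ fun l i => (X l).measWire i :=
  .ite_lt (h.n.add h.q) .snd (h.off₁.left.add .snd)

lemma postWire (h : IsUniform X) : LogspaceFun₂ fun l i => (X l).postWire i :=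
  .ite_lt h.n .snd (.ite_lt (h.n.add h.a) (.add (.sub .snd h.n.left) h.off₂.left)
    (.ite_lt ((h.n.add h.a).add h.q) (.sub .snd h.a.left) (h.off₄.left.add .snd)))

lemma fstWire (h : IsUniform X) : LogspaceFun₂ fun l i => (X l).fstWire i :=
  .ite_lt h.q h.postWire (h.off₅.left.add .snd)

lemma sndWire (h : IsUniform X) : LogspaceFun₂ fun l i => (X l).sndWire i :=
  .ite_lt h.q h.postWire (h.off₆.left.add .snd)

lemma mapped {C : ℕ → QCircuit 𝒢} (hC : UniformTable fun l => (C l).desc)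
    {e : ∀ l, Fin (C l).width ↪ Fin (X l).width} {f : ℕ → ℕ → ℕ}
    (hf : ∀ l i, (e l i).val = f l i) (hf' : LogspaceFun₂ f) :
    UniformTable fun l => ((C l).ops.map (QOp.map (e l))).map OpCode.code := by
  simp only [fun l => map_code_map (e l) (f l) (hf l) (C l).ops]
  exact hC.ops_desc.map_mapRow (N := 𝒢.num) (fun n hn => if_neg (by omega)) hf'

lemma measOps {C : ℕ → QCircuit 𝒢} (hC : UniformTable fun l => (C l).desc)
    {e : ∀ l, Fin (C l).width ↪ Fin (X l).width} {f : ℕ → ℕ → ℕ}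
    (hf : ∀ l i, (e l i).val = f l i) (hf' : LogspaceFun₂ f) {k : ℕ → ℕ} (hk : LogspaceFun k)
    {o : ∀ l, Fin (k l) ↪ Fin (C l).width} {T : ∀ l, Fin (k l) ↪ Fin (X l).width}
    (hT : ∀ l i j, T l j ≠ e l i) {g g' : ℕ → ℕ → ℕ} (hg : ∀ l i, (o l i).val = g l i)
    (hg' : LogspaceFun₂ g) (hT' : ∀ l i, (T l i).val = g' l i) (hg'' : LogspaceFun₂ g') :
    UniformTable fun l => ((X l).measOps (C l).ops (e l) (o l) (T l) (hT l)).map OpCode.code := by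
  simp only [Attack.measOps, List.map_append]
  refine (mapped hC hf hf').append (.append ?_ ?_)
  · simp only [fun l => map_code_copyOps (𝒢 := 𝒢) (fun i => e l (o l i)) (T l)
      (fun _ _ => (hT _ _ _).symm) (fun i => f l (g l i)) (g' l) (fun i => by rw [hf, hg]) (hT' l)]
    exact .triples hk (LogspaceFun.const _).left (hf'.comp₂ hg') hg''
  · simp only [fun l => map_code_inv (e l) (f l) (hf l) (C l).ops]
    exact (hC.ops_desc.map_mapRow (N := 𝒢.num) (fun n hn => dif_neg (by omega)) hf').reverse

/-- Each piece of the gate list is a renumbered given table, the reversal of one, or an explicit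
table of CNOTs. The wire maps are piecewise affine with logspace offsets. -/
theorem circuit (h : IsUniform X) (len : ℕ → ℕ → ℕ) :
    UniformTable fun l => ((X l).circuit (len l)).desc := by
  have h1 : ∀ l, ((X l).circuit (len l)).desc = [[(X l).n, 1, (X l).width]] ++
      (((X l).mainOps).map OpCode.code ++ ((X l).finalOps).map OpCode.code) := by
    intro l
    rw [← List.map_append]
    simp only [Circuit.desc, Attack.circuit, List.singleton_append]
    rw [List.map_map]
    rfl
  simp only [h1]
  refine (UniformTable.triple h.n (.const 1) h.width).append (.append ?_ ?_)
  · simp only [mainOps, List.map_append]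
    refine .append ?_ (.append ?_ (.append ?_ (.append ?_ (.append ?_ ?_))))
    · exact mapped h.prep (f := fun l i => (X l).n + i) (fun _ _ => rfl) (h.n.left.add .snd)
    · exact measOps h.meas (f := fun l i => (X l).measWire i) (fun _ _ => rfl) h.measWire h.a _
        (g := fun _ i => i) (fun _ _ => rfl) .snd (g' := fun l i => (X l).off₂ + i)
        (fun _ _ => rfl) (h.off₂.left.add .snd)
    · simp only [fun l => map_code_copyOps (𝒢 := 𝒢) (X l).t₁ (X l).t₂
        (fun i j => ((X l).t₂_ne_t₁ i j).symm) (fun i => (X l).off₂ + i)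
        (fun i => (X l).off₃ + i) (fun _ => rfl) (fun _ => rfl)]
      exact .triples h.a (LogspaceFun.const _).left (h.off₂.left.add .snd) (h.off₃.left.add .snd)
    · exact mapped h.post (f := fun l i => (X l).postWire i) (fun _ _ => rfl) h.postWire
    · exact measOps h.fst (f := fun l i => (X l).fstWire i) (fun _ _ => rfl) h.fstWire (.const 1) _
        (g := fun l i => (X l).bit + i) (fun _ _ => rfl) (h.bit.left.add .snd)
        (g' := fun l i => (X l).off₇ + 1 + i) (fun _ _ => rfl)
        ((h.off₇.add (.const 1)).left.add .snd)
    · exact mapped h.snd (f := fun l i => (X l).sndWire i) (fun _ _ => rfl) h.sndWire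
  · have h2 : ∀ l, ((X l).finalOps).map OpCode.code =
        [[𝒢.cnot_mem.choose.val, (X l).sndWire (X l).bit, (X l).off₇ + 1]] ++
          ([[𝒢.cnot_mem.choose.val, 0, (X l).off₇ + 1]] ++
            [[𝒢.cnot_mem.choose.val, (X l).off₇ + 1, 0]]) := by
      intro l
      simp only [finalOps, List.map_cons, List.map_nil, code_cnotOp]
      rfl
    simp only [h2]
    have h3 := h.off₇.add (.const 1)
    have h4 : LogspaceFun fun l => (X l).sndWire (X l).bit :=
      LogspaceFun₂.comp (a := fun v => v 0) h.sndWire (.proj 0) h.bit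
    exact (UniformTable.triple (.const _) h4 h3).append
      ((UniformTable.triple (.const _) (.const 0) h3).append
        (UniformTable.triple (.const _) h3 (.const 0)))

end IsUniform

end Attack

/-! ## Vector strategies for XOR games -/

section Clifford

/-- Real symmetric anticommuting matrices. -/
lemma exists_anticommuting (n : ℕ) : ∃ d : ℕ, 0 < d ∧ ∃ γ : Fin n → Matrix (Fin d) (Fin d) ℂ,
    (∀ i, (γ i).transpose = γ i) ∧ (∀ i, (γ i).IsHermitian) ∧
      ∀ i j, γ i * γ j + γ j * γ i = if i = j then 2 else 0 := by
  -- The induction uses arbitrary finite index types, because Kronecker products are indexed by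
  -- product types.
  suffices h : ∃ (ι : Type) (_ : Fintype ι) (_ : DecidableEq ι) (_ : Nonempty ι)
      (γ : Fin n → Matrix ι ι ℂ), (∀ i, (γ i).transpose = γ i) ∧ (∀ i, (γ i).IsHermitian) ∧
      ∀ i j, γ i * γ j + γ j * γ i = if i = j then 2 else 0 by
    obtain ⟨ι, _, _, _, γ, h1, h2, h3⟩ := h
    let e := (Fintype.equivFin ι).symm
    refine ⟨Fintype.card ι, Fintype.card_pos, fun i => (γ i).submatrix e e, fun i => ?_,
      fun i => (h2 i).submatrix e, fun i j => ?_⟩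
    · rw [Matrix.transpose_submatrix, h1]
    · rw [Matrix.submatrix_mul_equiv, Matrix.submatrix_mul_equiv]
      ext a b
      rw [Matrix.add_apply, Matrix.submatrix_apply, Matrix.submatrix_apply, ← Matrix.add_apply, h3]
      split_ifs
      · simp [Matrix.ofNat_apply]
      · rfl
  induction n with
  | zero => exact ⟨Unit, inferInstance, inferInstance, inferInstance, fun i => i.elim0,
      fun i => i.elim0, fun i => i.elim0, fun i => i.elim0⟩
  | succ n ih =>
    obtain ⟨ι, _, _, _, γ, h1, h2, h3⟩ := ih
    let Z : Matrix (Fin 2) (Fin 2) ℂ := !![1, 0; 0, -1]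
    let Q : Matrix (Fin 2) (Fin 2) ℂ := !![0, 1; 1, 0]
    have hZ : Z * Z = 1 := by ext i j; fin_cases i <;> fin_cases j <;> simp [Z]
    have hQ : Q * Q = 1 := by ext i j; fin_cases i <;> fin_cases j <;> simp [Q]
    have hZQ : Z * Q + Q * Z = 0 := by
      ext i j; fin_cases i <;> fin_cases j <;> simp [Z, Q]
    have hZt : Z.transpose = Z := by ext i j; fin_cases i <;> fin_cases j <;> simp [Z]
    have hQt : Q.transpose = Q := by ext i j; fin_cases i <;> fin_cases j <;> simp [Q]
    have hZh : Z.conjTranspose = Z := by ext i j; fin_cases i <;> fin_cases j <;> simp [Z]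
    have hQh : Q.conjTranspose = Q := by ext i j; fin_cases i <;> fin_cases j <;> simp [Q]
    -- `Z` and `Q` are anticommuting real symmetric Pauli matrices with square one: tensoring the
    -- old matrices with `Z` keeps their relations, and `1 ⊗ Q` anticommutes with all of them.
    refine ⟨ι × Fin 2, inferInstance, inferInstance, inferInstance,
      Fin.snoc (fun i => γ i ⊗ₖ Z) ((1 : Matrix ι ι ℂ) ⊗ₖ Q), fun i => ?_, fun i => ?_,
      fun i j => ?_⟩
    · refine Fin.lastCases ?_ (fun i => ?_) i
      · simp only [Fin.snoc_last]
        rw [← Matrix.kroneckerMap_transpose, Matrix.transpose_one, hQt]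
      · simp only [Fin.snoc_castSucc]
        rw [← Matrix.kroneckerMap_transpose, h1, hZt]
    · refine Fin.lastCases ?_ (fun i => ?_) i
      · simp only [Fin.snoc_last]
        rw [Matrix.IsHermitian, Matrix.conjTranspose_kronecker, Matrix.conjTranspose_one, hQh]
      · simp only [Fin.snoc_castSucc]
        rw [Matrix.IsHermitian, Matrix.conjTranspose_kronecker, (h2 i).eq, hZh]
    · refine Fin.lastCases ?_ (fun i => ?_) i <;> refine Fin.lastCases ?_ (fun j => ?_) j
      · simp only [Fin.snoc_last]
        rw [← Matrix.mul_kronecker_mul, one_mul, hQ, Matrix.one_kronecker_one]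
        simpa using one_add_one_eq_two
      · simp only [Fin.snoc_last, Fin.snoc_castSucc]
        rw [← Matrix.mul_kronecker_mul, ← Matrix.mul_kronecker_mul, one_mul, mul_one,
          ← Matrix.kronecker_add, add_comm, hZQ, Matrix.kronecker_zero,
          if_neg (Fin.castSucc_lt_last j).ne']
      · simp only [Fin.snoc_last, Fin.snoc_castSucc]
        rw [← Matrix.mul_kronecker_mul, ← Matrix.mul_kronecker_mul, one_mul, mul_one,
          ← Matrix.kronecker_add, hZQ, Matrix.kronecker_zero,
          if_neg (Fin.castSucc_lt_last i).ne]
      · simp only [Fin.snoc_castSucc]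
        rw [← Matrix.mul_kronecker_mul, ← Matrix.mul_kronecker_mul, hZ, ← Matrix.add_kronecker, h3]
        simp only [Fin.castSucc_inj]
        split_ifs
        · have h2 : (2 : Matrix ι ι ℂ) = 1 + 1 := one_add_one_eq_two.symm
          rw [h2, Matrix.add_kronecker, Matrix.one_kronecker_one]
          exact one_add_one_eq_two
        · exact Matrix.zero_kronecker _

variable {κ : Type*} [Fintype κ] {d : ℕ}

/-- A linear combination of matrices. -/
def cliffordSum (γ : κ → Matrix (Fin d) (Fin d) ℂ) (v : κ → ℝ) : Matrix (Fin d) (Fin d) ℂ :=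
  ∑ i, (v i : ℂ) • γ i

variable [DecidableEq κ] {γ : κ → Matrix (Fin d) (Fin d) ℂ}

/-- After symmetrization only the diagonal terms survive. Hence unit vectors yield observables with
square one, and normalized traces of products recover inner products. -/
lemma cliffordSum_anticomm (h : ∀ i j, γ i * γ j + γ j * γ i = if i = j then 2 else 0)
    (u v : κ → ℝ) : cliffordSum γ u * cliffordSum γ v + cliffordSum γ v * cliffordSum γ u =
      (2 * ((∑ i, u i * v i : ℝ) : ℂ)) • 1 := by
  have h1 : cliffordSum γ v * cliffordSum γ u =
      ∑ i, ∑ j, ((u i : ℂ) * v j) • (γ j * γ i) := by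
    rw [cliffordSum, cliffordSum, Finset.sum_mul_sum, Finset.sum_comm]
    simp only [smul_mul_smul_comm, mul_comm (v _ : ℂ)]
  have h2 : cliffordSum γ u * cliffordSum γ v =
      ∑ i, ∑ j, ((u i : ℂ) * v j) • (γ i * γ j) := by
    rw [cliffordSum, cliffordSum, Finset.sum_mul_sum]
    simp only [smul_mul_smul_comm]
  rw [h1, h2, ← Finset.sum_add_distrib]
  simp only [← Finset.sum_add_distrib, ← smul_add, h]
  have h3 : ∀ i j, ((u i : ℂ) * v j) • (if i = j then (2 : Matrix (Fin d) (Fin d) ℂ) else 0) =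
      if i = j then (2 * ((u i : ℂ) * v i)) • (1 : Matrix (Fin d) (Fin d) ℂ) else 0 := by
    intro i j
    split_ifs with hij
    · subst hij
      rw [← one_add_one_eq_two, ← one_add_one_eq_two, smul_add, ← add_smul]
      ring_nf
    · exact smul_zero _
  simp only [h3, Finset.sum_ite_eq, Finset.mem_univ, if_true]
  push_cast
  rw [← Finset.sum_smul, Finset.mul_sum]

lemma cliffordSum_mul_self (h : ∀ i j, γ i * γ j + γ j * γ i = if i = j then 2 else 0)
    {v : κ → ℝ} (hv : ∑ i, v i * v i = 1) : cliffordSum γ v * cliffordSum γ v = 1 := by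
  have := cliffordSum_anticomm h v v
  rw [hv, ← two_smul ℂ, Complex.ofReal_one, mul_one] at this
  exact smul_right_injective _ (two_ne_zero (α := ℂ)) this

lemma trace_cliffordSum_mul (h : ∀ i j, γ i * γ j + γ j * γ i = if i = j then 2 else 0)
    (u v : κ → ℝ) :
    (cliffordSum γ u * cliffordSum γ v).trace = ((∑ i, u i * v i : ℝ) : ℂ) * d := by
  have := congrArg Matrix.trace (cliffordSum_anticomm h u v)
  rw [Matrix.trace_add, Matrix.trace_mul_comm (cliffordSum γ v), Matrix.trace_smul,
    Matrix.trace_one, Fintype.card_fin, ← two_mul, smul_eq_mul, mul_assoc] at this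
  exact mul_left_cancel₀ two_ne_zero this

end Clifford

/-! ### Two-valued observables and their projections -/

section Sign

/-- `(-1) ^ b`. -/
def boolSign (b : Bool) : ℝ := (-1) ^ b.toNat

lemma boolSign_mul_self (b : Bool) : boolSign b * boolSign b = 1 := by
  cases b <;> simp [boolSign]

/-- The projections of an observable with values `1` and `-1`. -/
def signProj {n : Type*} [DecidableEq n] (O : Matrix n n ℂ) (b : Bool) : Matrix n n ℂ :=
  (1 / 2 : ℂ) • (1 + (boolSign b : ℂ) • O)

lemma isPVM_signProj {n : Type*} [Fintype n] [DecidableEq n] {O : Matrix n n ℂ}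
    (hO : O.IsHermitian) (hO' : O * O = 1) : IsPVM (signProj O) where
  hermitian b := by
    have h := hO.eq
    cases b <;> simp [signProj, boolSign, Matrix.IsHermitian, Matrix.conjTranspose_smul, h]
  idem b := by
    rw [signProj, smul_mul_smul_comm, add_mul, mul_add, mul_add, smul_mul_smul_comm, hO',
      ← Complex.ofReal_mul, boolSign_mul_self]
    simp only [one_mul, mul_one, Complex.ofReal_one, one_smul]
    module
  orth b b' hb := by
    have : boolSign b' = - boolSign b := by
      cases b <;> cases b' <;> simp_all [boolSign]
    rw [signProj, signProj, smul_mul_smul_comm, add_mul, mul_add, mul_add, smul_mul_smul_comm, hO',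
      ← Complex.ofReal_mul, this, mul_neg, boolSign_mul_self]
    push_cast
    simp only [one_mul, mul_one, neg_smul, one_smul]
    module
  sum_eq_one := by
    simp [signProj, boolSign]
    module

end Sign

/-! ### Quantum value and unit vectors: Tsirelson's theorem -/

section Values

lemma quadForm_kronecker {d : ℕ} (A B : Matrix (Fin d) (Fin d) ℂ) (c : ℂ) :
    quadForm (A ⊗ₖ B) (fun x : Fin d × Fin d => if x.1 = x.2 then c else 0) =
      star c * c * (A * B.transpose).trace := by
  simp only [quadForm, dotProduct, Matrix.mulVec, Fintype.sum_prod_type, Pi.star_apply,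
    Matrix.kroneckerMap_apply, Matrix.trace, Matrix.diag, Matrix.mul_apply, Matrix.transpose_apply]
  simp [apply_ite, Finset.mul_sum]
  exact Finset.sum_congr rfl fun i _ => Finset.sum_congr rfl fun j _ => by ring

/-- `1 - P` is again a projection, so its expectation is a squared norm. -/
lemma expval_le_one {ι : Type*} [Fintype ι] [DecidableEq ι] {ψ : ι → ℂ}
    (hψ : ∑ i, ‖ψ i‖ ^ 2 = 1) {P : Matrix ι ι ℂ} (hP : P.IsHermitian) (hP' : P * P = P) :
    expval ψ P ≤ 1 := by
  have h1 : (1 - P).conjTranspose * 1 * (1 - P) = 1 - P := by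
    rw [Matrix.conjTranspose_sub, Matrix.conjTranspose_one, hP.eq]
    simp only [mul_one, sub_mul, mul_sub, hP', one_mul, sub_self, sub_zero]
  have h2 : 0 ≤ (quadForm (1 - P) ψ).re := by
    rw [← h1, quadForm_conj, quadForm_one, Complex.ofReal_re]
    positivity
  have h3 : quadForm (1 - P) ψ = quadForm 1 ψ - quadForm P ψ := by
    simp only [quadForm, Matrix.sub_mulVec, dotProduct_sub]
  rw [h3, quadForm_one, hψ, Complex.sub_re, Complex.ofReal_re] at h2
  rw [expval_eq_re_quadForm]
  linarith

variable {IA IB : Type*} [Fintype IA] [Fintype IB]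

/-- The supremum that defines the quantum value is meaningful only for a bounded set. The crude
bound counts at most one for each of the four answer pairs. -/
lemma NonlocalGame.bddAbove_range_winProb (G : NonlocalGame IA IB Bool Bool) :
    BddAbove (Set.range fun S : QuantumStrategy IA IB Bool Bool => G.winProb S) := by
  refine ⟨∑ x, ∑ y, G.prob x y * 4, ?_⟩
  rintro _ ⟨S, rfl⟩
  refine Finset.sum_le_sum fun x _ => Finset.sum_le_sum fun y _ =>
    mul_le_mul_of_nonneg_left ?_ (G.prob_nonneg x y)
  have h : ∀ a b, (if G.wins x y a b then expval S.ψ (S.A x a ⊗ₖ S.B y b) else 0) ≤ 1 := by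
    intro a b
    split_ifs
    · refine expval_le_one S.ψ_norm ?_ ?_
      · rw [Matrix.IsHermitian, Matrix.conjTranspose_kronecker, ((S.A_pvm x).hermitian a).eq,
          ((S.B_pvm y).hermitian b).eq]
      · rw [← Matrix.mul_kronecker_mul, (S.A_pvm x).idem, (S.B_pvm y).idem]
    · exact zero_le_one
  simp only [Fintype.sum_bool]
  have := h true true
  have := h true false
  have := h false true
  have := h false false
  linarith

/-- The weights of an XOR game. -/
def NonlocalGame.weight (G : NonlocalGame IA IB Bool Bool) (g : IA → IB → Bool) (x : IA) (y : IB) :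
    ℝ :=
  G.prob x y * boolSign (g x y)

/-- Splits a winning probability into total mass and signed correlation. The total mass is left
open, because in the compiled game it can be less than one. -/
lemma sum_wins_mul {w : Bool → Bool → Bool} {g : Bool}
    (h : ∀ a b, (if w a b then (1 : ℝ) else 0) =
      1 / 2 * (1 + (-1) ^ g.toNat * (-1) ^ (a.toNat + b.toNat))) (f : Bool → Bool → ℝ) :
    (∑ a, ∑ b, if w a b then f a b else 0) = 1 / 2 * (∑ a, ∑ b, f a b) +
      1 / 2 * (boolSign g * ∑ a, ∑ b, boolSign a * boolSign b * f a b) := by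
  have h1 : ∀ a b, (if w a b then f a b else 0) =
      1 / 2 * f a b + 1 / 2 * (boolSign g * (boolSign a * boolSign b * f a b)) := by
    intro a b
    have h2 : (if w a b then f a b else 0) = (if w a b then (1 : ℝ) else 0) * f a b := by
      split_ifs <;> simp
    rw [h2, h, boolSign, boolSign, boolSign, pow_add]
    ring
  simp only [h1, Finset.sum_add_distrib, Finset.mul_sum]

/-- Unit vectors give a quantum strategy. -/
lemma NonlocalGame.vector_le_quantumValue (G : NonlocalGame IA IB Bool Bool) {g : IA → IB → Bool}
    (hg : ∀ x y a b, (if G.wins x y a b then (1 : ℝ) else 0) =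
      1 / 2 * (1 + (-1) ^ (g x y).toNat * (-1) ^ (a.toNat + b.toNat)))
    {κ : Type*} [Fintype κ] {u : IA → κ → ℝ} {v : IB → κ → ℝ} (hu : ∀ x, ∑ i, u x i * u x i = 1)
    (hv : ∀ y, ∑ i, v y i * v y i = 1) :
    1 / 2 + 1 / 2 * ∑ x, ∑ y, G.weight g x y * ∑ i, u x i * v y i ≤ G.quantumValue := by
  classical
  obtain ⟨d, hd, γ₀, h1, h2, h3⟩ := exists_anticommuting (Fintype.card κ)
  let γ : κ → Matrix (Fin d) (Fin d) ℂ := fun i => γ₀ (Fintype.equivFin κ i)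
  have hγ : ∀ i j, γ i * γ j + γ j * γ i = if i = j then 2 else 0 := fun i j => by
    rw [h3]; simp
  have hherm : ∀ v : κ → ℝ, (cliffordSum γ v).IsHermitian := fun v => by
    rw [Matrix.IsHermitian, cliffordSum, Matrix.conjTranspose_sum]
    refine Finset.sum_congr rfl fun i _ => ?_
    rw [Matrix.conjTranspose_smul, (h2 _).eq]
    simp [γ]
  have htr : ∀ v : κ → ℝ, (cliffordSum γ v).transpose = cliffordSum γ v := fun v => by
    rw [cliffordSum, Matrix.transpose_sum]
    refine Finset.sum_congr rfl fun i _ => ?_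
    rw [Matrix.transpose_smul, h1]
  have hd' : (0 : ℝ) < d := by exact_mod_cast hd
  let c : ℂ := ((Real.sqrt d)⁻¹ : ℝ)
  have hc : star c * c = ((d : ℝ)⁻¹ : ℝ) := by
    simp only [c, RCLike.star_def, Complex.conj_ofReal]
    rw [← Complex.ofReal_mul, ← mul_inv, Real.mul_self_sqrt hd'.le]
  -- The state is maximally entangled, so `⟨A ⊗ B⟩ = tr(A Bᵀ) / d`; the symmetry of the Clifford
  -- matrices disposes of the transpose.
  let S : QuantumStrategy IA IB Bool Bool :=
    { dA := d
      dB := d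
      ψ := fun x => if x.1 = x.2 then c else 0
      ψ_norm := by
        have h : ‖c‖ ^ 2 = (d : ℝ)⁻¹ := by
          rw [Complex.norm_real, Real.norm_of_nonneg (by positivity), inv_pow,
            Real.sq_sqrt hd'.le]
        simp only [Fintype.sum_prod_type, apply_ite (fun z : ℂ => ‖z‖ ^ 2), h]
        simp [hd'.ne']
      A := fun x => signProj (cliffordSum γ (u x))
      B := fun y => signProj (cliffordSum γ (v y))
      A_pvm := fun x => isPVM_signProj (hherm _) (cliffordSum_mul_self hγ (hu x))
      B_pvm := fun y => isPVM_signProj (hherm _) (cliffordSum_mul_self hγ (hv y)) }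
  have hval : ∀ A B : Matrix (Fin d) (Fin d) ℂ, expval S.ψ (A ⊗ₖ B) =
      (d : ℝ)⁻¹ * (A * B.transpose).trace.re := by
    intro A B
    rw [expval_eq_re_quadForm, quadForm_kronecker, hc, Complex.re_ofReal_mul]
  have hsum : ∀ x y, (∑ a, ∑ b, expval S.ψ (S.A x a ⊗ₖ S.B y b)) = 1 := by
    intro x y
    have e1 : ∑ a, ∑ b, (S.A x a * (S.B y b).transpose).trace = d := by
      have e2 : ∀ a, ∑ b, (S.A x a * (S.B y b).transpose).trace =
          (S.A x a * (∑ b, S.B y b).transpose).trace := fun a => by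
        rw [Matrix.transpose_sum, Finset.mul_sum, Matrix.trace_sum]
      simp only [e2]
      rw [← Matrix.trace_sum, ← Finset.sum_mul, (S.A_pvm x).sum_eq_one, (S.B_pvm y).sum_eq_one,
        Matrix.transpose_one, one_mul]
      exact (Matrix.trace_one).trans (by simp [S])
    simp only [hval, ← Finset.mul_sum, ← Complex.re_sum, e1]
    simp [hd'.ne']
  have hcor : ∀ x y, (∑ a, ∑ b, boolSign a * boolSign b * expval S.ψ (S.A x a ⊗ₖ S.B y b)) =
      ∑ i, u x i * v y i := by
    intro x y
    have e1 : ∀ O : Matrix (Fin d) (Fin d) ℂ, signProj O false - signProj O true = O := fun O => by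
      simp [signProj, boolSign]
      module
    have e2 : (d : ℝ)⁻¹ * ((cliffordSum γ (u x) * (cliffordSum γ (v y)).transpose).trace).re =
        ∑ i, u x i * v y i := by
      rw [htr, trace_cliffordSum_mul hγ, ← Complex.ofReal_natCast, ← Complex.ofReal_mul,
        Complex.ofReal_re]
      field_simp
    rw [← e2]
    conv_rhs => rw [← e1 (cliffordSum γ (u x)), ← e1 (cliffordSum γ (v y))]
    simp only [hval, Fintype.sum_bool, boolSign, Matrix.transpose_sub, sub_mul, mul_sub,
      Matrix.trace_sub, Complex.sub_re, S]
    simp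
    ring
  refine le_trans (le_of_eq ?_) (le_csSup G.bddAbove_range_winProb ⟨S, rfl⟩)
  simp only [NonlocalGame.winProb]
  have h4 : ∀ x y, G.prob x y * (∑ a, ∑ b,
      if G.wins x y a b then expval S.ψ (S.A x a ⊗ₖ S.B y b) else 0) =
      1 / 2 * G.prob x y + 1 / 2 * (G.weight g x y * ∑ i, u x i * v y i) := by
    intro x y
    rw [sum_wins_mul (hg x y), hsum, hcor, NonlocalGame.weight]
    ring
  simp only [h4, Finset.sum_add_distrib, ← Finset.mul_sum, G.prob_sum]
  ring

/-- Optimal vectors for the first player. -/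
lemma NonlocalGame.sqrt_le_quantumValue (G : NonlocalGame IA IB Bool Bool) {g : IA → IB → Bool}
    (hg : ∀ x y a b, (if G.wins x y a b then (1 : ℝ) else 0) =
      1 / 2 * (1 + (-1) ^ (g x y).toNat * (-1) ^ (a.toNat + b.toNat)))
    {κ : Type*} [Fintype κ] {v : IB → κ → ℝ} (hv : ∀ y, ∑ i, v y i * v y i = 1) :
    1 / 2 + 1 / 2 * ∑ x, Real.sqrt (∑ i, (∑ y, G.weight g x y * v y i) ^ 2) ≤
      G.quantumValue := by
  obtain ⟨y₀⟩ : Nonempty IB := by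
    by_contra h
    rw [not_nonempty_iff] at h
    have := G.prob_sum
    simp at this
  set ξ : IA → κ → ℝ := fun x i => ∑ y, G.weight g x y * v y i with hξ
  set m : IA → ℝ := fun x => ∑ i, ξ x i ^ 2 with hm
  have hm0 : ∀ x, 0 ≤ m x := fun x => Finset.sum_nonneg fun i _ => sq_nonneg _
  -- The unit vector in the direction of `ξ x` attains equality in Cauchy–Schwarz. If `ξ x = 0`, any
  -- unit vector will do.
  let u : IA → κ → ℝ := fun x => if m x = 0 then v y₀ else fun i => ξ x i / Real.sqrt (m x)
  have hu : ∀ x, ∑ i, u x i * u x i = 1 := by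
    intro x
    by_cases h : m x = 0
    · simp only [u, if_pos h]
      exact hv y₀
    · simp only [u, if_neg h, div_mul_div_comm, Real.mul_self_sqrt (hm0 x)]
      rw [← Finset.sum_div, div_eq_one_iff_eq h, hm]
      exact Finset.sum_congr rfl fun i _ => by ring
  have hcor : ∀ x, ∑ y, G.weight g x y * ∑ i, u x i * v y i = Real.sqrt (m x) := by
    intro x
    have h1 : ∑ y, G.weight g x y * ∑ i, u x i * v y i = ∑ i, u x i * ξ x i := by
      simp only [hξ, Finset.mul_sum]
      rw [Finset.sum_comm]
      exact Finset.sum_congr rfl fun i _ => Finset.sum_congr rfl fun y _ => by ring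
    rw [h1]
    by_cases h : m x = 0
    · have h2 : ∀ i, ξ x i = 0 := fun i => by
        have := (Finset.sum_eq_zero_iff_of_nonneg fun i _ => sq_nonneg (ξ x i)).1 h i
          (Finset.mem_univ _)
        exact pow_eq_zero_iff two_ne_zero |>.1 this
      simp [h2, h]
    · simp only [u, if_neg h]
      have h3 : ∀ i, ξ x i / Real.sqrt (m x) * ξ x i = ξ x i ^ 2 / Real.sqrt (m x) := fun i => by
        ring
      simp only [h3]
      rw [← Finset.sum_div]
      exact Real.div_sqrt
  have := G.vector_le_quantumValue hg hu hv
  simpa only [hcor] using this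

end Values

/-! ## Ensembles of states -/

section Ensembles

variable {IA IB : Type*} {J ι : Type*} [Fintype J] [Fintype ι]

/-- The real inner products of the vectors `O y φ`, in expectation. -/
def gram (p : J → ℝ) (φ : J → ι → ℂ) (O : IB → Matrix ι ι ℂ) (y y' : IB) : ℝ :=
  ∑ j, p j * (star ((O y).mulVec (φ j)) ⬝ᵥ (O y').mulVec (φ j)).re

/-- The coordinates of the vectors `O y φ`, as real numbers. -/
def realCoord (p : J → ℝ) (φ : J → ι → ℂ) (O : IB → Matrix ι ι ℂ) (y : IB) :
    (J × ι) × Bool → ℝ :=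
  fun i => Real.sqrt (p i.1.1) * if i.2 then ((O y).mulVec (φ i.1.1) i.1.2).re
    else ((O y).mulVec (φ i.1.1) i.1.2).im

variable {p : J → ℝ} {φ : J → ι → ℂ} {O : IB → Matrix ι ι ℂ}

/-- The real part of a complex inner product is the inner product of real and imaginary parts, and
each weight enters once through two square roots. So `gram` is a Gram matrix of real vectors. -/
lemma sum_realCoord_mul (hp : ∀ j, 0 ≤ p j) (y y' : IB) :
    ∑ i, realCoord p φ O y i * realCoord p φ O y' i = gram p φ O y y' := by
  simp only [Fintype.sum_prod_type, gram, realCoord, Fintype.sum_bool, if_true, dotProduct,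
    Complex.re_sum, Finset.mul_sum]
  refine Finset.sum_congr rfl fun j _ => Finset.sum_congr rfl fun s _ => ?_
  have h := Real.mul_self_sqrt (hp j)
  simp only [Pi.star_apply, RCLike.star_def, Complex.mul_re, Complex.conj_re, Complex.conj_im,
    Bool.false_eq_true, if_false]
  linear_combination (((O y).mulVec (φ j) s).re * ((O y').mulVec (φ j) s).re +
    ((O y).mulVec (φ j) s).im * ((O y').mulVec (φ j) s).im) * h

lemma sum_sq_realCoord [Fintype IB] (hp : ∀ j, 0 ≤ p j) (w : IB → ℝ) :
    ∑ i, (∑ y, w y * realCoord p φ O y i) ^ 2 = ∑ y, ∑ y', w y * w y' * gram p φ O y y' := by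
  have h : ∀ i, (∑ y, w y * realCoord p φ O y i) ^ 2 =
      ∑ y, ∑ y', w y * w y' * (realCoord p φ O y i * realCoord p φ O y' i) := fun i => by
    rw [sq, Finset.sum_mul_sum]
    exact Finset.sum_congr rfl fun y _ => Finset.sum_congr rfl fun y' _ => by ring
  simp only [h, ← sum_realCoord_mul hp, Finset.mul_sum]
  rw [Finset.sum_comm]
  refine Finset.sum_congr rfl fun y _ => ?_
  rw [Finset.sum_comm]

lemma gram_self [DecidableEq ι] (hO : ∀ y, (O y).IsHermitian) (hO' : ∀ y, O y * O y = 1)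
    (hφ : ∑ j, p j * ∑ s, ‖φ j s‖ ^ 2 = 1) (y : IB) : gram p φ O y y = 1 := by
  rw [← hφ, gram]
  refine Finset.sum_congr rfl fun j _ => ?_
  have h : star ((O y).mulVec (φ j)) ⬝ᵥ (O y).mulVec (φ j) = quadForm 1 (φ j) := by
    have := quadForm_conj 1 (O y) (φ j)
    rw [(hO y).eq, mul_one, hO' y] at this
    rw [this, quadForm, Matrix.one_mulVec]
  rw [h, quadForm_one, Complex.ofReal_re]

lemma NonlocalGame.gram_le_quantumValue [Fintype IA] [Fintype IB] [DecidableEq ι] (G : NonlocalGame IA IB Bool Bool)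
    {g : IA → IB → Bool} (hg : ∀ x y a b, (if G.wins x y a b then (1 : ℝ) else 0) =
      1 / 2 * (1 + (-1) ^ (g x y).toNat * (-1) ^ (a.toNat + b.toNat)))
    (hp : ∀ j, 0 ≤ p j) (hO : ∀ y, (O y).IsHermitian) (hO' : ∀ y, O y * O y = 1)
    (hφ : ∑ j, p j * ∑ s, ‖φ j s‖ ^ 2 = 1) :
    1 / 2 + 1 / 2 * ∑ x, Real.sqrt (∑ y, ∑ y', G.weight g x y * G.weight g x y' *
      gram p φ O y y') ≤ G.quantumValue := by
  have := G.sqrt_le_quantumValue hg (v := realCoord p φ O) fun y => by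
    rw [sum_realCoord_mul hp, gram_self hO hO' hφ]
  simpa only [sum_sq_realCoord hp] using this

/-- Cauchy–Schwarz between the ensemble `φ`, of total norm one, and the ensemble of the vectors `∑_y
w y O y φ`. The signs `ε` need only be bounded, so the decrypted answer, and with it the secret key,
disappears from the estimate. -/
lemma sum_correlation_le_sqrt [Fintype IB] (hp : ∀ j, 0 ≤ p j) (hφ : ∑ j, p j * ∑ s, ‖φ j s‖ ^ 2 = 1)
    {ε : J → ℝ} (hε : ∀ j, |ε j| ≤ 1) (w : IB → ℝ) :
    ∑ y, w y * ∑ j, p j * (ε j * expval (φ j) (O y)) ≤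
      Real.sqrt (∑ y, ∑ y', w y * w y' * gram p φ O y y') := by
  set ξ : J → ι → ℂ := fun j s => ∑ y, (w y : ℂ) * (O y).mulVec (φ j) s with hξ
  have h1 : ∑ y, w y * ∑ j, p j * (ε j * expval (φ j) (O y)) =
      ∑ j, ∑ s, p j * (ε j * (star (φ j s) * ξ j s).re) := by
    simp only [Finset.mul_sum]
    rw [Finset.sum_comm]
    refine Finset.sum_congr rfl fun j _ => ?_
    simp only [expval, dotProduct, Complex.re_sum, hξ, Finset.mul_sum, Pi.star_apply]
    rw [Finset.sum_comm]
    refine Finset.sum_congr rfl fun s _ => Finset.sum_congr rfl fun y _ => ?_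
    have : star (φ j s) * ((w y : ℂ) * (O y).mulVec (φ j) s) =
      (w y : ℂ) * (star (φ j s) * (O y).mulVec (φ j) s) := by ring
    rw [this, Complex.re_ofReal_mul]
    ring
  have h2 : ∑ j, ∑ s, p j * (ε j * (star (φ j s) * ξ j s).re) ≤
      ∑ x : J × ι, (Real.sqrt (p x.1) * ‖φ x.1 x.2‖) * (Real.sqrt (p x.1) * ‖ξ x.1 x.2‖) := by
    rw [Fintype.sum_prod_type]
    refine Finset.sum_le_sum fun j _ => Finset.sum_le_sum fun s _ => ?_
    have e1 : ε j * (star (φ j s) * ξ j s).re ≤ ‖φ j s‖ * ‖ξ j s‖ := by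
      refine (le_abs_self _).trans ?_
      rw [abs_mul]
      have e2 := Complex.abs_re_le_norm (star (φ j s) * ξ j s)
      rw [norm_mul, norm_star] at e2
      exact (mul_le_mul (hε j) e2 (abs_nonneg _) zero_le_one).trans (by rw [one_mul])
    refine (mul_le_mul_of_nonneg_left e1 (hp j)).trans (le_of_eq ?_)
    linear_combination (-‖φ j s‖ * ‖ξ j s‖) * Real.mul_self_sqrt (hp j)
  have h3 : ∑ x : J × ι, (Real.sqrt (p x.1) * ‖φ x.1 x.2‖) ^ 2 = 1 := by
    rw [← hφ, Fintype.sum_prod_type]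
    simp only [mul_pow, Real.sq_sqrt (hp _), Finset.mul_sum]
  have h4 : ∑ x : J × ι, (Real.sqrt (p x.1) * ‖ξ x.1 x.2‖) ^ 2 =
      ∑ y, ∑ y', w y * w y' * gram p φ O y y' := by
    rw [← sum_sq_realCoord hp, Fintype.sum_prod_type, Fintype.sum_prod_type,
      Fintype.sum_prod_type]
    refine Finset.sum_congr rfl fun j _ => Finset.sum_congr rfl fun s _ => ?_
    rw [Fintype.sum_bool, mul_pow, Real.sq_sqrt (hp j), ← Complex.normSq_eq_norm_sq,
      Complex.normSq_apply]
    have e1 : ∀ f : IB → ℝ, ∑ y, w y * (Real.sqrt (p j) * f y) =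
        Real.sqrt (p j) * ∑ y, w y * f y := fun f => by
      rw [Finset.mul_sum]
      exact Finset.sum_congr rfl fun y _ => by ring
    simp only [realCoord, if_true, Bool.false_eq_true, if_false, e1, mul_pow, Real.sq_sqrt (hp j)]
    simp only [hξ, Complex.re_sum, Complex.im_sum, Complex.re_ofReal_mul, Complex.im_ofReal_mul]
    ring
  rw [h1]
  refine h2.trans (Real.le_sqrt_of_sq_le ?_)
  refine (Finset.sum_mul_sq_le_sq_mul_sq _ _ _).trans ?_
  rw [h3, h4, one_mul]

end Ensembles

/-! ### Closure properties of negligible functions -/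

section Negligible

lemma Negligible.add {f g : ℕ → ℝ} (hf : Negligible f) (hg : Negligible g) :
    Negligible fun l => f l + g l :=
  Asymptotics.SuperpolynomialDecay.add hf hg

lemma Negligible.const_mul {f : ℕ → ℝ} (hf : Negligible f) (c : ℝ) :
    Negligible fun l => c * f l :=
  Asymptotics.SuperpolynomialDecay.const_mul hf c

lemma Negligible.sum {κ : Type*} (s : Finset κ) {f : κ → ℕ → ℝ} (hf : ∀ i ∈ s, Negligible (f i)) :
    Negligible fun l => ∑ i ∈ s, f i l := by
  classical
  induction s using Finset.induction_on with
  | empty =>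
    simp only [Finset.sum_empty]
    exact Asymptotics.superpolynomialDecay_zero (β := ℝ) Filter.atTop _
  | insert i s hi ih =>
    simp only [Finset.sum_insert hi]
    exact (hf i (Finset.mem_insert_self _ _)).add
      (ih fun j hj => hf j (Finset.mem_insert_of_mem hj))

/-- Decay of `f` against the power `2 * k` gives decay of its square root against the power `k`. -/
lemma Negligible.sqrt {f : ℕ → ℝ} (hf : Negligible f) :
    Negligible fun l => Real.sqrt (f l) := by
  intro k
  have h := (hf (2 * k)).sqrt
  rw [Real.sqrt_zero] at h
  refine h.congr fun l => ?_
  rw [Real.sqrt_mul (by positivity), mul_comm 2 k, pow_mul, Real.sqrt_sq (by positivity)]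

end Negligible

/-! ## Compiled XOR games -/

section Observables

variable {ι : Type*} [Fintype ι]

/-- The observable of a measurement with two outcomes. -/
def observable (E : Bool → Matrix ι ι ℂ) : Matrix ι ι ℂ := E false - E true

variable {E E' : Bool → Matrix ι ι ℂ}

lemma expval_observable (φ : ι → ℂ) :
    expval φ (observable E) = expval φ (E false) - expval φ (E true) := by
  simp only [expval, observable, Matrix.sub_mulVec, dotProduct_sub, Complex.sub_re]

variable [DecidableEq ι]

lemma IsPVM.add_eq_one (h : IsPVM E) : E true + E false = 1 := by
  rw [← h.sum_eq_one, Fintype.sum_bool]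

lemma IsPVM.isHermitian_observable (h : IsPVM E) : (observable E).IsHermitian :=
  (h.hermitian _).sub (h.hermitian _)

lemma IsPVM.observable_mul_self (h : IsPVM E) : observable E * observable E = 1 := by
  rw [observable, mul_sub, sub_mul, sub_mul, h.idem, h.idem, h.orth _ _ (by decide),
    h.orth _ _ (by decide), ← h.add_eq_one]
  abel

/-- The left side is the operator for two successive measurements giving different results. That the
first measurement disturbs the state symmetrizes the product of the observables, so the statistics
reveal the real part of the inner product, which is all that is needed. -/
lemma IsPVM.parity_eq (h : IsPVM E) (h' : IsPVM E') :
    E true * E' false * E true + E false * E' true * E false =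
      (1 / 2 : ℂ) • 1 - (1 / 4 : ℂ) •
        (observable E * observable E' + observable E' * observable E) := by
  have h1 : E false = 1 - E true := by rw [← h.add_eq_one]; abel
  have h2 : E' false = 1 - E' true := by rw [← h'.add_eq_one]; abel
  have e1 : E true * (1 - E' true) * E true + (1 - E true) * E' true * (1 - E true) =
      E true + E' true - E true * E' true - E' true * E true := by
    simp only [mul_sub, sub_mul, mul_one, one_mul, h.idem]
    abel
  have e2 : observable E * observable E' + observable E' * observable E =
      (2 : ℂ) • 1 - (4 : ℂ) •
        (E true + E' true - E true * E' true - E' true * E true) := by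
    simp only [observable, h1, h2, mul_sub, sub_mul, mul_one, one_mul]
    module
  rw [h1, h2, e1, e2]
  module

lemma IsPVM.expval_parity (h : IsPVM E) (h' : IsPVM E') (φ : ι → ℂ) :
    expval φ (E true * E' false * E true + E false * E' true * E false) =
      1 / 2 * ∑ s, ‖φ s‖ ^ 2 -
        1 / 2 * (star ((observable E).mulVec φ) ⬝ᵥ (observable E').mulVec φ).re := by
  have key : ∀ {E E' : Bool → Matrix ι ι ℂ}, IsPVM E →
      quadForm (observable E * observable E') φ =
        star ((observable E).mulVec φ) ⬝ᵥ (observable E').mulVec φ := by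
    intro E E' h
    rw [quadForm, Matrix.star_mulVec, h.isHermitian_observable.eq, ← Matrix.mulVec_mulVec,
      Matrix.dotProduct_mulVec]
  have hsymm : (star ((observable E').mulVec φ) ⬝ᵥ (observable E).mulVec φ).re =
      (star ((observable E).mulVec φ) ⬝ᵥ (observable E').mulVec φ).re := by
    rw [← Complex.conj_re, ← RCLike.star_def, ← Matrix.star_dotProduct_star, star_star]
  have h1 : ∀ (a b : ℂ) (A B : Matrix ι ι ℂ), quadForm (a • A - b • B) φ =
      a * quadForm A φ - b * quadForm B φ := by
    intro a b A B
    simp only [quadForm, Matrix.sub_mulVec, Matrix.smul_mulVec, dotProduct_sub, dotProduct_smul,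
      smul_eq_mul]
  have h2 : ∀ A B : Matrix ι ι ℂ, quadForm (A + B) φ = quadForm A φ + quadForm B φ := by
    intro A B
    simp only [quadForm, Matrix.add_mulVec, dotProduct_add]
  rw [expval_eq_re_quadForm, h.parity_eq h', h1, h2, key h, key h', quadForm_one]
  have e1 : (1 / 2 : ℂ) = ((1 / 2 : ℝ) : ℂ) := by push_cast; rfl
  have e2 : (1 / 4 : ℂ) = ((1 / 4 : ℝ) : ℂ) := by push_cast; rfl
  rw [e1, e2, Complex.sub_re, Complex.re_ofReal_mul, Complex.re_ofReal_mul, Complex.add_re, hsymm,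
    Complex.ofReal_re]
  ring

lemma IsPVM.sum_norm_sq (h : IsPVM E) (φ : ι → ℂ) :
    ∑ b, expval φ (E b) = ∑ s, ‖φ s‖ ^ 2 := by
  simp only [expval_eq_re_quadForm]
  rw [← Complex.re_sum, ← quadForm_sum, h.sum_eq_one, quadForm_one, Complex.ofReal_re]

end Observables

/-- One bit of the output distinguishes the two outcomes. -/
lemma QCircuit.sum_bit_eq {𝒢 : GateSet} (C : QCircuit 𝒢) {q k : ℕ} (hq : q ≤ C.width)
    (hk : k ≤ C.width) {E : Bool → Matrix (Bits q) (Bits q) ℂ} (hE : IsPVM E)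
    {ans : Bool → Bits k} (h : ∀ (φ : Bits q → ℂ) b, C.outcomeProb φ (ans b) = expval φ (E b))
    {i : Fin k} (hi : ans false i ≠ ans true i) (φ : Bits q → ℂ) (b : Bool) :
    (∑ s, if s (Fin.castLEEmb hk i) = ans b i then
      ‖C.mat.mulVec (withAncillas C.width φ) s‖ ^ 2 else 0) = expval φ (E b) := by
  set χ := C.mat.mulVec (withAncillas C.width φ) with hχ
  have hle : ∀ b, expval φ (E b) ≤
      ∑ s, if s (Fin.castLEEmb hk i) = ans b i then ‖χ s‖ ^ 2 else 0 := by
    intro b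
    rw [← h, C.outcomeProb_eq hk]
    refine Finset.sum_le_sum fun s _ => ?_
    split_ifs with h1 h2 h2
    · exact le_rfl
    · exact absurd (congrFun h1 i) h2
    · positivity
    · exact le_rfl
  -- Over the two answers, and over the two values of the bit, the probabilities add up to the
  -- squared norm of `φ`. Hence the inequalities `hle` are equalities.
  have hsum : (∑ b, ∑ s, if s (Fin.castLEEmb hk i) = ans b i then ‖χ s‖ ^ 2 else 0) =
      ∑ b, expval φ (E b) := by
    rw [hE.sum_norm_sq, Finset.sum_comm, ← sum_norm_sq_place (Fin.castLEEmb hq) (fun _ => false),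
      ← withAncillas_eq_place, ← sum_norm_sq_mulVec (opsMat_unitary C.ops)]
    refine Finset.sum_congr rfl fun s _ => ?_
    rw [Fintype.sum_bool]
    change _ = ‖χ s‖ ^ 2
    revert hi
    cases s (Fin.castLEEmb hk i) <;> cases ans false i <;> cases ans true i <;> simp
  rw [Fintype.sum_bool, Fintype.sum_bool] at hsum
  have h1 := hle true
  have h2 := hle false
  cases b <;> linarith

/-! ### The ensemble of runs of the compiled game -/

section Expectations

variable {𝒢 : GateSet} {IA IB OA OB : Type*} [Fintype IA] [Fintype IB]

namespace QHEScheme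

variable (Q : QHEScheme 𝒢) (l : ℕ) {n : ℕ}

/-- Random bits of the key generation and the encryption of `n` bits. -/
abbrev Coins (n : ℕ) : Type := Bits (Q.Gen.coins ![l]) × Bits (Q.Enc.coins ![l, n])

/-- The key for given random bits. -/
def keyOf (ω : Q.Coins l n) : Bits (Q.skLen l) := Q.Gen.run ![l] Fin.elim0 ω.1

/-- The ciphertext for given random bits. -/
def ctOf (x : Bits n) (ω : Q.Coins l n) : Bits (Q.ctLen l n) :=
  Q.Enc.run ![l, n] (Fin.append (Q.keyOf l ω) x) ω.2

lemma isCiphertext_ctOf (x : Bits n) (ω : Q.Coins l n) : Q.IsCiphertext l x (Q.ctOf l x ω) :=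
  ⟨_, ⟨ω.1, rfl⟩, ⟨ω.2, rfl⟩⟩

/-- The probability of each choice of random bits. -/
def coinProb (n : ℕ) : ℝ := (2 ^ Q.Gen.coins ![l])⁻¹ * (2 ^ Q.Enc.coins ![l, n])⁻¹

lemma coinProb_nonneg (n : ℕ) : 0 ≤ Q.coinProb l n := by
  unfold coinProb
  positivity

lemma sum_coinProb (n : ℕ) : ∑ _ω : Q.Coins l n, Q.coinProb l n = 1 := by
  rw [Finset.sum_const, Finset.card_univ, Fintype.card_prod]
  simp [coinProb]
  field_simp

lemma expect_eq (x : Bits n) (f : Bits (Q.skLen l) → Bits (Q.ctLen l n) → ℝ) :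
    (Q.expectKey l fun sk => Q.expectEnc l sk x (f sk)) =
      ∑ ω : Q.Coins l n, Q.coinProb l n * f (Q.keyOf l ω) (Q.ctOf l x ω) := by
  simp only [expectKey, expectEnc, PPT.expect, Fintype.sum_prod_type, keyOf, ctOf, coinProb,
    div_eq_inv_mul, Finset.mul_sum, mul_assoc]

end QHEScheme

namespace CompiledStrategy

variable {G : CompiledGame 𝒢 IA IB Bool Bool} (S : CompiledStrategy G) (l : ℕ)

/-- Random bits and answers to the first question. -/
abbrev Runs : Type := G.qhe.Coins l G.msgLen × Bits (S.ansLen l)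

/-- The weight of a run. -/
def runProb (_ : S.Runs l) : ℝ := G.qhe.coinProb l G.msgLen

/-- The state after the answer to the question `x`. -/
def runState (x : IA) (j : S.Runs l) : Bits (S.qubits l) → ℂ :=
  S.post l (G.qhe.ctOf l (G.question x) j.1) j.2

lemma isQuestion_ctOf (x : IA) (ω : G.qhe.Coins l G.msgLen) :
    G.IsQuestion l (G.qhe.ctOf l (G.question x) ω) :=
  ⟨x, G.qhe.isCiphertext_ctOf l _ ω⟩

/-- The unitary preserves norms, so these squared norms are the outcome probabilities of `P l c`. -/
lemma sum_post_norm_sq {c : Bits (G.ctLen l)} (hc : G.IsQuestion l c) :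
    ∑ α, ∑ s, ‖S.post l c α s‖ ^ 2 = 1 := by
  have h1 : ∀ α, ∑ s, ‖S.post l c α s‖ ^ 2 = expval (S.ψ l) (S.P l c α) := by
    intro α
    rw [post, ← Matrix.mulVec_mulVec, sum_norm_sq_mulVec (S.U_unitary l c α hc)]
    have h := quadForm_conj 1 (S.P l c α) (S.ψ l)
    rw [((S.P_pvm l c hc).hermitian α).eq, mul_one, (S.P_pvm l c hc).idem, quadForm_one] at h
    rw [expval_eq_re_quadForm, h, Complex.ofReal_re]
  simp only [h1, expval_eq_re_quadForm]
  rw [← Complex.re_sum, ← quadForm_sum, (S.P_pvm l c hc).sum_eq_one, quadForm_one, S.ψ_norm]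
  rfl

lemma sum_runProb (x : IA) :
    ∑ j, S.runProb l j * ∑ s, ‖S.runState l x j s‖ ^ 2 = 1 := by
  rw [Fintype.sum_prod_type, ← G.qhe.sum_coinProb l G.msgLen]
  refine Finset.sum_congr rfl fun ω _ => ?_
  simp only [runProb, runState]
  rw [← Finset.mul_sum, S.sum_post_norm_sq l (isQuestion_ctOf l x ω), mul_one]

/-- The Gram matrix of the second player's observables after the question `x`. -/
def runGram (x : IA) : IB → IB → ℝ :=
  gram (S.runProb l) (S.runState l x) fun y => observable (S.B l y)

lemma answerProb_eq (x : IA) (y : IB) (a b : Bool) : S.answerProb l x y a b =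
    ∑ j, S.runProb l j *
      if List.ofFn (G.qhe.dec l (S.ansLen l) (G.qhe.keyOf l j.1) j.2) = G.answerA a then
        expval (S.runState l x j) (S.B l y b) else 0 := by
  rw [answerProb, G.qhe.expect_eq l (G.question x) fun sk c => ∑ α,
    if List.ofFn (G.qhe.dec l (S.ansLen l) sk α) = G.answerA a then
      expval (S.post l c α) (S.B l y b) else 0]
  simp only [Fintype.sum_prod_type, Finset.mul_sum]
  rfl

/-- The sign of the decrypted answer. -/
def runSign (j : S.Runs l) : ℝ := ∑ a, boolSign a *
  if List.ofFn (G.qhe.dec l (S.ansLen l) (G.qhe.keyOf l j.1) j.2) = G.answerA a then 1 else 0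

/-- At most one answer matches the decrypted string; if none does, the sign is `0`. -/
lemma abs_runSign_le (j : S.Runs l) : |S.runSign l j| ≤ 1 := by
  have : G.answerA true ≠ G.answerA false := fun h => by simpa using G.answerA.injective h
  rw [runSign, Fintype.sum_bool]
  split_ifs with h1 h2
  · exact absurd (h1.symm.trans h2) this
  all_goals simp [boolSign]

/-- Equality may fail, because runs whose decrypted string encodes no answer are lost. -/
lemma sum_answerProb_le (x : IA) (y : IB) : ∑ a, ∑ b, S.answerProb l x y a b ≤ 1 := by
  have : G.answerA true ≠ G.answerA false := fun h => by simpa using G.answerA.injective h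
  simp only [answerProb_eq]
  simp only [Finset.sum_comm (t := (Finset.univ : Finset (S.Runs l))), ← Finset.mul_sum]
  rw [← S.sum_runProb l x]
  refine Finset.sum_le_sum fun j _ => mul_le_mul_of_nonneg_left ?_ (G.qhe.coinProb_nonneg l _)
  rw [← (S.B_pvm l y).sum_norm_sq]
  have h0 : 0 ≤ ∑ b, expval (S.runState l x j) (S.B l y b) := by
    rw [(S.B_pvm l y).sum_norm_sq]
    positivity
  rw [Fintype.sum_bool]
  split_ifs with h1 h2
  · exact absurd (h1.symm.trans h2) this
  · simp
  · simp
  · simpa using h0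

lemma sum_sign_answerProb (x : IA) (y : IB) :
    ∑ a, ∑ b, boolSign a * boolSign b * S.answerProb l x y a b =
      ∑ j, S.runProb l j *
        (S.runSign l j * expval (S.runState l x j) (observable (S.B l y))) := by
  simp only [answerProb_eq, Finset.mul_sum]
  simp only [Finset.sum_comm (t := (Finset.univ : Finset (S.Runs l)))]
  refine Finset.sum_congr rfl fun j _ => ?_
  rw [expval_observable, runSign]
  simp only [Fintype.sum_bool, boolSign]
  split_ifs <;> simp <;> ring

/-- For each `x`, `sum_correlation_le_sqrt` is applied with the decrypted sign as `ε`; the total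
mass contributes at most `1/2`. -/
lemma winProb_le {g : IA → IB → Bool}
    (hg : ∀ x y a b, (if G.game.wins x y a b then (1 : ℝ) else 0) =
      1 / 2 * (1 + (-1) ^ (g x y).toNat * (-1) ^ (a.toNat + b.toNat))) :
    S.winProb l ≤ 1 / 2 + 1 / 2 * ∑ x, Real.sqrt (∑ y, ∑ y',
      G.game.weight g x y * G.game.weight g x y' * S.runGram l x y y') := by
  have h1 : ∀ x y, G.game.prob x y * (∑ a, ∑ b,
      if G.game.wins x y a b then S.answerProb l x y a b else 0) ≤
      1 / 2 * G.game.prob x y + 1 / 2 * (G.game.weight g x y * ∑ j, S.runProb l j *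
        (S.runSign l j * expval (S.runState l x j) (observable (S.B l y)))) := by
    intro x y
    rw [sum_wins_mul (hg x y), sum_sign_answerProb, NonlocalGame.weight]
    have := mul_le_mul_of_nonneg_left (S.sum_answerProb_le l x y) (G.game.prob_nonneg x y)
    linarith
  refine (Finset.sum_le_sum fun x _ => Finset.sum_le_sum fun y _ => h1 x y).trans ?_
  simp only [Finset.sum_add_distrib, ← Finset.mul_sum, G.game.prob_sum]
  rw [mul_one]
  have h2 : ∀ x, _ ≤ _ := fun x => sum_correlation_le_sqrt (p := S.runProb l)
    (O := fun y => observable (S.B l y)) (fun _ => G.qhe.coinProb_nonneg l _)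
    (S.sum_runProb l x) (S.abs_runSign_le l) (G.game.weight g x)
  gcongr with x
  exact h2 x

end CompiledStrategy

end Expectations

/-! ### Reduction to CPA security -/

section Security

variable {𝒢 : GateSet} {IA IB : Type*} [Fintype IA] [Fintype IB]

lemma UniformFamily.uniformTable {Op : ℕ → ℕ → Type} [∀ l, OpCode (Op l)]
    {C : ∀ l, Circuit (Op l)} (h : UniformFamily fun v : Fin 1 → ℕ => C (v 0)) :
    UniformTable fun l => (C l).desc :=
  LogspaceUniform.uniformTable (g := fun _ l => l) h fun _ => .id

lemma CompiledGame.logspaceFun_ctLen {OA OB : Type*} (G : CompiledGame 𝒢 IA IB OA OB) :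
    LogspaceFun fun l => G.ctLen l := by
  have h := LogspaceUniform.uniformTable (g := ![fun l => l, fun _ => G.msgLen])
    G.qhe.Enc.uniform fun i => by
      fin_cases i
      · exact LogspaceFun.id
      · exact LogspaceFun.const _
  have h' : ∀ l, (fun i => (![fun l => l, fun _ => G.msgLen] : Fin 2 → ℕ → ℕ) i l) =
      ![l, G.msgLen] := fun l => by
    funext i
    fin_cases i <;> rfl
  simp only [h'] at h
  exact h.outs_desc

/-- `t` stands for the value of the measured bit that encodes `true`. Both results are relabelled by
the same `t`, so whether they differ does not depend on it. -/
lemma sum_parity {ι : Type*} [Fintype ι] {E : Bool → Matrix ι ι ℂ}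
    (hE : ∀ b, (E b).IsHermitian) (E' : Bool → Matrix ι ι ℂ) (t : Bool) :
    (∑ β : Bits 1, ∑ β' : Bits 1, if xor (β 0) (β' 0) = true then
      (E (β 0 == t)).conjTranspose * E' (β' 0 == t) * E (β 0 == t) else 0) =
      E true * E' false * E true + E false * E' true * E false := by
  have h : ∀ f : Bool → Matrix ι ι ℂ, ∑ β : Bits 1, f (β 0) = f true + f false := fun f => by
    rw [← Fintype.sum_bool]
    exact Fintype.sum_equiv (Equiv.funUnique (Fin 1) Bool) _ _ fun _ => rfl
  simp only [(hE _).eq]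
  have h' : ∀ u : Bool, (∑ β' : Bits 1, if xor u (β' 0) = true then
      E (u == t) * E' (β' 0 == t) * E (u == t) else 0) = E (u == t) * E' (!u == t) * E (u == t) := by
    intro u
    rw [h fun v => if xor u v = true then E (u == t) * E' (v == t) * E (u == t) else 0]
    cases u <;> simp
  simp only [h']
  rw [h fun u => E (u == t) * E' (!u == t) * E (u == t)]
  cases t <;> simp [add_comm]

/-- The answers are bit strings, but a single bit at which their encodings differ carries the
result, by `QCircuit.sum_bit_eq`. This lets one wire and two CNOTs handle the parity, with a third
to place it on the output wire. -/
lemma Attack.acceptProb_parity (X : Attack 𝒢) {len : ℕ → ℕ}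
    (answer : ∀ m, Bits m → (Bits (len m) → ℂ) → ℂ) (c : Bits X.n) {ψ : Bits X.q → ℂ}
    {P U : Bits X.a → Matrix (Bits X.q) (Bits X.q) ℂ}
    {E E' : Bool → Matrix (Bits X.q) (Bits X.q) ℂ} {k : ℕ} {ans : Bool → Bits k} {i : Fin k}
    (hi : ans false i ≠ ans true i) (hbit : X.bit = i.val)
    (hk : k ≤ X.fst.width) (hk' : k ≤ X.snd.width)
    (hprep : X.prep.outDensity X.q (ket (Fin.elim0 : Bits 0)) = Matrix.vecMulVec ψ (star ψ))
    (hP : ∀ α, P α * P α = P α)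
    (hmeas : ∀ φ α, X.meas.outcomeProb (ketTensor c φ) α = expval φ (P α))
    (hpost : ∀ α, P α ≠ 0 → ∀ φ : Bits X.q → ℂ,
      X.post.outDensity X.q (ketTensor (Fin.append c α) φ) =
        Matrix.vecMulVec ((U α).mulVec φ) (star ((U α).mulVec φ)))
    (hE : IsPVM E) (hE' : IsPVM E')
    (hfst : ∀ (φ : Bits X.q → ℂ) b, X.fst.outcomeProb φ (ans b) = expval φ (E b))
    (hsnd : ∀ (φ : Bits X.q → ℂ) b, X.snd.outcomeProb φ (ans b) = expval φ (E' b)) :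
    (X.circuit len).acceptProb answer c = ∑ α, expval ((U α * P α).mulVec ψ)
      (E true * E' false * E true + E false * E' true * E false) := by
  have hb : ∀ β : Bits 1, ans (β 0 == ans true i) i = β 0 := by
    intro β
    revert hi
    cases β 0 <;> cases h1 : ans false i <;> cases h2 : ans true i <;> simp [h1, h2]
  have hone : ∀ {w : ℕ} (hw : k ≤ w) (o : Fin 1 ↪ Fin w), (o 0).val = i.val →
      ∀ (s : Bits w) (β : Bits 1),
        (fun j => s (o j)) = β ↔ s (Fin.castLEEmb hw i) = ans (β 0 == ans true i) i := by
    intro w hw o ho s β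
    have : Fin.castLEEmb hw i = o 0 := Fin.ext ho.symm
    rw [hb, this]
    refine ⟨fun h => congrFun h 0, fun h => funext fun j => ?_⟩
    rw [Subsingleton.elim j 0]
    exact h
  rw [← sum_parity hE.hermitian E' (ans true i)]
  refine X.acceptProb_circuit answer c hprep hP hmeas hpost
    (R := fun β => E (β 0 == ans true i)) (R' := fun β => E' (β 0 == ans true i))
    (fun β => hE.idem _) (fun β => hE'.idem _) (fun φ β => ?_) fun φ β => ?_
  · simp only [hone hk X.o₃ (by simp [o₃, hbit])]
    exact X.fst.sum_bit_eq X.q_le_fst hk hE hfst hi φ _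
  · simp only [hone hk' X.o₄ (by simp [o₄, hbit])]
    exact X.snd.sum_bit_eq X.q_le_snd hk' hE' hsnd hi φ _

namespace CompiledStrategy

variable {G : CompiledGame 𝒢 IA IB Bool Bool} (S : CompiledStrategy G)

/-- The distinguishing advantage of the attack bounds the change of the Gram matrix. -/
lemma exists_adversary (y y' : IB) : ∃ A : ∀ l, Circuit (OracleOp 𝒢 (G.qhe.ctLen l)),
    UniformFamily (fun v : Fin 1 → ℕ => A (v 0)) ∧ (∀ l, (A l).ins = G.ctLen l) ∧
    (∀ l, (A l).outs = 1) ∧ ∀ l x, G.qhe.adversaryProb l (A l) (G.question x) =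
      1 / 2 - 1 / 2 * S.runGram l x y y' := by
  obtain ⟨C₀, hC₀, hψ⟩ := S.ψ_qpt
  obtain ⟨C₁, hC₁, hP⟩ := S.P_qpt
  obtain ⟨C₂, hC₂, hU⟩ := S.U_qpt
  obtain ⟨C₃, hC₃, hB⟩ := S.B_qpt y
  obtain ⟨C₄, hC₄, hB'⟩ := S.B_qpt y'
  obtain ⟨i, hi⟩ : ∃ i, G.answerB false i ≠ G.answerB true i :=
    Function.ne_iff.1 fun h => by simpa using G.answerB.injective h
  let X : ℕ → Attack 𝒢 := fun l =>
    { n := G.ctLen l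
      q := S.qubits l
      a := S.ansLen l
      prep := C₀ l
      meas := C₁ l
      post := C₂ l
      fst := C₃ l
      snd := C₄ l
      bit := i.val
      prep_outs := hC₀.outs_eq l
      meas_ins := hC₁.ins_eq l
      meas_outs := hC₁.outs_eq l
      post_ins := hC₂.ins_eq l
      post_outs := hC₂.outs_eq l
      fst_ins := hC₃.ins_eq l
      snd_ins := hC₄.ins_eq l
      bit_lt_fst := by rw [hC₃.outs_eq]; exact i.2
      bit_lt_snd := by rw [hC₄.outs_eq]; exact i.2 }
  have hX : Attack.IsUniform X :=
    { n := G.logspaceFun_ctLen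
      q := by
        have := (UniformFamily.uniformTable hC₀.uniform).outs_desc
        simpa only [hC₀.outs_eq] using this
      a := by
        have := (UniformFamily.uniformTable hC₁.uniform).outs_desc
        simpa only [hC₁.outs_eq] using this
      bit := LogspaceFun.const _
      prep := UniformFamily.uniformTable hC₀.uniform
      meas := UniformFamily.uniformTable hC₁.uniform
      post := UniformFamily.uniformTable hC₂.uniform
      fst := UniformFamily.uniformTable hC₃.uniform
      snd := UniformFamily.uniformTable hC₄.uniform }
  refine ⟨fun l => (X l).circuit (G.qhe.ctLen l), (hX.circuit fun l => G.qhe.ctLen l).logspaceUniform,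
    fun _ => rfl, fun _ => rfl, fun l x => ?_⟩
  have hk : G.ansLenB ≤ (C₃ l).width := hC₃.outs_eq l ▸ (C₃ l).outs_le
  have hk' : G.ansLenB ≤ (C₄ l).width := hC₄.outs_eq l ▸ (C₄ l).outs_le
  -- The circuit makes no queries, so the key influences acceptance only through the ciphertext.
  have hacc : ∀ ω, ((X l).circuit (G.qhe.ctLen l)).acceptProb
      (G.qhe.encOracle l (G.qhe.keyOf l ω)) (G.qhe.ctOf l (G.question x) ω) =
      ∑ α, expval (S.runState l x (ω, α)) (S.B l y true * S.B l y' false * S.B l y true +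
        S.B l y false * S.B l y' true * S.B l y false) := by
    intro ω
    have h : ∀ c, G.IsQuestion l c → ((X l).circuit (G.qhe.ctLen l)).acceptProb
        (G.qhe.encOracle l (G.qhe.keyOf l ω)) c = ∑ α, expval (S.post l c α)
          (S.B l y true * S.B l y' false * S.B l y true +
            S.B l y false * S.B l y' true * S.B l y false) := fun c hc =>
      @Attack.acceptProb_parity 𝒢 (X l) (G.qhe.ctLen l) _ c (S.ψ l) (S.P l c) (S.U l c) (S.B l y)
        (S.B l y') G.ansLenB G.answerB i hi rfl hk hk' (hψ l) (S.P_pvm l c hc).idem (hP l c hc)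
        (hU l c hc) (S.B_pvm l y) (S.B_pvm l y') (hB l) (hB' l)
    exact h _ (isQuestion_ctOf l x ω)
  rw [QHEScheme.adversaryProb, G.qhe.expect_eq l (G.question x) fun sk c =>
    ((X l).circuit (G.qhe.ctLen l)).acceptProb (G.qhe.encOracle l sk) c]
  have hsum : (∑ ω, G.qhe.coinProb l G.msgLen * ∑ α, expval (S.runState l x (ω, α))
      (S.B l y true * S.B l y' false * S.B l y true +
        S.B l y false * S.B l y' true * S.B l y false)) =
      ∑ j, S.runProb l j * expval (S.runState l x j)
        (S.B l y true * S.B l y' false * S.B l y true +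
          S.B l y false * S.B l y' true * S.B l y false) := by
    simp only [Fintype.sum_prod_type, Finset.mul_sum]
    rfl
  simp only [hacc]
  refine hsum.trans ?_
  have hone := S.sum_runProb l x
  simp only [(S.B_pvm l y).expval_parity (S.B_pvm l y'), mul_sub, Finset.sum_sub_distrib,
    runGram, gram, mul_left_comm _ (1 / 2 : ℝ), ← Finset.mul_sum, hone, mul_one]

lemma negligible_runGram (x x' : IA) (y y' : IB) :
    Negligible fun l => |S.runGram l x y y' - S.runGram l x' y y'| := by
  obtain ⟨A, h1, h2, h3, h4⟩ := S.exists_adversary y y'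
  -- The distinguishing advantage is half the change of the Gram entry.
  have := (G.qhe.secure G.msgLen (G.question x) (G.question x') A h1 h2 h3).const_mul 2
  refine Asymptotics.SuperpolynomialDecay.congr this fun l => ?_
  rw [h4, h4]
  have : (1 / 2 - 1 / 2 * S.runGram l x y y') - (1 / 2 - 1 / 2 * S.runGram l x' y y') =
      -(1 / 2 * (S.runGram l x y y' - S.runGram l x' y y')) := by ring
  rw [this, abs_neg, abs_mul]
  rw [abs_of_pos (by norm_num : (0 : ℝ) < 1 / 2)]
  ring

end CompiledStrategy

end Security

lemma Real.sqrt_add_le_add_sqrt {a b : ℝ} (hb : 0 ≤ b) : √(a + b) ≤ √a + √b := by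
  rcases le_total 0 a with ha | ha
  · refine Real.sqrt_le_iff.2 ⟨by positivity, ?_⟩
    have := Real.sq_sqrt ha
    have := Real.sq_sqrt hb
    have := mul_nonneg (Real.sqrt_nonneg a) (Real.sqrt_nonneg b)
    nlinarith
  · rw [Real.sqrt_eq_zero_of_nonpos ha, zero_add]
    exact Real.sqrt_le_sqrt (by linarith)

end

theorem theorem3p1 {IA IB : Type*} [Fintype IA] [Fintype IB] (𝒢 : GateSet)
    (G : CompiledGame 𝒢 IA IB Bool Bool) (hG : G.game.IsXOR) (S : CompiledStrategy G) :
    ∃ η : ℕ → ℝ, Negligible η ∧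
      ∀ l : ℕ, S.winProb l ≤ G.game.quantumValue + η l := by
  obtain ⟨g, hg⟩ := hG
  -- Any fixed question serves as reference.
  obtain ⟨x₀⟩ : Nonempty IA := by
    by_contra h
    rw [not_nonempty_iff] at h
    have := G.game.prob_sum
    simp at this
  let w := G.game.weight g
  -- Bounds the error in the quadratic form at `x` when the Gram matrix of `x` is replaced by that
  -- of `x₀`.
  let δ : IA → ℕ → ℝ := fun x l => ∑ y, ∑ y', |w x y * w x y'| *
    |S.runGram l x y y' - S.runGram l x₀ y y'|
  have hδ : ∀ x, Negligible (δ x) := fun x => Negligible.sum _ fun y _ => Negligible.sum _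
    fun y' _ => (S.negligible_runGram x x₀ y y').const_mul _
  refine ⟨fun l => 1 / 2 * ∑ x, Real.sqrt (δ x l),
    (Negligible.sum _ fun x _ => (hδ x).sqrt).const_mul _, fun l => ?_⟩
  have hle : ∀ x, ∑ y, ∑ y', w x y * w x y' * S.runGram l x y y' ≤
      (∑ y, ∑ y', w x y * w x y' * S.runGram l x₀ y y') + δ x l := by
    intro x
    simp only [δ, ← Finset.sum_add_distrib]
    refine Finset.sum_le_sum fun y _ => Finset.sum_le_sum fun y' _ => ?_
    have := le_abs_self (w x y * w x y' * (S.runGram l x y y' - S.runGram l x₀ y y'))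
    rw [abs_mul] at this
    linarith
  have hδ0 : ∀ x, 0 ≤ δ x l := fun x => by positivity
  -- The second player's vectors must not depend on `x`; the ensemble after `x₀` supplies one family
  -- of them for all questions.
  have hval := G.game.gram_le_quantumValue hg (p := S.runProb l) (φ := S.runState l x₀)
    (O := fun y => observable (S.B l y)) (fun _ => G.qhe.coinProb_nonneg l _)
    (fun y => (S.B_pvm l y).isHermitian_observable) (fun y => (S.B_pvm l y).observable_mul_self)
    (S.sum_runProb l x₀)
  have hsqrt : ∑ x, Real.sqrt (∑ y, ∑ y', w x y * w x y' * S.runGram l x y y') ≤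
      ∑ x, Real.sqrt (∑ y, ∑ y', w x y * w x y' * S.runGram l x₀ y y') +
        ∑ x, Real.sqrt (δ x l) := by
    rw [← Finset.sum_add_distrib]
    exact Finset.sum_le_sum fun x _ =>
      (Real.sqrt_le_sqrt (hle x)).trans (Real.sqrt_add_le_add_sqrt (hδ0 x))
  have hwin := S.winProb_le l hg
  change _ ≤ 1 / 2 + 1 / 2 * ∑ x, Real.sqrt (∑ y, ∑ y', w x y * w x y' * S.runGram l x y y') at hwin
  change 1 / 2 + 1 / 2 * ∑ x, Real.sqrt (∑ y, ∑ y', w x y * w x y' * S.runGram l x₀ y y') ≤ _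
    at hval
  linarith
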